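/- Let $n\ge 3$, $k>0$, and let $\mathbb H^n_{-k^2}=\{(x,t)\in\mathbb R^{n,1}: |x|^2-t^2=-1/k^2,\ t>0\}$ be hyperbolic space of curvature $-k^2$ in Minkowski space. Let $\Sigma$ be a compact connected smooth $(n-1)$-manifold (for instance a topological sphere) and $F:\Sigma\to\mathbb H^n_{-k^2}$ a smooth embedding whose image $\Sigma_0$ is the boundary of a bounded open region $\Omega_0$ of $\mathbb H^n_{-k^2}$ (lying locally on one side of $\Sigma_0$), with unit normal $N$ pointing out of $\Omega_0$. Assume that the metric induced on $\Sigma$ by $F$ has sectional curvature greater than $-k^2$. For $\rho\ge 0$ let $\Sigma_\rho$ be the equidistant hypersurface parametrized by $$X(p,\rho)=\cosh(k\rho)\,F(p)+\tfrac1k\sinh(k\rho)\,N(p),\qquad p\in\Sigma,$$ and denote by $g_\rho$, $d\Sigma_\rho$, $\Delta_\rho$, $R^\rho$ its induced metric, volume element, Laplacian and scalar curvature, and by $H_0(p,\rho)$ its mean curvature in $\mathbb H^n_{-k^2}$ with respect to the outward unit normal $\partial X/\partial\rho$. Let $u>0$ be a smooth function on $\Sigma\times[0,\infty)$ with $$2H_0\frac{\partial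 u}{\partial\rho}=2u^2\Delta_\rho u+(u-u^3)\bigl(R^\rho+n(n-1)k^2\bigr),$$ and let $H(p,\rho)$ be the mean curvature of $\Sigma_\rho$ in the metric $u^2d\rho^2+g_\rho$ with respect to the unit normal $u^{-1}\partial_\rho$. Then for every $\rho\ge0$ the integrands below are integrable, the left-hand integral is differentiable in $\rho$ (one-sidedly at $\rho=0$), and, as vectors of $\mathbb R^{n,1}$, $$\frac{d}{d\rho}\int_{\Sigma_\rho}(H_0-H)X\,d\Sigma_\rho=-\int_{\Sigma_\rho}u^{-1}(u-1)^2\Bigl(\bigl(R^\rho+(n-1)(n-2)k^2\bigr)\frac X2+H_0\frac{\partial X}{\partial\rho}\Bigr)\,d\Sigma_\rho .$$ -/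

import Mathlib

open MeasureTheory Filter
open scoped Manifold ContDiff Topology

noncomputable section

namespace QuasiSpherical

/-! ### Minkowski space and the hyperboloid model -/

/-- The vector space underlying `ℝ^{n,1}`; a point is `(x, t)`. -/
abbrev Minkowski (n : ℕ) : Type := EuclideanSpace ℝ (Fin n) × ℝ

/-- The Lorentz form `∑ dx_i² - dt²`. -/
def lorentz {n : ℕ} (v w : Minkowski n) : ℝ := inner ℝ v.1 w.1 - v.2 * w.2

/-- The hyperbolic space `ℍⁿ_{-k²}` as the upper sheet of a hyperboloid in `ℝ^{n,1}`. -/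
def hyperbolicSpace (n : ℕ) (k : ℝ) : Set (Minkowski n) :=
  {x | lorentz x x = -(1 / k ^ 2) ∧ 0 < x.2}

/-! ### Riemannian geometry in coordinates

`e : ι → E` is the coordinate frame and `G x` is the matrix of the metric at `x` in this frame. -/

section Coordinates

variable {ι : Type*} [Fintype ι] [DecidableEq ι]
variable {E : Type*} [NormedAddCommGroup E] [NormedSpace ℝ E]

/-- Partial derivative `∂_i f`. -/
def pderiv (e : ι → E) (i : ι) (f : E → ℝ) (x : E) : ℝ := fderiv ℝ f x (e i)

/-- Christoffel symbol `Γ^l_{ij}`. -/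
def christoffel (e : ι → E) (G : E → Matrix ι ι ℝ) (l i j : ι) (x : E) : ℝ :=
  (1 / 2) * ∑ m, (G x)⁻¹ l m *
    (pderiv e i (fun y => G y j m) x + pderiv e j (fun y => G y i m) x
      - pderiv e m (fun y => G y i j) x)

/-- The component `R^l_{kij}` of the curvature tensor: `R(∂_i, ∂_j) ∂_k = ∑_l R^l_{kij} ∂_l`,
where `R(V, W) = ∇_V ∇_W - ∇_W ∇_V - ∇_[V, W]`. -/
def riemann (e : ι → E) (G : E → Matrix ι ι ℝ) (l k i j : ι) (x : E) : ℝ :=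
  pderiv e i (christoffel e G l j k) x - pderiv e j (christoffel e G l i k) x
    + ∑ m, (christoffel e G l i m x * christoffel e G m j k x
      - christoffel e G l j m x * christoffel e G m i k x)

/-- Ricci curvature `Ric_{jk} = ∑_i R^i_{kij}`. -/
def ricci (e : ι → E) (G : E → Matrix ι ι ℝ) (j k : ι) (x : E) : ℝ :=
  ∑ i, riemann e G i k i j x

/-- Scalar curvature `∑ G^{jk} Ric_{jk}`. -/
def coordScalarCurvature (e : ι → E) (G : E → Matrix ι ι ℝ) (x : E) : ℝ :=
  ∑ j, ∑ k, (G x)⁻¹ j k * ricci e G j k x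

/-- Sectional curvature of the plane spanned by `∑ v_i ∂_i` and `∑ w_i ∂_i`:
`⟨R(v, w) w, v⟩ / (|v|² |w|² - ⟨v, w⟩²)`. -/
def coordSectionalCurvature (e : ι → E) (G : E → Matrix ι ι ℝ) (x : E) (v w : ι → ℝ) : ℝ :=
  (∑ m, ∑ l, ∑ k, ∑ i, ∑ j, G x m l * v m * riemann e G l k i j x * v i * w j * w k) /
    ((∑ i, ∑ j, G x i j * v i * v j) * (∑ i, ∑ j, G x i j * w i * w j)
      - (∑ i, ∑ j, G x i j * v i * w j) ^ 2)

/-- The Laplace-Beltrami operator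
`(det G)^{-1/2} ∑ ∂_i ((det G)^{1/2} G^{ij} ∂_j f)`. -/
def coordLaplacian (e : ι → E) (G : E → Matrix ι ι ℝ) (f : E → ℝ) (x : E) : ℝ :=
  (√(G x).det)⁻¹ *
    ∑ i, ∑ j, pderiv e i (fun y => √(G y).det * (G y)⁻¹ i j * pderiv e j f y) x

/-- The coordinate frame `(∂_a, ∂_ρ)` on `E × ℝ`. -/
def prodFrame (e : ι → E) : ι ⊕ Unit → E × ℝ :=
  Sum.elim (fun a => (e a, 0)) (fun _ => (0, 1))

/-- The matrix of the metric `w² dρ² + G_ρ` on `E × ℝ` at `z = (x, ρ)`. -/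
def warpedMetric (G : ℝ → E → Matrix ι ι ℝ) (w : E → ℝ → ℝ) (z : E × ℝ) :
    Matrix (ι ⊕ Unit) (ι ⊕ Unit) ℝ :=
  Matrix.fromBlocks (G z.2 z.1) 0 0 (Matrix.of fun _ _ => w z.1 z.2 ^ 2)

/-- The mean curvature of the slice `{ρ = const}` in the metric `w² dρ² + G_ρ`, `w > 0`, with
respect to the unit normal `ν = w⁻¹ ∂_ρ`: the trace of the second fundamental form
`-⟨∇_{∂_a} ∂_b, ν⟩ = -w Γ^ρ_{ab}` with respect to `G_ρ`. -/
def coordSliceMeanCurvature (e : ι → E) (G : ℝ → E → Matrix ι ι ℝ) (w : E → ℝ → ℝ)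
    (x : E) (ρ : ℝ) : ℝ :=
  ∑ a, ∑ b, (G ρ x)⁻¹ a b *
    -(w x ρ * christoffel (prodFrame e) (warpedMetric G w)
        (Sum.inr ()) (Sum.inl a) (Sum.inl b) (x, ρ))

end Coordinates

/-! ### Covariant 2-tensors on a manifold, and the associated geometric quantities -/

section Manifold

variable {d : ℕ} {S : Type*} [TopologicalSpace S] [ChartedSpace (EuclideanSpace ℝ (Fin d)) S]

/-- The standard frame of `ℝ^d`. -/
def stdFrame (d : ℕ) (i : Fin d) : EuclideanSpace ℝ (Fin d) := EuclideanSpace.single i 1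

variable (d S) in
/-- Fields of real-valued functions of two tangent vectors; used for the metrics `g_ρ` and for
second fundamental forms. -/
abbrev Tensor2 : Type _ :=
  ∀ p : S, TangentSpace (𝓡 d) p → TangentSpace (𝓡 d) p → ℝ

/-- The matrix of a tensor in the chart at `q`, at the point with coordinates `x`. -/
def chartMatrix (g : Tensor2 d S) (q : S) (x : EuclideanSpace ℝ (Fin d)) :
    Matrix (Fin d) (Fin d) ℝ :=
  Matrix.of fun i j =>
    g ((chartAt (EuclideanSpace ℝ (Fin d)) q).symm x)
      (mfderiv (𝓡 d) (𝓡 d) (chartAt (EuclideanSpace ℝ (Fin d)) q).symm x (stdFrame d i))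
      (mfderiv (𝓡 d) (𝓡 d) (chartAt (EuclideanSpace ℝ (Fin d)) q).symm x (stdFrame d j))

/-- The coordinates of `p` in the chart at `p`. -/
def coords (p : S) : EuclideanSpace ℝ (Fin d) := chartAt (EuclideanSpace ℝ (Fin d)) p p

/-- The scalar curvature of the metric `g`. -/
def scalarCurvature (g : Tensor2 d S) (p : S) : ℝ :=
  coordScalarCurvature (stdFrame d) (chartMatrix g p) (coords p)

/-- All sectional curvatures of the metric `g` are larger than `c`. -/
def SectionalCurvatureGT (g : Tensor2 d S) (c : ℝ) : Prop :=
  ∀ (p : S) (v w : Fin d → ℝ), LinearIndependent ℝ ![v, w] →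
    c < coordSectionalCurvature (stdFrame d) (chartMatrix g p) (coords p) v w

/-- The Laplacian `Δ_g f`. -/
def laplacian (g : Tensor2 d S) (f : S → ℝ) (p : S) : ℝ :=
  coordLaplacian (stdFrame d) (chartMatrix g p)
    (fun x => f ((chartAt (EuclideanSpace ℝ (Fin d)) p).symm x)) (coords p)

/-- The trace of the tensor `h` with respect to the metric `g`. -/
def traceWith (g h : Tensor2 d S) (p : S) : ℝ :=
  ((chartMatrix g p (coords p))⁻¹ * chartMatrix h p (coords p)).trace

/-- The mean curvature of the slice `S × {ρ}` of `S × ℝ` in the metric `w² dρ² + g_ρ`, with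
respect to the unit normal `w⁻¹ ∂_ρ`. -/
def sliceMeanCurvature (g : ℝ → Tensor2 d S) (w : S → ℝ → ℝ) (p : S) (ρ : ℝ) : ℝ :=
  coordSliceMeanCurvature (stdFrame d) (fun s => chartMatrix (g s) p)
    (fun x s => w ((chartAt (EuclideanSpace ℝ (Fin d)) p).symm x) s) (coords p) ρ

/-- The metric induced by the Lorentz form through `f : S → ℝ^{n,1}`. -/
def inducedMetric {n : ℕ} (f : S → Minkowski n) : Tensor2 d S := fun p v w =>
  lorentz (mfderiv (𝓡 d) 𝓘(ℝ, Minkowski n) f p v : Minkowski n)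
    (mfderiv (𝓡 d) 𝓘(ℝ, Minkowski n) f p w : Minkowski n)

/-- The second fundamental form `⟨∇_v ν, w⟩` of an immersion `f` into `ℍⁿ_{-k²}` with unit normal
`ν`. The connection of `ℍⁿ_{-k²}` is the tangential part of the flat one, so that on vectors
tangent to `f` it is the Lorentz product of `dν v` and `df w`. -/
def secondFundamentalForm {n : ℕ} (f ν : S → Minkowski n) : Tensor2 d S := fun p v w =>
  lorentz (mfderiv (𝓡 d) 𝓘(ℝ, Minkowski n) ν p v : Minkowski n)
    (mfderiv (𝓡 d) 𝓘(ℝ, Minkowski n) f p w : Minkowski n)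

/-- The mean curvature of an immersion `f` into `ℍⁿ_{-k²}` with unit normal `ν`: the trace of the
second fundamental form (positive for a geodesic sphere with its outward normal). -/
def meanCurvature {n : ℕ} (f ν : S → Minkowski n) (p : S) : ℝ :=
  traceWith (d := d) (inducedMetric f) (secondFundamentalForm f ν) p

variable [T2Space S] [CompactSpace S] [IsManifold (𝓡 d) ∞ S]

variable (d S) in
/-- A smooth partition of unity, with the `q`-th function supported in the chart at `q`. -/
def chartPartition : SmoothPartitionOfUnity S (𝓡 d) S Set.univ :=
  Classical.choose (SmoothPartitionOfUnity.exists_isSubordinate_chartAt_source (𝓡 d) S)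

/-- The Riemannian volume measure of the metric `g`: with a partition of unity `χ_q`
subordinate to the charts, it is the sum over `q` of the measures `χ_q (det g)^{1/2} dx` in the
chart at `q`. -/
def riemannianVolume [MeasurableSpace S] (g : Tensor2 d S) : Measure S :=
  Measure.sum fun q : S =>
    Measure.map (chartAt (EuclideanSpace ℝ (Fin d)) q).symm
      ((volume.restrict (chartAt (EuclideanSpace ℝ (Fin d)) q).target).withDensity fun x =>
        ENNReal.ofReal
          (chartPartition d S q ((chartAt (EuclideanSpace ℝ (Fin d)) q).symm x)
            * √(chartMatrix g q x).det))

end Manifold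

/-! ### The equidistant foliation -/

section Foliation

variable {n : ℕ} {S : Type*}

/-- The point at (signed) distance `ρ` from `F p` on the unit speed geodesic of `ℍⁿ_{-k²}` that
starts at `F p` with velocity `N p`. -/
def equidistant (k : ℝ) (F N : S → Minkowski n) (p : S) (ρ : ℝ) : Minkowski n :=
  Real.cosh (k * ρ) • F p + (1 / k * Real.sinh (k * ρ)) • N p

variable [TopologicalSpace S] [ChartedSpace (EuclideanSpace ℝ (Fin (n - 1))) S]

/-- `F` is a smooth embedding of the compact manifold `S` as a hypersurface of `ℍⁿ_{-k²}` that is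
the boundary of the bounded region `Ω₀`, and `N` is its unit normal that points out of `Ω₀`. -/
structure IsOutwardEmbedding (k : ℝ) (F N : S → Minkowski n) (Ω₀ : Set (Minkowski n)) : Prop where
  smooth : ContMDiff (𝓡 (n - 1)) 𝓘(ℝ, Minkowski n) ∞ F
  mem : ∀ p, F p ∈ hyperbolicSpace n k
  injective : Function.Injective F
  immersion : ∀ p, Function.Injective (mfderiv (𝓡 (n - 1)) 𝓘(ℝ, Minkowski n) F p)
  normal_smooth : ContMDiff (𝓡 (n - 1)) 𝓘(ℝ, Minkowski n) ∞ N
  normal_tangent : ∀ p, lorentz (N p) (F p) = 0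
  normal_unit : ∀ p, lorentz (N p) (N p) = 1
  normal_orthogonal : ∀ (p : S) (v : TangentSpace (𝓡 (n - 1)) p),
    lorentz (N p) (mfderiv (𝓡 (n - 1)) 𝓘(ℝ, Minkowski n) F p v : Minkowski n) = 0
  region_subset : Ω₀ ⊆ hyperbolicSpace n k
  region_open : ∃ U : Set (Minkowski n), IsOpen U ∧ Ω₀ = U ∩ hyperbolicSpace n k
  region_bounded : Bornology.IsBounded Ω₀
  region_boundary : closure Ω₀ \ Ω₀ = Set.range F
  outward : ∀ p, ∀ᶠ s in 𝓝[>] (0 : ℝ),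
    equidistant k F N p s ∉ closure Ω₀ ∧ equidistant k F N p (-s) ∈ Ω₀

/-- The velocity `∂X/∂ρ`, which is the outward unit normal of `Σ_ρ`. -/
def velocity (k : ℝ) (F N : S → Minkowski n) (p : S) (ρ : ℝ) : Minkowski n :=
  deriv (fun s => equidistant k F N p s) ρ

/-- The induced metric `g_ρ` of `Σ_ρ`. -/
def leafMetric (k : ℝ) (F N : S → Minkowski n) (ρ : ℝ) : Tensor2 (n - 1) S :=
  inducedMetric fun p => equidistant k F N p ρ

/-- The mean curvature `H₀(p, ρ)` of `Σ_ρ` in hyperbolic space. -/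
def leafH₀ (k : ℝ) (F N : S → Minkowski n) (p : S) (ρ : ℝ) : ℝ :=
  meanCurvature (d := n - 1) (fun q => equidistant k F N q ρ) (fun q => velocity k F N q ρ) p

/-- The mean curvature `H(p, ρ)` of `Σ_ρ` in the metric `u² dρ² + g_ρ`. -/
def leafH (k : ℝ) (F N : S → Minkowski n) (u : S → ℝ → ℝ) (p : S) (ρ : ℝ) : ℝ :=
  sliceMeanCurvature (leafMetric k F N) u p ρ

/-- The scalar curvature `R^ρ` of `Σ_ρ`. -/
def leafScalar (k : ℝ) (F N : S → Minkowski n) (p : S) (ρ : ℝ) : ℝ :=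
  scalarCurvature (leafMetric k F N ρ) p

/-- `u` is a positive smooth solution on `S × [0, ∞)` of
`2 H₀ ∂u/∂ρ = 2 u² Δ_ρ u + (u - u³) (R^ρ + n(n-1)k²)`. -/
structure IsQuasiSphericalSolution (k : ℝ) (F N : S → Minkowski n) (u : S → ℝ → ℝ) : Prop where
  smooth : ContMDiffOn ((𝓡 (n - 1)).prod 𝓘(ℝ, ℝ)) 𝓘(ℝ, ℝ) ∞
    (fun z : S × ℝ => u z.1 z.2) (Set.univ ×ˢ Set.Ici 0)
  pos : ∀ p, ∀ ρ, 0 ≤ ρ → 0 < u p ρ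
  pde : ∀ p, ∀ ρ, 0 ≤ ρ →
    2 * leafH₀ k F N p ρ * derivWithin (u p) (Set.Ici 0) ρ =
      2 * u p ρ ^ 2 * laplacian (leafMetric k F N ρ) (fun q => u q ρ) p
        + (u p ρ - u p ρ ^ 3) * (leafScalar k F N p ρ + n * (n - 1) * k ^ 2)

end Foliation

end QuasiSpherical

end

/-! Write ν = ∂X/∂ρ, A for the second fundamental form of the leaf and dσ for its area element. In
Minkowski space ∂ν/∂ρ = k²X, which gives the first variation (dσ)' = H₀ dσ and the traced Riccati
equation H₀' = (n-1)k² - |A|². In the metric u²dρ² + g_ρ the slice has H = H₀/u. The derivative of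
(H₀ - H) X dσ is therefore explicit in H₀, |A|², u, ∂u/∂ρ, X and ν (`variationField`).

The Gauss equation R = -(n-1)(n-2)k² + H₀² - |A|² eliminates |A|², and the evolution equation
divided by 2u² eliminates H₀ ∂u/∂ρ in favour of Δu. Since 1 - 1/u = (u-1) - (u-1)²/u, what is left
is the claimed integrand plus Δ(u-1) X - (u-1)((n-1)k² X - H₀ ν) (`variationField_eq`). The last
bracket is ΔX, the Laplacian of the position vector of a hypersurface of hyperbolic space
(`vecLaplacian_self`), so Green's identity, applied to each linear functional of X, makes the extra
term integrate to zero.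

The curvature hypothesis is needed so that all leaves with ρ ≥ 0 are regular. By the Gauss equation
it says that A has positive determinant on every tangent plane, so A is definite at each point.
Where the time coordinate is largest on the closed region, the Hessian of that coordinate shows that
A > 0 for the outward normal. The mean curvature cannot vanish where A is definite, so by
connectedness A > 0 everywhere (`IsOutwardEmbedding.posDef`). Then no tangent vector is annihilated
as one moves outward, and every leaf is spacelike (`IsHypersurface.equidistant`).

The geometric quantities at a point are computed in the preferred chart at that point, so continuity
and integration by parts need chart independence. Traces of the shape operator are invariant because
the forms change by congruence; the scalar curvature is then handled through the Gauss equation. For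
the Laplacian, the first order coefficients are identified by applying it to the position vector,
whose Laplacian has no tangential part in any coordinates (`driftComp_eq`). Integrals are finite
sums over a partition of unity, each over a compact set independent of ρ, so dominated convergence
allows differentiation under the integral, from the right at ρ = 0. -/

noncomputable section

namespace QuasiSpherical

/-! ### The Lorentz form -/

section Lorentz

variable {n : ℕ}

/-- The Lorentz form as a continuous bilinear map. -/
def lorentzL (n : ℕ) : Minkowski n →L[ℝ] Minkowski n →L[ℝ] ℝ :=
  (innerSL ℝ).bilinearComp (ContinuousLinearMap.fst ℝ _ _) (ContinuousLinearMap.fst ℝ _ _) -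
    (ContinuousLinearMap.mul ℝ ℝ).bilinearComp (ContinuousLinearMap.snd ℝ _ _)
      (ContinuousLinearMap.snd ℝ _ _)

@[simp] theorem lorentzL_apply (v w : Minkowski n) : lorentzL n v w = lorentz v w := by
  simp [lorentzL, lorentz]

theorem lorentz_comm (v w : Minkowski n) : lorentz v w = lorentz w v := by
  simp only [lorentz, real_inner_comm, mul_comm]

theorem lorentz_add_left (v v' w : Minkowski n) :
    lorentz (v + v') w = lorentz v w + lorentz v' w := by
  simp [← lorentzL_apply]

theorem lorentz_add_right (v w w' : Minkowski n) :
    lorentz v (w + w') = lorentz v w + lorentz v w' := by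
  simp [← lorentzL_apply]

theorem lorentz_sub_left (v v' w : Minkowski n) :
    lorentz (v - v') w = lorentz v w - lorentz v' w := by
  simp [← lorentzL_apply]

theorem lorentz_smul_left (c : ℝ) (v w : Minkowski n) : lorentz (c • v) w = c * lorentz v w := by
  simp [← lorentzL_apply]

theorem lorentz_smul_right (c : ℝ) (v w : Minkowski n) : lorentz v (c • w) = c * lorentz v w := by
  simp [← lorentzL_apply]

@[simp] theorem lorentz_zero_left (w : Minkowski n) : lorentz 0 w = 0 := by
  simp [← lorentzL_apply]

theorem lorentz_sum_left {ι : Type*} (s : Finset ι) (v : ι → Minkowski n) (w : Minkowski n) :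
    lorentz (∑ i ∈ s, v i) w = ∑ i ∈ s, lorentz (v i) w := by
  simp [← lorentzL_apply]

theorem lorentz_sum_right {ι : Type*} (s : Finset ι) (v : ι → Minkowski n) (w : Minkowski n) :
    lorentz w (∑ i ∈ s, v i) = ∑ i ∈ s, lorentz w (v i) := by
  simp [← lorentzL_apply]

/-- Testing against the time reflection of `w` produces the Euclidean norm. Nondegeneracy is what
lets vector identities be checked on a frame. -/
theorem eq_zero_of_lorentz_eq_zero (w : Minkowski n) (h : ∀ m, lorentz w m = 0) : w = 0 := by
  have h1 := h (w.1, -w.2)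
  simp only [lorentz, real_inner_self_eq_norm_sq] at h1
  have h2 : ‖w.1‖ ^ 2 + w.2 ^ 2 = 0 := by linarith
  have h3 : ‖w.1‖ = 0 := by nlinarith [sq_nonneg ‖w.1‖, sq_nonneg w.2]
  have h4 : w.2 = 0 := by nlinarith [sq_nonneg ‖w.1‖, sq_nonneg w.2]
  exact Prod.ext (norm_eq_zero.1 h3) h4

/-- Vectors orthogonal to a timelike vector are spacelike. -/
theorem lorentz_self_pos_of_orthogonal {y w : Minkowski n} (hy : lorentz y y < 0)
    (h : lorentz w y = 0) (hw : w ≠ 0) : 0 < lorentz w w := by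
  simp only [lorentz, real_inner_self_eq_norm_sq] at *
  -- Orthogonality says ⟨w.1, y.1⟩ = w.2 y.2, and `y` timelike says ‖y.1‖ < |y.2|; Cauchy-Schwarz
  -- then forces |w.2| < ‖w.1‖, the case w.1 = 0 being excluded since it gives w.2 = 0.
  have hcs := abs_real_inner_le_norm w.1 y.1
  have hcs2 : (inner ℝ w.1 y.1 : ℝ) ^ 2 ≤ (‖w.1‖ * ‖y.1‖) ^ 2 := by
    rw [← sq_abs]; gcongr
  have h1 : (inner ℝ w.1 y.1 : ℝ) = w.2 * y.2 := by linarith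
  rw [h1] at hcs2
  have hy2 : 0 < y.2 * y.2 := by nlinarith [sq_nonneg ‖y.1‖]
  rcases eq_or_ne w.1 0 with h0 | h0
  · have : w.2 ≠ 0 := fun h' => hw (Prod.ext h0 h')
    have h3 : 0 < w.2 ^ 2 := by positivity
    rw [h0, norm_zero] at hcs2
    nlinarith
  · have h3 : 0 < ‖w.1‖ ^ 2 := by positivity
    have h4 : (w.2 * w.2) * (y.2 * y.2) < ‖w.1‖ ^ 2 * (y.2 * y.2) := by nlinarith
    have := lt_of_mul_lt_mul_right h4 hy2.le
    linarith

theorem _root_.ContDiffAt.lorentz {V : Type*} [NormedAddCommGroup V] [NormedSpace ℝ V]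
    {f g : V → Minkowski n} {x : V} {m : ℕ∞ω}
    (hf : ContDiffAt ℝ m f x) (hg : ContDiffAt ℝ m g x) :
    ContDiffAt ℝ m (fun y => lorentz (f y) (g y)) x := by
  simp only [← lorentzL_apply]
  exact ((lorentzL n).contDiff.contDiffAt.comp x hf).clm_apply hg

theorem _root_.HasFDerivAt.lorentz {V : Type*} [NormedAddCommGroup V] [NormedSpace ℝ V]
    {f g : V → Minkowski n} {f' g' : V →L[ℝ] Minkowski n} {x : V}
    (hf : HasFDerivAt f f' x) (hg : HasFDerivAt g g' x) :
    HasFDerivAt (fun y => lorentz (f y) (g y))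
      ((lorentzL n (f x)).comp g' + ((lorentzL n).flip (g x)).comp f') x := by
  simp only [← lorentzL_apply]
  refine (((lorentzL n).hasFDerivAt.comp x hf).clm_apply hg).congr_fderiv ?_
  ext v; simp

theorem _root_.HasDerivAt.lorentz {f g : ℝ → Minkowski n} {f' g' : Minkowski n} {s : ℝ}
    (hf : HasDerivAt f f' s) (hg : HasDerivAt g g' s) :
    HasDerivAt (fun y => lorentz (f y) (g y)) (lorentz f' (g s) + lorentz (f s) g') s := by
  have := (hf.hasFDerivAt.lorentz hg.hasFDerivAt).hasDerivAt
  convert this using 1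
  simp [add_comm]

end Lorentz

/-! ### Coordinate derivatives of vector-valued functions -/

section Pd

variable {d : ℕ} {V : Type*} [NormedAddCommGroup V] [NormedSpace ℝ V]

local notation "𝔼" d:max => EuclideanSpace ℝ (Fin d)

/-- The partial derivative of a vector-valued function in the direction of the standard frame. -/
def pd (i : Fin d) (f : 𝔼 d → V) (x : 𝔼 d) : V := fderiv ℝ f x (stdFrame d i)

theorem pderiv_stdFrame (i : Fin d) (f : 𝔼 d → ℝ) (x : 𝔼 d) :
    pderiv (stdFrame d) i f x = pd i f x := rfl

theorem eq_sum_stdFrame (v : 𝔼 d) : v = ∑ i, v i • stdFrame d i := by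
  ext j
  simp [stdFrame, Finset.sum_apply, Pi.single_apply]

theorem fderiv_eq_sum_pd (f : 𝔼 d → V) (x v : 𝔼 d) : fderiv ℝ f x v = ∑ i, v i • pd i f x := by
  conv_lhs => rw [eq_sum_stdFrame v]
  simp [pd]

theorem _root_.ContDiffAt.pd {f : 𝔼 d → V} {x : 𝔼 d} (hf : ContDiffAt ℝ ∞ f x) (i : Fin d) :
    ContDiffAt ℝ ∞ (pd i f) x :=
  (hf.fderiv_right (m := ∞) (by simp)).clm_apply contDiffAt_const

theorem _root_.ContDiffAt.diff {W : Type*} [NormedAddCommGroup W] [NormedSpace ℝ W]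
    {f : W → V} {x : W} (hf : ContDiffAt ℝ ∞ f x) :
    DifferentiableAt ℝ f x := hf.differentiableAt (by simp)

theorem _root_.Filter.EventuallyEq.pd {f g : 𝔼 d → V} {x : 𝔼 d} (h : f =ᶠ[𝓝 x] g) (i : Fin d) :
    pd i f =ᶠ[𝓝 x] pd i g := by
  filter_upwards [h.eventuallyEq_nhds] with y hy
  simp only [QuasiSpherical.pd, hy.fderiv_eq]

theorem pd_congr {f g : 𝔼 d → V} {x : 𝔼 d} (h : f =ᶠ[𝓝 x] g) (i : Fin d) :
    pd i f x = pd i g x := (h.pd i).eq_of_nhds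

theorem pd_comm {f : 𝔼 d → V} {x : 𝔼 d} (hf : ContDiffAt ℝ ∞ f x) (i j : Fin d) :
    pd i (pd j f) x = pd j (pd i f) x := by
  have h2 : DifferentiableAt ℝ (fderiv ℝ f) x :=
    (hf.fderiv_right (m := ∞) (by simp)).differentiableAt (by simp)
  have key : ∀ a b : Fin d, pd a (pd b f) x = fderiv ℝ (fderiv ℝ f) x (stdFrame d a) (stdFrame d b) := by
    intro a b
    unfold pd
    rw [fderiv_clm_apply h2 (differentiableAt_const _)]
    simp
  rw [key, key]
  exact (hf.isSymmSndFDerivAt (by simp; exact WithTop.coe_le_coe.2 le_top)) _ _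

theorem pd_const (c : V) (i : Fin d) (x : 𝔼 d) : pd i (fun _ => c) x = 0 := by simp [pd]

theorem pd_add {f g : 𝔼 d → V} {x : 𝔼 d} (hf : DifferentiableAt ℝ f x) (hg : DifferentiableAt ℝ g x)
    (i : Fin d) : pd i (fun y => f y + g y) x = pd i f x + pd i g x := by
  simp [pd, fderiv_fun_add hf hg]

theorem pd_sub {f g : 𝔼 d → V} {x : 𝔼 d} (hf : DifferentiableAt ℝ f x) (hg : DifferentiableAt ℝ g x)
    (i : Fin d) : pd i (fun y => f y - g y) x = pd i f x - pd i g x := by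
  simp [pd, fderiv_fun_sub hf hg]

theorem pd_sum {ι : Type*} {s : Finset ι} {f : ι → 𝔼 d → V} {x : 𝔼 d}
    (hf : ∀ a ∈ s, DifferentiableAt ℝ (f a) x) (i : Fin d) :
    pd i (fun y => ∑ a ∈ s, f a y) x = ∑ a ∈ s, pd i (f a) x := by
  simp [pd, fderiv_fun_sum hf]

theorem pd_smul {c : 𝔼 d → ℝ} {f : 𝔼 d → V} {x : 𝔼 d} (hc : DifferentiableAt ℝ c x)
    (hf : DifferentiableAt ℝ f x) (i : Fin d) :
    pd i (fun y => c y • f y) x = pd i c x • f x + c x • pd i f x := by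
  simp [pd, fderiv_fun_smul hc hf, add_comm]

theorem pd_mul {f g : 𝔼 d → ℝ} {x : 𝔼 d} (hf : DifferentiableAt ℝ f x) (hg : DifferentiableAt ℝ g x)
    (i : Fin d) : pd i (fun y => f y * g y) x = pd i f x * g x + f x * pd i g x := by
  simp [pd, fderiv_fun_mul hf hg]; ring

theorem pd_const_smul (c : ℝ) {f : 𝔼 d → V} {x : 𝔼 d}
    (hf : DifferentiableAt ℝ f x) (i : Fin d) :
    pd i (fun y => c • f y) x = c • pd i f x := by
  simp [pd, fderiv_fun_const_smul hf]

theorem pd_lorentz {n : ℕ} {f g : 𝔼 d → Minkowski n} {x : 𝔼 d}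
    (hf : DifferentiableAt ℝ f x) (hg : DifferentiableAt ℝ g x) (i : Fin d) :
    pd i (fun y => lorentz (f y) (g y)) x = lorentz (pd i f x) (g x) + lorentz (f x) (pd i g x) := by
  simp [pd, (hf.hasFDerivAt.lorentz hg.hasFDerivAt).fderiv, add_comm]

theorem pd_clm {W : Type*} [NormedAddCommGroup W] [NormedSpace ℝ W] (L : V →L[ℝ] W) {f : 𝔼 d → V}
    {x : 𝔼 d} (hf : DifferentiableAt ℝ f x) (i : Fin d) :
    pd i (fun y => L (f y)) x = L (pd i f x) := by
  have := (L.hasFDerivAt.comp x hf.hasFDerivAt).fderiv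
  simp only [Function.comp_def] at this
  simp [pd, this]

/-- The vector-valued chain rule in coordinates. -/
theorem pd_comp {f : 𝔼 d → V} {T : 𝔼 d → 𝔼 d} {x : 𝔼 d} (hf : DifferentiableAt ℝ f (T x))
    (hT : DifferentiableAt ℝ T x) (i : Fin d) :
    pd i (fun y => f (T y)) x = ∑ a, pd i T x a • pd a f (T x) := by
  have := (hf.hasFDerivAt.comp x hT.hasFDerivAt).fderiv
  simp only [Function.comp_def] at this
  rw [pd, this, ← fderiv_eq_sum_pd]
  rfl

end Pd

/-! ### Calculus of determinants and inverses of matrices -/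

section MatrixCalculus

variable {ι : Type*} [Fintype ι] [DecidableEq ι]
variable {V : Type*} [NormedAddCommGroup V] [NormedSpace ℝ V]

theorem contDiffAt_det {m : ℕ∞ω} {A : V → Matrix ι ι ℝ} {x : V}
    (h : ∀ i j, ContDiffAt ℝ m (fun y => A y i j) x) :
    ContDiffAt ℝ m (fun y => (A y).det) x := by
  simp only [Matrix.det_apply']
  exact ContDiffAt.sum fun σ _ => contDiffAt_const.mul (contDiffAt_prod fun i _ => h _ _)

theorem contDiffAt_inv_apply {m : ℕ∞ω} {A : V → Matrix ι ι ℝ} {x : V}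
    (h : ∀ i j, ContDiffAt ℝ m (fun y => A y i j) x) (hdet : (A x).det ≠ 0) (i j : ι) :
    ContDiffAt ℝ m (fun y => (A y)⁻¹ i j) x := by
  simp only [Matrix.inv_def, Ring.inverse_eq_inv', Matrix.smul_apply, smul_eq_mul,
    Matrix.adjugate_apply]
  refine (contDiffAt_det h).inv hdet |>.mul (contDiffAt_det fun a b => ?_)
  -- By Cramer's rule the adjugate entry is the determinant of `A` with row `j` replaced by a
  -- constant basis vector, so each entry is constant or an entry of `A`.
  by_cases hb : a = j
  · subst hb; simpa using contDiffAt_const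
  · simpa [Matrix.updateRow_ne hb] using h a b

theorem contDiffAt_sqrt_det {m : ℕ∞ω} {A : V → Matrix ι ι ℝ} {x : V}
    (h : ∀ i j, ContDiffAt ℝ m (fun y => A y i j) x) (hdet : (A x).det ≠ 0) :
    ContDiffAt ℝ m (fun y => √(A y).det) x :=
  (contDiffAt_det h).sqrt hdet

/-- Jacobi's formula. -/
theorem hasFDerivAt_det {A : V → Matrix ι ι ℝ} {A' : ι → ι → V →L[ℝ] ℝ} {x : V}
    (h : ∀ i j, HasFDerivAt (fun y => A y i j) (A' i j) x) :
    HasFDerivAt (fun y => (A y).det) (∑ i, ∑ j, (A x).adjugate j i • A' i j) x := by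
  -- The determinant is multilinear in the rows, so its derivative varies one row at a time;
  -- expanding along that row produces the adjugate.
  let f : ContinuousMultilinearMap ℝ (fun _ : ι => ι → ℝ) ℝ :=
    { (Matrix.detRowAlternating (n := ι) (R := ℝ)).toMultilinearMap with
      cont := by
        change Continuous fun A : Matrix ι ι ℝ => A.det
        exact continuous_id.matrix_det }
  have hA : HasFDerivAt (fun y => (A y : ι → ι → ℝ))
      (ContinuousLinearMap.pi fun i => ContinuousLinearMap.pi fun j => A' i j) x :=
    hasFDerivAt_pi.2 fun i => hasFDerivAt_pi.2 fun j => h i j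
  have := (f.hasFDerivAt (A x)).comp x hA
  refine this.congr_fderiv (Eq.symm ?_)
  ext v
  simp only [FunLike.coe_sum, Finset.sum_apply, FunLike.coe_smul,
    Pi.smul_apply, smul_eq_mul, ContinuousLinearMap.comp_apply]
  refine Eq.trans ?_ (ContinuousMultilinearMap.linearDeriv_apply f (A x) _).symm
  refine Finset.sum_congr rfl fun i _ => ?_
  change _ = ((A x).updateRow i fun j => A' i j v).det
  rw [Matrix.det_eq_sum_mul_adjugate_row _ i]
  refine Finset.sum_congr rfl fun j _ => ?_
  simp [Matrix.adjugate_apply, mul_comm]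

end MatrixCalculus

/-! ### Hypersurfaces of hyperbolic space in coordinates -/

section Hypersurface

variable {d n : ℕ}

local notation "𝔼" d:max => EuclideanSpace ℝ (Fin d)

/-- The matrix of Lorentz products of the partial derivatives of `Y` and `Z`. -/
def gram (Y Z : 𝔼 d → Minkowski n) (x : 𝔼 d) : Matrix (Fin d) (Fin d) ℝ :=
  Matrix.of fun i j => lorentz (pd i Y x) (pd j Z x)

theorem gram_apply (Y Z : 𝔼 d → Minkowski n) (x : 𝔼 d) (i j : Fin d) :
    gram Y Z x i j = lorentz (pd i Y x) (pd j Z x) := rfl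

/-- Reduces positivity of these matrices to the causal character of tangent vectors. -/
theorem dotProduct_gram_mulVec (Y Z : 𝔼 d → Minkowski n) (x : 𝔼 d) (v w : Fin d → ℝ) :
    dotProduct v ((gram Y Z x).mulVec w) =
      lorentz (∑ i, v i • pd i Y x) (∑ j, w j • pd j Z x) := by
  simp only [dotProduct, Matrix.mulVec, gram_apply, lorentz_sum_left, lorentz_sum_right,
    lorentz_smul_left, lorentz_smul_right, Finset.mul_sum]
  rw [Finset.sum_comm]
  exact Finset.sum_congr rfl fun i _ => Finset.sum_congr rfl fun j _ => by ring

/-- `Y` parametrizes a spacelike hypersurface of `ℍⁿ_{-k²}` over the open set `U`, with unit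
normal `ν`. -/
structure IsHypersurface (k : ℝ) (Y ν : 𝔼 d → Minkowski n) (U : Set (𝔼 d)) : Prop where
  isOpen : IsOpen U
  smooth : ∀ x ∈ U, ContDiffAt ℝ ∞ Y x
  smooth_normal : ∀ x ∈ U, ContDiffAt ℝ ∞ ν x
  lorentz_self : ∀ x ∈ U, lorentz (Y x) (Y x) = -(1 / k ^ 2)
  lorentz_normal : ∀ x ∈ U, lorentz (ν x) (ν x) = 1
  lorentz_normal_self : ∀ x ∈ U, lorentz (ν x) (Y x) = 0
  lorentz_normal_pd : ∀ x ∈ U, ∀ i, lorentz (ν x) (pd i Y x) = 0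
  posDef : ∀ x ∈ U, (gram Y Y x).PosDef

namespace IsHypersurface

variable {k : ℝ} {Y ν : 𝔼 d → Minkowski n} {U : Set (𝔼 d)} {x : 𝔼 d}

theorem det_pos (H : IsHypersurface k Y ν U) (hx : x ∈ U) : 0 < (gram Y Y x).det :=
  (H.posDef x hx).det_pos

theorem isUnit_det (H : IsHypersurface k Y ν U) (hx : x ∈ U) : IsUnit (gram Y Y x).det :=
  (H.det_pos hx).ne'.isUnit

theorem gram_comm (Y : 𝔼 d → Minkowski n) (i j : Fin d) : gram Y Y x i j = gram Y Y x j i :=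
  lorentz_comm _ _

theorem inv_comm (H : IsHypersurface k Y ν U) (hx : x ∈ U) (i j : Fin d) :
    (gram Y Y x)⁻¹ i j = (gram Y Y x)⁻¹ j i := by
  have := (H.posDef x hx).inv.isHermitian.apply j i
  simpa using this

/-- The constraints on `Y` and `ν` hold on an open set and may be differentiated; the orthogonality
relations that follow are their first and second derivatives. -/
theorem pd_eq_zero_of_const {f : 𝔼 d → ℝ} {c : ℝ} (hU : IsOpen U) (h : ∀ y ∈ U, f y = c)
    (hx : x ∈ U) (i : Fin d) : pd i f x = 0 := by
  have : f =ᶠ[𝓝 x] fun _ => c := by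
    filter_upwards [hU.mem_nhds hx] with y hy using h y hy
  rw [pd_congr this, pd_const]

theorem lorentz_pd_self (H : IsHypersurface k Y ν U) (hx : x ∈ U) (i : Fin d) :
    lorentz (pd i Y x) (Y x) = 0 := by
  have := pd_eq_zero_of_const H.isOpen H.lorentz_self hx i
  rw [pd_lorentz (H.smooth x hx).diff (H.smooth x hx).diff, lorentz_comm (Y x)] at this
  linarith

theorem lorentz_pd_normal (H : IsHypersurface k Y ν U) (hx : x ∈ U) (i : Fin d) :
    lorentz (pd i Y x) (ν x) = 0 := by
  rw [lorentz_comm]; exact H.lorentz_normal_pd x hx i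

theorem lorentz_pdNormal_normal (H : IsHypersurface k Y ν U) (hx : x ∈ U) (i : Fin d) :
    lorentz (pd i ν x) (ν x) = 0 := by
  have := pd_eq_zero_of_const H.isOpen H.lorentz_normal hx i
  rw [pd_lorentz (H.smooth_normal x hx).diff (H.smooth_normal x hx).diff,
    lorentz_comm (ν x)] at this
  linarith

theorem lorentz_pdNormal_self (H : IsHypersurface k Y ν U) (hx : x ∈ U) (i : Fin d) :
    lorentz (pd i ν x) (Y x) = 0 := by
  have := pd_eq_zero_of_const H.isOpen H.lorentz_normal_self hx i
  rw [pd_lorentz (H.smooth_normal x hx).diff (H.smooth x hx).diff,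
    H.lorentz_normal_pd x hx] at this
  linarith

theorem lorentz_pd_pd_self (H : IsHypersurface k Y ν U) (hx : x ∈ U) (i j : Fin d) :
    lorentz (pd i (pd j Y) x) (Y x) = -gram Y Y x i j := by
  have := pd_eq_zero_of_const H.isOpen (fun y hy => H.lorentz_pd_self hy j) hx i
  rw [pd_lorentz ((H.smooth x hx).pd j).diff (H.smooth x hx).diff, ← gram_apply,
    gram_comm] at this
  linarith

theorem lorentz_pd_pd_normal (H : IsHypersurface k Y ν U) (hx : x ∈ U) (i j : Fin d) :
    lorentz (pd i (pd j Y) x) (ν x) = -gram ν Y x i j := by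
  have := pd_eq_zero_of_const H.isOpen (fun y hy => H.lorentz_pd_normal hy j) hx i
  rw [pd_lorentz ((H.smooth x hx).pd j).diff (H.smooth_normal x hx).diff,
    lorentz_comm (pd j Y x), ← gram_apply] at this
  linarith

/-- Up to sign the entries are ⟨∂_i∂_j Y, ν⟩, and second derivatives commute. -/
theorem gramNormal_comm (H : IsHypersurface k Y ν U) (hx : x ∈ U) (i j : Fin d) :
    gram ν Y x i j = gram ν Y x j i := by
  have h1 := H.lorentz_pd_pd_normal hx i j
  have h2 := H.lorentz_pd_pd_normal hx j i
  rw [pd_comm (H.smooth x hx)] at h1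
  linarith

theorem gramNormal_transpose (H : IsHypersurface k Y ν U) (hx : x ∈ U) :
    (gram ν Y x).transpose = gram ν Y x := by
  ext i j; exact H.gramNormal_comm hx j i

theorem inv_mul_apply (H : IsHypersurface k Y ν U) (hx : x ∈ U) (i j : Fin d) :
    ∑ m, (gram Y Y x)⁻¹ i m * gram Y Y x m j = if i = j then 1 else 0 := by
  rw [← Matrix.mul_apply, Matrix.nonsing_inv_mul _ (H.isUnit_det hx), Matrix.one_apply]

/-- A vector orthogonal to the hypersurface, its normal and its position vector vanishes. -/
theorem eq_zero_of_orthogonal (H : IsHypersurface k Y ν U) (hk : k ≠ 0) (hd : n = d + 1)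
    (hx : x ∈ U) {w : Minkowski n} (h1 : lorentz w (Y x) = 0) (h2 : lorentz w (ν x) = 0)
    (h3 : ∀ i, lorentz w (pd i Y x) = 0) : w = 0 := by
  -- The vectors ∂_i Y, Y, ν are d + 2 = n + 1 in number, so their independence already makes them
  -- span Minkowski space. Independence follows by pairing with Y, with ν, and then using positivity
  -- of the metric.
  let L : ((Fin d → ℝ) × ℝ × ℝ) →ₗ[ℝ] Minkowski n :=
    { toFun := fun c => ∑ i, c.1 i • pd i Y x + (c.2.1 • Y x + c.2.2 • ν x)
      map_add' := fun a b => by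
        simp only [Prod.fst_add, Prod.snd_add, Pi.add_apply, add_smul, Finset.sum_add_distrib]
        abel
      map_smul' := fun a b => by
        simp only [Prod.smul_fst, Prod.smul_snd, Pi.smul_apply, smul_eq_mul, mul_smul,
          RingHom.id_apply, smul_add, Finset.smul_sum] }
  have hL : ∀ c, L c = ∑ i, c.1 i • pd i Y x + (c.2.1 • Y x + c.2.2 • ν x) := fun _ => rfl
  have e1 := H.lorentz_self x hx
  have e2 := H.lorentz_normal x hx
  have e3 := H.lorentz_normal_self x hx
  have e3' : lorentz (Y x) (ν x) = 0 := by rw [lorentz_comm]; exact e3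
  have hinj : Function.Injective L := by
    rw [← LinearMap.ker_eq_bot, LinearMap.ker_eq_bot']
    intro c hc
    rw [hL] at hc
    have a1 := congrArg (fun m => lorentz m (Y x)) hc
    have a2 := congrArg (fun m => lorentz m (ν x)) hc
    simp only [lorentz_add_left, lorentz_sum_left, lorentz_smul_left, H.lorentz_pd_self hx,
      H.lorentz_pd_normal hx, e1, e2, e3, e3', lorentz_zero_left, mul_zero, Finset.sum_const_zero,
      mul_one, add_zero, zero_add] at a1 a2
    have hk2 : (1 : ℝ) / k ^ 2 ≠ 0 := by positivity
    have b1 : c.2.1 = 0 := by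
      rcases mul_eq_zero.1 a1 with h | h
      · exact h
      · exact absurd (neg_eq_zero.1 h) hk2
    rw [b1, a2] at hc
    simp only [zero_smul, add_zero] at hc
    have b3 : c.1 = 0 := by
      by_contra hne
      have := (H.posDef x hx).dotProduct_mulVec_pos hne
      simp only [star_trivial, dotProduct_gram_mulVec, hc, lorentz_zero_left, lt_irrefl] at this
    exact Prod.ext b3 (Prod.ext b1 a2)
  have hfr : Module.finrank ℝ ((Fin d → ℝ) × ℝ × ℝ) = Module.finrank ℝ (Minkowski n) := by
    simp [hd]
  have hsurj : Function.Surjective L := (LinearMap.injective_iff_surjective_of_finrank_eq_finrank hfr).1 hinj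
  refine eq_zero_of_lorentz_eq_zero w fun m => ?_
  obtain ⟨c, rfl⟩ := hsurj m
  simp [hL, lorentz_add_right, lorentz_sum_right, lorentz_smul_right, h1, h2, h3]

theorem eq_of_lorentz_eq (H : IsHypersurface k Y ν U) (hk : k ≠ 0) (hd : n = d + 1)
    (hx : x ∈ U) {w w' : Minkowski n} (h1 : lorentz w (Y x) = lorentz w' (Y x))
    (h2 : lorentz w (ν x) = lorentz w' (ν x))
    (h3 : ∀ i, lorentz w (pd i Y x) = lorentz w' (pd i Y x)) : w = w' := by
  refine sub_eq_zero.1 (H.eq_zero_of_orthogonal hk hd hx ?_ ?_ ?_)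
  · rw [lorentz_sub_left, h1, sub_self]
  · rw [lorentz_sub_left, h2, sub_self]
  · intro i; rw [lorentz_sub_left, h3, sub_self]

theorem contDiffAt_gram (H : IsHypersurface k Y ν U) (hx : x ∈ U) (i j : Fin d) :
    ContDiffAt ℝ ∞ (fun y => gram Y Y y i j) x :=
  ((H.smooth x hx).pd i).lorentz ((H.smooth x hx).pd j)

theorem contDiffAt_gramNormal (H : IsHypersurface k Y ν U) (hx : x ∈ U) (i j : Fin d) :
    ContDiffAt ℝ ∞ (fun y => gram ν Y y i j) x :=
  ((H.smooth_normal x hx).pd i).lorentz ((H.smooth x hx).pd j)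

theorem contDiffAt_inv (H : IsHypersurface k Y ν U) (hx : x ∈ U) (i j : Fin d) :
    ContDiffAt ℝ ∞ (fun y => (gram Y Y y)⁻¹ i j) x :=
  contDiffAt_inv_apply (H.contDiffAt_gram hx) (H.det_pos hx).ne' i j

theorem contDiffAt_sqrt (H : IsHypersurface k Y ν U) (hx : x ∈ U) :
    ContDiffAt ℝ ∞ (fun y => √(gram Y Y y).det) x :=
  contDiffAt_sqrt_det (H.contDiffAt_gram hx) (H.det_pos hx).ne'

theorem pd_gram (H : IsHypersurface k Y ν U) (hx : x ∈ U) (m i j : Fin d) :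
    pd m (fun y => gram Y Y y i j) x =
      lorentz (pd m (pd i Y) x) (pd j Y x) + lorentz (pd m (pd j Y) x) (pd i Y x) := by
  simp only [gram_apply]
  rw [pd_lorentz ((H.smooth x hx).pd i).diff ((H.smooth x hx).pd j).diff,
    lorentz_comm (pd i Y x)]

/-- Writing G_ij = ⟨∂_i Y, ∂_j Y⟩, all terms of the three derivatives cancel except 2⟨∂_i∂_j Y, ∂_m
Y⟩: the Levi-Civita connection is the tangential part of the flat one. -/
theorem christoffel_eq (H : IsHypersurface k Y ν U) (hx : x ∈ U) (l i j : Fin d) :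
    christoffel (stdFrame d) (gram Y Y) l i j x =
      ∑ m, (gram Y Y x)⁻¹ l m * lorentz (pd i (pd j Y) x) (pd m Y x) := by
  simp only [christoffel, pderiv_stdFrame, H.pd_gram hx]
  rw [Finset.mul_sum]
  refine Finset.sum_congr rfl fun m _ => ?_
  rw [pd_comm (H.smooth x hx) j i, pd_comm (H.smooth x hx) m j, pd_comm (H.smooth x hx) m i]
  ring

theorem contDiffAt_christoffel (H : IsHypersurface k Y ν U) (hx : x ∈ U) (l i j : Fin d) :
    ContDiffAt ℝ ∞ (christoffel (stdFrame d) (gram Y Y) l i j) x := by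
  have : christoffel (stdFrame d) (gram Y Y) l i j =ᶠ[𝓝 x]
      fun y => ∑ m, (gram Y Y y)⁻¹ l m * lorentz (pd i (pd j Y) y) (pd m Y y) := by
    filter_upwards [H.isOpen.mem_nhds hx] with y hy using H.christoffel_eq hy l i j
  refine ContDiffAt.congr_of_eventuallyEq ?_ this
  exact ContDiffAt.sum fun m _ => (H.contDiffAt_inv hx l m).mul
    ((((H.smooth x hx).pd j).pd i).lorentz ((H.smooth x hx).pd m))

theorem lorentz_pd_pd_pd (H : IsHypersurface k Y ν U) (hx : x ∈ U) (i j m : Fin d) :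
    lorentz (pd i (pd j Y) x) (pd m Y x) =
      ∑ l, christoffel (stdFrame d) (gram Y Y) l i j x * gram Y Y x l m := by
  simp only [H.christoffel_eq hx, Finset.sum_mul]
  rw [Finset.sum_comm]
  have : ∀ r, ∑ l, (gram Y Y x)⁻¹ l r * lorentz (pd i (pd j Y) x) (pd r Y x) * gram Y Y x l m =
      lorentz (pd i (pd j Y) x) (pd r Y x) * if r = m then 1 else 0 := by
    intro r
    rw [← H.inv_mul_apply hx, Finset.mul_sum]
    refine Finset.sum_congr rfl fun l _ => ?_
    rw [H.inv_comm hx l r]; ring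
  simp [this]

/-- The Gauss formula for a hypersurface of hyperbolic space. -/
theorem pd_pd_eq (H : IsHypersurface k Y ν U) (hk : k ≠ 0) (hd : n = d + 1) (hx : x ∈ U)
    (i j : Fin d) :
    pd i (pd j Y) x = ∑ l, christoffel (stdFrame d) (gram Y Y) l i j x • pd l Y x +
      (k ^ 2 * gram Y Y x i j) • Y x - gram ν Y x i j • ν x := by
  have e3' : lorentz (Y x) (ν x) = 0 := by rw [lorentz_comm]; exact H.lorentz_normal_self x hx
  -- The coefficient of `Y` is k² G_ij because ⟨∂_i∂_j Y, Y⟩ = -G_ij while ⟨Y, Y⟩ = -1/k².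
  apply H.eq_of_lorentz_eq hk hd hx
  · simp only [lorentz_add_left, lorentz_sub_left, lorentz_sum_left, lorentz_smul_left,
      H.lorentz_pd_self hx, H.lorentz_pd_pd_self hx, H.lorentz_self x hx,
      H.lorentz_normal_self x hx]
    simp; field_simp
  · simp only [lorentz_add_left, lorentz_sub_left, lorentz_sum_left, lorentz_smul_left,
      H.lorentz_pd_normal hx, H.lorentz_pd_pd_normal hx, e3', H.lorentz_normal x hx]
    simp
  · intro m
    simp only [lorentz_add_left, lorentz_sub_left, lorentz_sum_left, lorentz_smul_left,
      H.lorentz_pd_pd_pd hx, H.lorentz_normal_pd x hx, lorentz_comm (Y x), H.lorentz_pd_self hx,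
      gram_apply]
    simp

/-- Differentiate the Gauss formula once more and pair with ∂_m Y. Only ∂_i Y and ∂_i ν survive from
the `Y` and `ν` terms; the Christoffel terms form one half of the curvature tensor. -/
theorem lorentz_pd_pd_pd_pd (H : IsHypersurface k Y ν U) (hk : k ≠ 0) (hd : n = d + 1) (hx : x ∈ U)
    (i j r m : Fin d) :
    lorentz (pd i (pd j (pd r Y)) x) (pd m Y x) =
      ∑ l, gram Y Y x m l * (pd i (christoffel (stdFrame d) (gram Y Y) l j r) x +
        ∑ s, christoffel (stdFrame d) (gram Y Y) l i s x *
          christoffel (stdFrame d) (gram Y Y) s j r x) +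
      k ^ 2 * gram Y Y x j r * gram Y Y x i m - gram ν Y x j r * gram ν Y x i m := by
  have hev : pd j (pd r Y) =ᶠ[𝓝 x] fun y =>
      ∑ l, christoffel (stdFrame d) (gram Y Y) l j r y • pd l Y y +
      (k ^ 2 * gram Y Y y j r) • Y y - gram ν Y y j r • ν y := by
    filter_upwards [H.isOpen.mem_nhds hx] with y hy using H.pd_pd_eq hk hd hy j r
  have hY := H.smooth x hx
  have hν := H.smooth_normal x hx
  have hc : ∀ l, DifferentiableAt ℝ (fun y => christoffel (stdFrame d) (gram Y Y) l j r y) x :=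
    fun l => (H.contDiffAt_christoffel hx l j r).diff
  have hg : DifferentiableAt ℝ (fun y => k ^ 2 * gram Y Y y j r) x :=
    ((H.contDiffAt_gram hx j r).diff).const_mul _
  have hh := (H.contDiffAt_gramNormal hx j r).diff
  have hs : DifferentiableAt ℝ
      (fun y => ∑ l, christoffel (stdFrame d) (gram Y Y) l j r y • pd l Y y) x :=
    DifferentiableAt.fun_sum fun l _ => (hc l).smul (hY.pd l).diff
  rw [pd_congr hev, pd_sub (hs.fun_add (hg.fun_smul hY.diff)) (hh.fun_smul hν.diff),
    pd_add hs (hg.fun_smul hY.diff), pd_sum fun l _ => (hc l).fun_smul (hY.pd l).diff,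
    pd_smul hg hY.diff, pd_smul hh hν.diff]
  simp only [pd_smul (hc _) (hY.pd _).diff, lorentz_add_left, lorentz_sub_left, lorentz_sum_left,
    lorentz_smul_left, H.lorentz_normal_pd x hx, lorentz_comm (Y x), H.lorentz_pd_self hx,
    H.lorentz_pd_pd_pd hx, ← gram_apply, mul_zero, zero_add, mul_add, Finset.sum_add_distrib]
  congr 2
  congr 1
  · exact Finset.sum_congr rfl fun l _ => by rw [mul_comm, gram_comm]
  · simp only [Finset.mul_sum]
    rw [Finset.sum_comm]
    refine Finset.sum_congr rfl fun l _ => Finset.sum_congr rfl fun s _ => ?_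
    rw [gram_comm Y m l]; ring

/-- The Gauss equation. -/
theorem sum_gram_mul_riemann (H : IsHypersurface k Y ν U) (hk : k ≠ 0) (hd : n = d + 1)
    (hx : x ∈ U) (m r i j : Fin d) :
    ∑ l, gram Y Y x m l * riemann (stdFrame d) (gram Y Y) l r i j x =
      -k ^ 2 * (gram Y Y x j r * gram Y Y x i m - gram Y Y x i r * gram Y Y x j m) +
      (gram ν Y x j r * gram ν Y x i m - gram ν Y x i r * gram ν Y x j m) := by
  have h1 := H.lorentz_pd_pd_pd_pd hk hd hx i j r m
  have h2 := H.lorentz_pd_pd_pd_pd hk hd hx j i r m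
  -- Third derivatives are symmetric in `i` and `j`, so subtracting the two identities leaves the
  -- curvature tensor on one side and the quadratic terms on the other.
  rw [pd_comm ((H.smooth x hx).pd r)] at h1
  have h3 : ∑ l, gram Y Y x m l * riemann (stdFrame d) (gram Y Y) l r i j x =
      ∑ l, gram Y Y x m l * (pd i (christoffel (stdFrame d) (gram Y Y) l j r) x +
        ∑ s, christoffel (stdFrame d) (gram Y Y) l i s x *
          christoffel (stdFrame d) (gram Y Y) s j r x) -
      ∑ l, gram Y Y x m l * (pd j (christoffel (stdFrame d) (gram Y Y) l i r) x +
        ∑ s, christoffel (stdFrame d) (gram Y Y) l j s x *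
          christoffel (stdFrame d) (gram Y Y) s i r x) := by
    rw [← Finset.sum_sub_distrib]
    refine Finset.sum_congr rfl fun l _ => ?_
    simp only [riemann, pderiv_stdFrame, Finset.sum_sub_distrib]
    ring
  rw [h3]
  linarith

theorem riemann_eq (H : IsHypersurface k Y ν U) (hk : k ≠ 0) (hd : n = d + 1)
    (hx : x ∈ U) (l r i j : Fin d) :
    riemann (stdFrame d) (gram Y Y) l r i j x = ∑ m, (gram Y Y x)⁻¹ l m *
      (-k ^ 2 * (gram Y Y x j r * gram Y Y x i m - gram Y Y x i r * gram Y Y x j m) +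
      (gram ν Y x j r * gram ν Y x i m - gram ν Y x i r * gram ν Y x j m)) := by
  simp only [← H.sum_gram_mul_riemann hk hd hx, Finset.mul_sum]
  rw [Finset.sum_comm]
  simp only [← mul_assoc, ← Finset.sum_mul, H.inv_mul_apply hx]
  simp

theorem sum_inv_mul_gram (H : IsHypersurface k Y ν U) (hx : x ∈ U) :
    ∑ i, ∑ m, (gram Y Y x)⁻¹ i m * gram Y Y x i m = d := by
  have : ∀ i, ∑ m, (gram Y Y x)⁻¹ i m * gram Y Y x i m = 1 := fun i => by
    have h := H.inv_mul_apply hx i i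
    rw [if_pos rfl] at h
    rw [← h]
    exact Finset.sum_congr rfl fun m _ => by rw [gram_comm Y i m]
  rw [Finset.sum_congr rfl fun i _ => this i]
  simp

/-- The shape operator. -/
def _root_.QuasiSpherical.shape (Y ν : 𝔼 d → Minkowski n) (x : 𝔼 d) : Matrix (Fin d) (Fin d) ℝ :=
  (gram Y Y x)⁻¹ * gram ν Y x

theorem ricci_eq (H : IsHypersurface k Y ν U) (hk : k ≠ 0) (hd : n = d + 1)
    (hx : x ∈ U) (j r : Fin d) :
    ricci (stdFrame d) (gram Y Y) j r x = -k ^ 2 * (d - 1) * gram Y Y x j r +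
      (shape Y ν x).trace * gram ν Y x j r - (gram ν Y x * shape Y ν x) j r := by
  have e1 : ∑ i, ∑ m, (gram Y Y x)⁻¹ i m * gram Y Y x i m = d :=
    H.sum_inv_mul_gram hx
  have e2 : ∑ i, ∑ m, (gram Y Y x)⁻¹ i m * (gram Y Y x i r * gram Y Y x j m) =
      gram Y Y x j r := by
    have : ∀ i, ∑ m, (gram Y Y x)⁻¹ i m * (gram Y Y x i r * gram Y Y x j m) =
        gram Y Y x i r * if i = j then 1 else 0 := fun i => by
      rw [← H.inv_mul_apply hx, Finset.mul_sum]
      exact Finset.sum_congr rfl fun m _ => by rw [gram_comm Y m j]; ring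
    simp [this]
  have e3 : ∑ i, ∑ m, (gram Y Y x)⁻¹ i m * gram ν Y x i m = (shape Y ν x).trace := by
    simp only [shape, Matrix.trace, Matrix.diag, Matrix.mul_apply]
    exact Finset.sum_congr rfl fun i _ => Finset.sum_congr rfl fun m _ => by
      rw [H.gramNormal_comm hx]
  have e4 : ∑ i, ∑ m, (gram Y Y x)⁻¹ i m * (gram ν Y x i r * gram ν Y x j m) =
      (gram ν Y x * shape Y ν x) j r := by
    simp only [shape, ← Matrix.mul_assoc]
    simp only [Matrix.mul_apply, Finset.sum_mul]
    exact Finset.sum_congr rfl fun i _ => Finset.sum_congr rfl fun m _ => by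
      rw [H.inv_comm hx]; ring
  have e5 : ricci (stdFrame d) (gram Y Y) j r x =
      -k ^ 2 * (gram Y Y x j r * (∑ i, ∑ m, (gram Y Y x)⁻¹ i m * gram Y Y x i m) -
        ∑ i, ∑ m, (gram Y Y x)⁻¹ i m * (gram Y Y x i r * gram Y Y x j m)) +
      (gram ν Y x j r * (∑ i, ∑ m, (gram Y Y x)⁻¹ i m * gram ν Y x i m) -
        ∑ i, ∑ m, (gram Y Y x)⁻¹ i m * (gram ν Y x i r * gram ν Y x j m)) := by
    simp only [ricci, H.riemann_eq hk hd hx, Finset.mul_sum, ← Finset.sum_sub_distrib,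
      ← Finset.sum_add_distrib]
    exact Finset.sum_congr rfl fun i _ => Finset.sum_congr rfl fun m _ => by ring
  rw [e5, e1, e2, e3, e4]
  ring

/-- The contracted Gauss equation. -/
theorem coordScalarCurvature_eq (H : IsHypersurface k Y ν U) (hk : k ≠ 0) (hd : n = d + 1)
    (hx : x ∈ U) :
    coordScalarCurvature (stdFrame d) (gram Y Y) x =
      -(d * (d - 1) * k ^ 2) + (shape Y ν x).trace ^ 2 - (shape Y ν x * shape Y ν x).trace := by
  have e1 : ∑ i, ∑ m, (gram Y Y x)⁻¹ i m * gram Y Y x i m = d :=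
    H.sum_inv_mul_gram hx
  have e3 : ∑ i, ∑ m, (gram Y Y x)⁻¹ i m * gram ν Y x i m = (shape Y ν x).trace := by
    simp only [shape, Matrix.trace, Matrix.diag, Matrix.mul_apply]
    exact Finset.sum_congr rfl fun i _ => Finset.sum_congr rfl fun m _ => by
      rw [H.gramNormal_comm hx]
  have e4 : ∑ j, ∑ r, (gram Y Y x)⁻¹ j r * (gram ν Y x * shape Y ν x) j r =
      (shape Y ν x * shape Y ν x).trace := by
    have : shape Y ν x * shape Y ν x = (gram Y Y x)⁻¹ * (gram ν Y x * shape Y ν x) := by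
      rw [← Matrix.mul_assoc]; rfl
    rw [this, Matrix.trace, Finset.sum_comm]
    simp only [Matrix.diag, Matrix.mul_apply (M := (gram Y Y x)⁻¹)]
    exact Finset.sum_congr rfl fun i _ => Finset.sum_congr rfl fun m _ => by
      rw [H.inv_comm hx]
  have e5 : coordScalarCurvature (stdFrame d) (gram Y Y) x =
      -k ^ 2 * (d - 1) * (∑ i, ∑ m, (gram Y Y x)⁻¹ i m * gram Y Y x i m) +
      (shape Y ν x).trace * (∑ i, ∑ m, (gram Y Y x)⁻¹ i m * gram ν Y x i m) -
      ∑ j, ∑ r, (gram Y Y x)⁻¹ j r * (gram ν Y x * shape Y ν x) j r := by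
    simp only [coordScalarCurvature, H.ricci_eq hk hd hx, Finset.mul_sum,
      ← Finset.sum_sub_distrib, ← Finset.sum_add_distrib]
    exact Finset.sum_congr rfl fun i _ => Finset.sum_congr rfl fun m _ => by ring
  rw [e5, e1, e3, e4]
  ring

/-- The numerator of the sectional curvature, by the Gauss equation. -/
theorem sum_riemann_eq (H : IsHypersurface k Y ν U) (hk : k ≠ 0) (hd : n = d + 1)
    (hx : x ∈ U) (v w : Fin d → ℝ) :
    (∑ m, ∑ l, ∑ r, ∑ i, ∑ j, gram Y Y x m l * v m *
      riemann (stdFrame d) (gram Y Y) l r i j x * v i * w j * w r) =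
    -k ^ 2 * ((∑ i, ∑ j, gram Y Y x i j * v i * v j) * (∑ i, ∑ j, gram Y Y x i j * w i * w j)
      - (∑ i, ∑ j, gram Y Y x i j * v i * w j) ^ 2) +
    ((∑ i, ∑ j, gram ν Y x i j * v i * v j) * (∑ i, ∑ j, gram ν Y x i j * w i * w j)
      - (∑ i, ∑ j, gram ν Y x i j * v i * w j) ^ 2) := by
  have h1 : (∑ m, ∑ l, ∑ r, ∑ i, ∑ j, gram Y Y x m l * v m *
      riemann (stdFrame d) (gram Y Y) l r i j x * v i * w j * w r) =
      ∑ i, ∑ m, ∑ j, ∑ r, (v m * v i * w j * w r) *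
        ∑ l, gram Y Y x m l * riemann (stdFrame d) (gram Y Y) l r i j x := by
    rw [Finset.sum_comm (s := Finset.univ (α := Fin d)) (f := fun i m => ∑ j, ∑ r,
      (v m * v i * w j * w r) * ∑ l, gram Y Y x m l * riemann (stdFrame d) (gram Y Y) l r i j x)]
    refine Finset.sum_congr rfl fun m _ => ?_
    simp only [Finset.mul_sum]
    calc _ = ∑ r, ∑ l, ∑ i, ∑ j, gram Y Y x m l * v m *
          riemann (stdFrame d) (gram Y Y) l r i j x * v i * w j * w r := Finset.sum_comm
      _ = ∑ r, ∑ i, ∑ j, ∑ l, v m * v i * w j * w r *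
          (gram Y Y x m l * riemann (stdFrame d) (gram Y Y) l r i j x) := by
        refine Finset.sum_congr rfl fun r _ => ?_
        rw [Finset.sum_comm]
        refine Finset.sum_congr rfl fun i _ => ?_
        rw [Finset.sum_comm]
        exact Finset.sum_congr rfl fun j _ => Finset.sum_congr rfl fun l _ => by ring
      _ = _ := by
        rw [Finset.sum_comm]
        exact Finset.sum_congr rfl fun i _ => Finset.sum_comm
  have prod : ∀ A B : Fin d → Fin d → ℝ, (∑ i, ∑ m, A i m) * (∑ j, ∑ r, B j r) =
      ∑ i, ∑ m, ∑ j, ∑ r, A i m * B j r := by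
    intro A B
    simp only [Finset.sum_mul]
    simp only [Finset.mul_sum]
  have swap : ∀ A : Matrix (Fin d) (Fin d) ℝ,
      ∑ i, ∑ m, ∑ j, ∑ r, (A i r * v i * w r) * (A m j * v m * w j) =
      (∑ i, ∑ j, A i j * v i * w j) ^ 2 := by
    intro A
    simp only [← Finset.sum_mul, ← Finset.mul_sum, sq]
  rw [h1, prod, prod, ← swap, ← swap]
  simp only [H.sum_gram_mul_riemann hk hd hx, ← Finset.sum_sub_distrib, Finset.mul_sum,
    ← Finset.sum_add_distrib]
  refine Finset.sum_congr rfl fun i _ => Finset.sum_congr rfl fun m _ =>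
    Finset.sum_congr rfl fun j _ => Finset.sum_congr rfl fun r _ => ?_
  rw [gram_comm Y j m, H.gramNormal_comm hx j m]
  ring

end IsHypersurface

end Hypersurface

/-! ### Change of coordinates -/

section ChangeOfCoordinates

variable {d n : ℕ}

local notation "𝔼" d:max => EuclideanSpace ℝ (Fin d)

/-- The transposed Jacobi matrix of `T`. -/
def jacobi (T : 𝔼 d → 𝔼 d) (x : 𝔼 d) : Matrix (Fin d) (Fin d) ℝ :=
  Matrix.of fun i a => pd i T x a

theorem gram_comp {Y Z : 𝔼 d → Minkowski n} {T : 𝔼 d → 𝔼 d} {x : 𝔼 d}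
    (hY : DifferentiableAt ℝ Y (T x)) (hZ : DifferentiableAt ℝ Z (T x))
    (hT : DifferentiableAt ℝ T x) :
    gram (fun y => Y (T y)) (fun y => Z (T y)) x =
      jacobi T x * gram Y Z (T x) * (jacobi T x).transpose := by
  ext i j
  simp only [gram_apply, pd_comp hY hT, pd_comp hZ hT, lorentz_sum_left, lorentz_sum_right,
    lorentz_smul_left, lorentz_smul_right, Matrix.mul_apply, Matrix.transpose_apply, jacobi,
    Matrix.of_apply, Finset.sum_mul, Finset.mul_sum]
  exact Finset.sum_congr rfl fun a _ => Finset.sum_congr rfl fun b _ => by ring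

/-! ### Invariants of a pair of bilinear forms under congruence -/

section Congruence

variable {ι : Type*} [Fintype ι] [DecidableEq ι] {G G' h h' J : Matrix ι ι ℝ}

theorem isUnit_det_of_congruence (hG : G' = J * G * J.transpose) (hdet : G'.det ≠ 0) :
    IsUnit J.det ∧ IsUnit G.det := by
  rw [hG, Matrix.det_mul, Matrix.det_mul, Matrix.det_transpose] at hdet
  refine ⟨isUnit_iff_ne_zero.2 fun h => hdet (by simp [h]), isUnit_iff_ne_zero.2 fun h => hdet (by simp [h])⟩

theorem inv_of_congruence (hG : G' = J * G * J.transpose) (hdet : G'.det ≠ 0) :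
    G⁻¹ = J.transpose * G'⁻¹ * J := by
  obtain ⟨hJ, -⟩ := isUnit_det_of_congruence hG hdet
  have hJt : IsUnit J.transpose.det := by rwa [Matrix.det_transpose]
  rw [hG, Matrix.mul_inv_rev, Matrix.mul_inv_rev]
  rw [← Matrix.mul_assoc, Matrix.mul_nonsing_inv _ hJt, Matrix.one_mul, Matrix.mul_assoc,
    Matrix.nonsing_inv_mul _ hJ, Matrix.mul_one]

/-- A change of frame acts on the shape operator by conjugation, which is why its trace and the
trace of its square do not depend on the chart. -/
theorem shape_of_congruence (hG : G' = J * G * J.transpose) (hh : h' = J * h * J.transpose)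
    (hdet : G'.det ≠ 0) :
    G⁻¹ * h = J.transpose * (G'⁻¹ * h') * J.transpose⁻¹ := by
  obtain ⟨hJ, -⟩ := isUnit_det_of_congruence hG hdet
  have hJt : IsUnit J.transpose.det := by rwa [Matrix.det_transpose]
  rw [inv_of_congruence hG hdet, hh]
  simp only [Matrix.mul_assoc]
  rw [Matrix.mul_nonsing_inv _ hJt, Matrix.mul_one]

theorem trace_of_congruence (hG : G' = J * G * J.transpose) (hh : h' = J * h * J.transpose)
    (hdet : G'.det ≠ 0) : (G⁻¹ * h).trace = (G'⁻¹ * h').trace := by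
  obtain ⟨hJ, -⟩ := isUnit_det_of_congruence hG hdet
  have hJt : IsUnit J.transpose.det := by rwa [Matrix.det_transpose]
  rw [shape_of_congruence hG hh hdet, Matrix.trace_mul_comm, ← Matrix.mul_assoc,
    Matrix.nonsing_inv_mul _ hJt, Matrix.one_mul]

theorem trace_sq_of_congruence (hG : G' = J * G * J.transpose) (hh : h' = J * h * J.transpose)
    (hdet : G'.det ≠ 0) :
    (G⁻¹ * h * (G⁻¹ * h)).trace = (G'⁻¹ * h' * (G'⁻¹ * h')).trace := by
  obtain ⟨hJ, -⟩ := isUnit_det_of_congruence hG hdet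
  have hJt : IsUnit J.transpose.det := by rwa [Matrix.det_transpose]
  rw [shape_of_congruence hG hh hdet]
  have : J.transpose * (G'⁻¹ * h') * J.transpose⁻¹ * (J.transpose * (G'⁻¹ * h') * J.transpose⁻¹) =
      J.transpose * (G'⁻¹ * h' * (G'⁻¹ * h')) * J.transpose⁻¹ := by
    calc _ = J.transpose * (G'⁻¹ * h') * (J.transpose⁻¹ * J.transpose) * (G'⁻¹ * h') *
          J.transpose⁻¹ := by simp only [Matrix.mul_assoc]
      _ = _ := by
        rw [Matrix.nonsing_inv_mul _ hJt, Matrix.mul_one]; simp only [Matrix.mul_assoc]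
  rw [this, Matrix.trace_mul_comm, ← Matrix.mul_assoc,
    Matrix.nonsing_inv_mul _ hJt, Matrix.one_mul]

theorem sqrt_det_of_congruence (hG : G' = J * G * J.transpose) :
    √G'.det = |J.det| * √G.det := by
  have : G'.det = J.det ^ 2 * G.det := by
    rw [hG, Matrix.det_mul, Matrix.det_mul, Matrix.det_transpose]; ring
  rw [this, Real.sqrt_mul (sq_nonneg _), Real.sqrt_sq_eq_abs]

end Congruence

/-- Matches the frame change of the metric with the Jacobian of the change of variables formula. -/
theorem det_jacobi (T : 𝔼 d → 𝔼 d) (x : 𝔼 d) :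
    (jacobi T x).det = (fderiv ℝ T x).det := by
  rw [ContinuousLinearMap.det, ← LinearMap.det_toMatrix (EuclideanSpace.basisFun (Fin d) ℝ).toBasis,
    ← Matrix.det_transpose]
  congr 1

end ChangeOfCoordinates

/-! ### The Laplacian in coordinates -/

section Laplacian

variable {d n : ℕ} {V : Type*} [NormedAddCommGroup V] [NormedSpace ℝ V]

local notation "𝔼" d:max => EuclideanSpace ℝ (Fin d)

/-- The first order coefficients of the Laplacian. -/
def drift (Y : 𝔼 d → Minkowski n) (x : 𝔼 d) (j : Fin d) : ℝ :=
  (√(gram Y Y x).det)⁻¹ * ∑ i, pd i (fun y => √(gram Y Y y).det * (gram Y Y y)⁻¹ i j) x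

/-- The Laplacian of a vector-valued function in the metric induced by `Y`. -/
def vecLaplacian (Y : 𝔼 d → Minkowski n) (u : 𝔼 d → V) (x : 𝔼 d) : V :=
  ∑ i, ∑ j, (gram Y Y x)⁻¹ i j • pd i (pd j u) x + ∑ j, drift Y x j • pd j u x

/-- Passes from the vector identity for ΔY to scalar functions, the only ones to which `laplacian`
and Green's identity apply. -/
theorem vecLaplacian_clm (Y : 𝔼 d → Minkowski n) (L : V →L[ℝ] ℝ) {u : 𝔼 d → V} {x : 𝔼 d}
    (hu : ContDiffAt ℝ ∞ u x) :
    vecLaplacian Y (fun y => L (u y)) x = L (vecLaplacian Y u x) := by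
  have h1 : ∀ j, pd j (fun y => L (u y)) =ᶠ[𝓝 x] fun y => L (pd j u y) := by
    intro j
    have h0 : ContDiffAt ℝ 1 u x := hu.of_le (by simp)
    filter_upwards [h0.eventually (by simp)] with y hy
    exact pd_clm L (hy.differentiableAt (by simp)) j
  simp only [vecLaplacian, pd_congr (h1 _), (h1 _).eq_of_nhds, pd_clm L (hu.pd _).diff, map_add,
    map_sum, map_smul]

namespace IsHypersurface

variable {k : ℝ} {Y ν : 𝔼 d → Minkowski n} {U : Set (𝔼 d)} {x : 𝔼 d}

/-- The product rule turns the divergence form into second order plus drift terms, a form that makes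
sense for vector-valued functions and to which the chain rule applies. -/
theorem coordLaplacian_eq (H : IsHypersurface k Y ν U) (hx : x ∈ U) {u : 𝔼 d → ℝ}
    (hu : ContDiffAt ℝ ∞ u x) :
    coordLaplacian (stdFrame d) (gram Y Y) u x = vecLaplacian Y u x := by
  have hs : √(gram Y Y x).det ≠ 0 := (Real.sqrt_pos.2 (H.det_pos hx)).ne'
  have hP : ∀ i j, DifferentiableAt ℝ (fun y => √(gram Y Y y).det * (gram Y Y y)⁻¹ i j) x :=
    fun i j => ((H.contDiffAt_sqrt hx).mul (H.contDiffAt_inv hx i j)).diff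
  have hd : ∀ j, DifferentiableAt ℝ (fun y => pd j u y) x := fun j => (hu.pd j).diff
  simp only [coordLaplacian, pderiv, vecLaplacian, drift]
  change (√(gram Y Y x).det)⁻¹ * ∑ i, ∑ j,
    pd i (fun y => √(gram Y Y y).det * (gram Y Y y)⁻¹ i j * pd j u y) x = _
  simp only [pd_mul (hP _ _) (hd _), smul_eq_mul, Finset.sum_add_distrib, mul_add, Finset.mul_sum,
    Finset.sum_mul]
  rw [add_comm]
  congr 1
  · refine Finset.sum_congr rfl fun i _ => Finset.sum_congr rfl fun j _ => ?_
    field_simp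
  · rw [Finset.sum_comm]
    refine Finset.sum_congr rfl fun i _ => Finset.sum_congr rfl fun j _ => ?_
    ring

theorem contDiffAt_coordLaplacian (H : IsHypersurface k Y ν U) (hx : x ∈ U) {u : 𝔼 d → ℝ}
    (hu : ContDiffAt ℝ ∞ u x) :
    ContDiffAt ℝ ∞ (coordLaplacian (stdFrame d) (gram Y Y) u) x := by
  have hs : √(gram Y Y x).det ≠ 0 := (Real.sqrt_pos.2 (H.det_pos hx)).ne'
  refine ((H.contDiffAt_sqrt hx).inv hs).mul (ContDiffAt.sum fun i _ => ContDiffAt.sum fun j _ => ?_)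
  exact (((H.contDiffAt_sqrt hx).mul (H.contDiffAt_inv hx i j)).mul (hu.pd j)).pd i

/-- The integrand in Green's second identity is a divergence. -/
theorem green_eq (H : IsHypersurface k Y ν U) (hx : x ∈ U) {u φ : 𝔼 d → ℝ}
    (hu : ContDiffAt ℝ ∞ u x) (hφ : ContDiffAt ℝ ∞ φ x) :
    √(gram Y Y x).det * (coordLaplacian (stdFrame d) (gram Y Y) u x * φ x -
      u x * coordLaplacian (stdFrame d) (gram Y Y) φ x) =
    ∑ i, pd i (fun y => ∑ j, √(gram Y Y y).det * (gram Y Y y)⁻¹ i j *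
      (φ y * pd j u y - u y * pd j φ y)) x := by
  have hs : √(gram Y Y x).det ≠ 0 := (Real.sqrt_pos.2 (H.det_pos hx)).ne'
  have hP : ∀ i j, DifferentiableAt ℝ (fun y => √(gram Y Y y).det * (gram Y Y y)⁻¹ i j) x :=
    fun i j => ((H.contDiffAt_sqrt hx).mul (H.contDiffAt_inv hx i j)).diff
  have hud : ∀ j, DifferentiableAt ℝ (fun y => pd j u y) x := fun j => (hu.pd j).diff
  have hφd : ∀ j, DifferentiableAt ℝ (fun y => pd j φ y) x := fun j => (hφ.pd j).diff
  have hu0 := hu.diff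
  have hφ0 := hφ.diff
  have h1 : ∀ i j, pd i (fun y => √(gram Y Y y).det * (gram Y Y y)⁻¹ i j *
      (φ y * pd j u y - u y * pd j φ y)) x =
      φ x * pd i (fun y => √(gram Y Y y).det * (gram Y Y y)⁻¹ i j * pd j u y) x -
      u x * pd i (fun y => √(gram Y Y y).det * (gram Y Y y)⁻¹ i j * pd j φ y) x +
      √(gram Y Y x).det * ((gram Y Y x)⁻¹ i j * (pd i φ x * pd j u x) -
        (gram Y Y x)⁻¹ i j * (pd i u x * pd j φ x)) := by
    intro i j
    rw [pd_mul (hP i j) ((hφ0.fun_mul (hud j)).fun_sub (hu0.fun_mul (hφd j))),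
      pd_sub (hφ0.fun_mul (hud j)) (hu0.fun_mul (hφd j)), pd_mul hφ0 (hud j),
      pd_mul hu0 (hφd j), pd_mul (hP i j) (hud j), pd_mul (hP i j) (hφd j)]
    ring
  -- The cross terms ⟨dφ, du⟩ - ⟨du, dφ⟩ cancel by symmetry of the inverse metric.
  have h2 : ∑ i, ∑ j, √(gram Y Y x).det * ((gram Y Y x)⁻¹ i j * (pd i φ x * pd j u x) -
        (gram Y Y x)⁻¹ i j * (pd i u x * pd j φ x)) = 0 := by
    simp only [← Finset.mul_sum, Finset.sum_sub_distrib]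
    rw [Finset.sum_comm (f := fun i j => (gram Y Y x)⁻¹ i j * (pd i φ x * pd j u x))]
    rw [sub_eq_zero.2, mul_zero]
    refine Finset.sum_congr rfl fun i _ => Finset.sum_congr rfl fun j _ => ?_
    rw [H.inv_comm hx]; ring
  have h3 : ∀ i, pd i (fun y => ∑ j, √(gram Y Y y).det * (gram Y Y y)⁻¹ i j *
      (φ y * pd j u y - u y * pd j φ y)) x = ∑ j, pd i (fun y => √(gram Y Y y).det *
      (gram Y Y y)⁻¹ i j * (φ y * pd j u y - u y * pd j φ y)) x := fun i =>
    pd_sum (fun j _ => (hP i j).fun_mul ((hφ0.fun_mul (hud j)).fun_sub (hu0.fun_mul (hφd j)))) i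
  simp only [h3, h1, Finset.sum_add_distrib]
  rw [h2, add_zero]
  simp only [Finset.sum_sub_distrib, ← Finset.mul_sum]
  simp only [coordLaplacian, pderiv_stdFrame]
  change √(gram Y Y x).det * ((√(gram Y Y x).det)⁻¹ * (∑ i, ∑ j,
    pd i (fun y => √(gram Y Y y).det * (gram Y Y y)⁻¹ i j * pd j u y) x) * φ x -
    u x * ((√(gram Y Y x).det)⁻¹ * (∑ i, ∑ j,
    pd i (fun y => √(gram Y Y y).det * (gram Y Y y)⁻¹ i j * pd j φ y) x))) = _
  field_simp

/-- Jacobi's formula; the factor 1/2 of the square root absorbs the two equal contributions to ∂_l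
G_ij. -/
theorem pd_sqrt_det (H : IsHypersurface k Y ν U) (hx : x ∈ U) (l : Fin d) :
    pd l (fun y => √(gram Y Y y).det) x = √(gram Y Y x).det *
      ∑ i, ∑ j, (gram Y Y x)⁻¹ i j * lorentz (pd i (pd l Y) x) (pd j Y x) := by
  have hpos := H.det_pos hx
  have h1 := hasFDerivAt_det (A := gram Y Y) (x := x)
    (fun i j => (H.contDiffAt_gram hx i j).diff.hasFDerivAt)
  have h2 := (h1.sqrt hpos.ne').fderiv
  have hs : √(gram Y Y x).det ≠ 0 := (Real.sqrt_pos.2 hpos).ne'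
  have hss : √(gram Y Y x).det * √(gram Y Y x).det = (gram Y Y x).det := Real.mul_self_sqrt hpos.le
  have hadj : ∀ i j, (gram Y Y x).adjugate j i = (gram Y Y x).det * (gram Y Y x)⁻¹ i j := by
    intro i j
    rw [H.inv_comm hx, Matrix.inv_def, Ring.inverse_eq_inv', Matrix.smul_apply, smul_eq_mul,
      ← mul_assoc, mul_inv_cancel₀ hpos.ne', one_mul]
  have h3 : pd l (fun y => √(gram Y Y y).det) x = 1 / (2 * √(gram Y Y x).det) *
      ∑ i, ∑ j, (gram Y Y x).adjugate j i * pd l (fun y => gram Y Y y i j) x := by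
    rw [pd, h2]
    simp [pd]
  rw [h3]
  simp only [hadj, H.pd_gram hx, mul_assoc, ← Finset.mul_sum, mul_add, Finset.sum_add_distrib]
  have h4 : ∑ i, ∑ j, (gram Y Y x)⁻¹ i j * lorentz (pd l (pd j Y) x) (pd i Y x) =
      ∑ i, ∑ j, (gram Y Y x)⁻¹ i j * lorentz (pd i (pd l Y) x) (pd j Y x) := by
    rw [Finset.sum_comm]
    refine Finset.sum_congr rfl fun i _ => Finset.sum_congr rfl fun j _ => ?_
    rw [H.inv_comm hx, pd_comm (H.smooth x hx)]
  have h5 : ∑ i, ∑ j, (gram Y Y x)⁻¹ i j * lorentz (pd l (pd i Y) x) (pd j Y x) =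
      ∑ i, ∑ j, (gram Y Y x)⁻¹ i j * lorentz (pd i (pd l Y) x) (pd j Y x) := by
    refine Finset.sum_congr rfl fun i _ => Finset.sum_congr rfl fun j _ => ?_
    rw [pd_comm (H.smooth x hx)]
  rw [h4, h5]
  generalize √(gram Y Y x).det = q at hs hss
  rw [← hss]
  field_simp
  ring

/-- Differentiate √det G · G^{ij} G_jl = √det G · δ_il in the direction `i` and sum. One half of ∂_i
G_jl contributes exactly ∂_l √det G by `pd_sqrt_det`, and what remains is the tangential part of ΔY,
which is therefore zero. -/
theorem lorentz_vecLaplacian_pd (H : IsHypersurface k Y ν U) (hx : x ∈ U) (l : Fin d) :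
    lorentz (vecLaplacian Y Y x) (pd l Y x) = 0 := by
  have hs : √(gram Y Y x).det ≠ 0 := (Real.sqrt_pos.2 (H.det_pos hx)).ne'
  have hP : ∀ i j, DifferentiableAt ℝ (fun y => √(gram Y Y y).det * (gram Y Y y)⁻¹ i j) x :=
    fun i j => ((H.contDiffAt_sqrt hx).mul (H.contDiffAt_inv hx i j)).diff
  have h1 : ∀ i, ∑ j, (pd i (fun y => √(gram Y Y y).det * (gram Y Y y)⁻¹ i j) x * gram Y Y x j l +
      √(gram Y Y x).det * (gram Y Y x)⁻¹ i j * pd i (fun y => gram Y Y y j l) x) =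
      if i = l then pd i (fun y => √(gram Y Y y).det) x else 0 := by
    intro i
    have e1 : (fun y => ∑ j, √(gram Y Y y).det * (gram Y Y y)⁻¹ i j * gram Y Y y j l) =ᶠ[𝓝 x]
        fun y => if i = l then √(gram Y Y y).det else 0 := by
      filter_upwards [H.isOpen.mem_nhds hx] with y hy
      simp only [mul_assoc, ← Finset.mul_sum, H.inv_mul_apply hy]
      split_ifs <;> simp
    have e2 := pd_congr e1 i
    rw [pd_sum fun j _ => (hP i j).fun_mul (H.contDiffAt_gram hx j l).diff] at e2
    simp only [pd_mul (hP i _) (H.contDiffAt_gram hx _ l).diff] at e2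
    rw [e2]
    split_ifs
    · rfl
    · exact pd_const 0 i x
  have h2 : ∑ i, ∑ j, (pd i (fun y => √(gram Y Y y).det * (gram Y Y y)⁻¹ i j) x * gram Y Y x j l +
      √(gram Y Y x).det * (gram Y Y x)⁻¹ i j * pd i (fun y => gram Y Y y j l) x) =
      pd l (fun y => √(gram Y Y y).det) x := by
    simp only [h1]; simp
  rw [H.pd_sqrt_det hx] at h2
  simp only [H.pd_gram hx, Finset.sum_add_distrib, mul_add, mul_assoc, ← Finset.mul_sum] at h2
  have h5 : √(gram Y Y x).det * lorentz (vecLaplacian Y Y x) (pd l Y x) =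
      ∑ i, ∑ j, pd i (fun y => √(gram Y Y y).det * (gram Y Y y)⁻¹ i j) x * gram Y Y x j l +
      √(gram Y Y x).det *
        ∑ i, ∑ j, (gram Y Y x)⁻¹ i j * lorentz (pd i (pd j Y) x) (pd l Y x) := by
    simp only [vecLaplacian, drift, lorentz_add_left, lorentz_sum_left, lorentz_smul_left,
      mul_add, ← gram_apply]
    rw [add_comm]
    congr 1
    rw [Finset.mul_sum, Finset.sum_comm]
    refine Finset.sum_congr rfl fun j _ => ?_
    rw [← Finset.sum_mul]
    field_simp
  have h6 : √(gram Y Y x).det * lorentz (vecLaplacian Y Y x) (pd l Y x) = 0 := by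
    rw [h5]; linarith
  exact (mul_eq_zero.1 h6).resolve_left hs

/-- The Laplacian of the position vector. -/
theorem vecLaplacian_self (H : IsHypersurface k Y ν U) (hk : k ≠ 0) (hd : n = d + 1) (hx : x ∈ U) :
    vecLaplacian Y Y x = (d * k ^ 2) • Y x - (shape Y ν x).trace • ν x := by
  have e3' : lorentz (Y x) (ν x) = 0 := by rw [lorentz_comm]; exact H.lorentz_normal_self x hx
  apply H.eq_of_lorentz_eq hk hd hx
  · simp only [vecLaplacian, lorentz_add_left, lorentz_sum_left, lorentz_smul_left,
      lorentz_sub_left, H.lorentz_pd_pd_self hx, H.lorentz_pd_self hx, H.lorentz_self x hx,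
      H.lorentz_normal_self x hx, mul_zero, Finset.sum_const_zero, add_zero, sub_zero, mul_neg,
      Finset.sum_neg_distrib, H.sum_inv_mul_gram hx]
    field_simp
  · simp only [vecLaplacian, lorentz_add_left, lorentz_sum_left, lorentz_smul_left,
      lorentz_sub_left, H.lorentz_pd_pd_normal hx, H.lorentz_pd_normal hx, H.lorentz_normal x hx,
      e3', mul_zero, Finset.sum_const_zero, add_zero, zero_sub, mul_neg, mul_one,
      Finset.sum_neg_distrib]
    congr 1
    simp only [shape, Matrix.trace, Matrix.diag, Matrix.mul_apply]
    exact Finset.sum_congr rfl fun i _ => Finset.sum_congr rfl fun m _ => by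
      rw [H.gramNormal_comm hx]
  · intro l
    rw [H.lorentz_vecLaplacian_pd hx, lorentz_sub_left, lorentz_smul_left, lorentz_smul_left,
      lorentz_comm (Y x), H.lorentz_pd_self hx, H.lorentz_normal_pd x hx]
    simp

end IsHypersurface

end Laplacian

/-! ### Invariance of the Laplacian under changes of coordinates -/

section LaplacianInvariance

variable {d n : ℕ} {V : Type*} [NormedAddCommGroup V] [NormedSpace ℝ V]

local notation "𝔼" d:max => EuclideanSpace ℝ (Fin d)

theorem contDiffAt_coord {f : 𝔼 d → 𝔼 d} {x : 𝔼 d} (hf : ContDiffAt ℝ ∞ f x) (a : Fin d) :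
    ContDiffAt ℝ ∞ (fun y => f y a) x :=
  (EuclideanSpace.proj (𝕜 := ℝ) a).contDiff.contDiffAt.comp x hf

/-- The second order chain rule in coordinates. -/
theorem pd_pd_comp {f : 𝔼 d → V} {T : 𝔼 d → 𝔼 d} {x : 𝔼 d} (hf : ContDiffAt ℝ ∞ f (T x))
    (hT : ContDiffAt ℝ ∞ T x) (i j : Fin d) :
    pd i (pd j (fun y => f (T y))) x =
      ∑ a, ((pd i (fun y => pd j T y a) x) • pd a f (T x) +
        pd j T x a • ∑ b, pd i T x b • pd b (pd a f) (T x)) := by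
  have h1 : pd j (fun y => f (T y)) =ᶠ[𝓝 x] fun y => ∑ a, pd j T y a • pd a f (T y) := by
    have hT1 : ContDiffAt ℝ 1 T x := hT.of_le (by simp)
    have hf1 : ContDiffAt ℝ 1 f (T x) := hf.of_le (by simp)
    filter_upwards [hT1.eventually (by simp),
      hT.continuousAt.eventually (hf1.eventually (by simp))] with y hy hy'
    exact pd_comp (hy'.differentiableAt (by simp)) (hy.differentiableAt (by simp)) j
  have hd1 : ∀ a, DifferentiableAt ℝ (fun y => pd j T y a) x :=
    fun a => (contDiffAt_coord (hT.pd j) a).diff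
  have hd2 : ∀ a, DifferentiableAt ℝ (fun y => pd a f (T y)) x :=
    fun a => ((hf.pd a).comp x hT).diff
  rw [pd_congr h1, pd_sum fun a _ => (hd1 a).fun_smul (hd2 a)]
  refine Finset.sum_congr rfl fun a _ => ?_
  rw [pd_smul (hd1 a) (hd2 a), pd_comp (hf.pd a).diff hT.diff]

/-- The first order coefficients obtained from a change of coordinates. -/
def driftComp (Y : 𝔼 d → Minkowski n) (T : 𝔼 d → 𝔼 d) (x : 𝔼 d) (a : Fin d) : ℝ :=
  ∑ i, ∑ j, (gram (fun y => Y (T y)) (fun y => Y (T y)) x)⁻¹ i j * pd i (fun y => pd j T y a) x +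
    ∑ j, drift (fun y => Y (T y)) x j * pd j T x a

namespace IsHypersurface

variable {k k' : ℝ} {Y ν : 𝔼 d → Minkowski n} {U : Set (𝔼 d)} {x : 𝔼 d} {T : 𝔼 d → 𝔼 d}
  {ν' : 𝔼 d → Minkowski n} {U' : Set (𝔼 d)}

/-- The second order part transforms as a tensor because the inverse metric does; everything of
first order produced by the chain rule is collected in `driftComp`. -/
theorem vecLaplacian_comp_eq (H : IsHypersurface k Y ν U)
    (H' : IsHypersurface k' (fun y => Y (T y)) ν' U') (hx : x ∈ U') (hTx : T x ∈ U)
    (hT : ContDiffAt ℝ ∞ T x) {u : 𝔼 d → V} (hu : ContDiffAt ℝ ∞ u (T x)) :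
    vecLaplacian (fun y => Y (T y)) (fun y => u (T y)) x =
      ∑ a, ∑ b, (gram Y Y (T x))⁻¹ a b • pd a (pd b u) (T x) +
        ∑ a, driftComp Y T x a • pd a u (T x) := by
  have hG := gram_comp (H.smooth _ hTx).diff (H.smooth _ hTx).diff hT.diff
  have hinv := inv_of_congruence hG (H'.det_pos hx).ne'
  have e1 : ∀ a b, (gram Y Y (T x))⁻¹ a b = ∑ i, ∑ j, pd i T x a *
      (gram (fun y => Y (T y)) (fun y => Y (T y)) x)⁻¹ i j * pd j T x b := by
    intro a b
    rw [hinv]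
    simp only [Matrix.mul_apply, Matrix.transpose_apply, jacobi, Matrix.of_apply, Finset.sum_mul]
    rw [Finset.sum_comm]
  simp only [vecLaplacian, pd_pd_comp hu hT, pd_comp hu.diff hT.diff, e1, driftComp, add_smul,
    Finset.sum_smul, Finset.smul_sum, smul_add, Finset.sum_add_distrib, smul_smul]
  rw [add_comm (∑ i, ∑ j, ∑ a, _) (∑ i, ∑ j, ∑ a, _), add_assoc]
  congr 1
  · calc _ = ∑ i, ∑ a, ∑ b, ∑ j, (((gram (fun y => Y (T y)) (fun y => Y (T y)) x)⁻¹ i j *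
          (pd j T x b * pd i T x a)) • pd a (pd b u) (T x)) := by
          refine Finset.sum_congr rfl fun i _ => ?_
          calc _ = ∑ j, ∑ a, ∑ b, (((gram (fun y => Y (T y)) (fun y => Y (T y)) x)⁻¹ i j *
              (pd j T x b * pd i T x a)) • pd a (pd b u) (T x)) :=
              Finset.sum_congr rfl fun j _ => Finset.sum_comm
            _ = ∑ a, ∑ j, ∑ b, (((gram (fun y => Y (T y)) (fun y => Y (T y)) x)⁻¹ i j *
              (pd j T x b * pd i T x a)) • pd a (pd b u) (T x)) := Finset.sum_comm
            _ = _ := Finset.sum_congr rfl fun a _ => Finset.sum_comm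
      _ = ∑ a, ∑ b, ∑ i, ∑ j, (((gram (fun y => Y (T y)) (fun y => Y (T y)) x)⁻¹ i j *
          (pd j T x b * pd i T x a)) • pd a (pd b u) (T x)) := by
          rw [Finset.sum_comm]
          exact Finset.sum_congr rfl fun a _ => Finset.sum_comm
      _ = _ := by
          refine Finset.sum_congr rfl fun a _ => Finset.sum_congr rfl fun b _ =>
            Finset.sum_congr rfl fun i _ => Finset.sum_congr rfl fun j _ => ?_
          congr 1; ring
  · congr 1
    · calc _ = ∑ i, ∑ a, ∑ j, (((gram (fun y => Y (T y)) (fun y => Y (T y)) x)⁻¹ i j *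
          pd i (fun y => pd j T y a) x) • pd a u (T x)) :=
          Finset.sum_congr rfl fun i _ => Finset.sum_comm
        _ = _ := Finset.sum_comm
    · exact Finset.sum_comm

/-- Applied to the position vector, the two operators differ by a tangent vector whose components
are the differences of the drifts. Both Laplacians of the position vector are orthogonal to the
hypersurface, so this tangent vector is orthogonal to all tangent vectors and vanishes. This avoids
transforming the derivatives of √det G directly. -/
theorem driftComp_eq (H : IsHypersurface k Y ν U)
    (H' : IsHypersurface k' (fun y => Y (T y)) ν' U') (hx : x ∈ U') (hTx : T x ∈ U)
    (hT : ContDiffAt ℝ ∞ T x) (a : Fin d) : driftComp Y T x a = drift Y (T x) a := by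
  have hG := gram_comp (H.smooth _ hTx).diff (H.smooth _ hTx).diff hT.diff
  obtain ⟨hJ, hdet⟩ := isUnit_det_of_congruence hG (H'.det_pos hx).ne'
  have h1 := H.vecLaplacian_comp_eq H' hx hTx hT (H.smooth _ hTx)
  have h2 : vecLaplacian (fun y => Y (T y)) (fun y => Y (T y)) x - vecLaplacian Y Y (T x) =
      ∑ a, (driftComp Y T x a - drift Y (T x) a) • pd a Y (T x) := by
    rw [h1, vecLaplacian]
    simp only [sub_smul, Finset.sum_sub_distrib]
    abel
  set c : Fin d → ℝ := fun a => driftComp Y T x a - drift Y (T x) a with hc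
  have h3 : ∀ i, lorentz (∑ a, c a • pd a Y (T x)) (pd i (fun y => Y (T y)) x) = 0 := by
    intro i
    rw [← h2, lorentz_sub_left, H'.lorentz_vecLaplacian_pd hx,
      pd_comp (H.smooth _ hTx).diff hT.diff, lorentz_sum_right]
    simp [lorentz_smul_right, H.lorentz_vecLaplacian_pd hTx]
  have h4 : (jacobi T x * gram Y Y (T x)).mulVec c = 0 := by
    ext i
    have := h3 i
    rw [pd_comp (H.smooth _ hTx).diff hT.diff, lorentz_comm] at this
    simp only [lorentz_sum_left, lorentz_sum_right, lorentz_smul_left, lorentz_smul_right] at this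
    rw [← Matrix.mulVec_mulVec]
    simp only [Matrix.mulVec, dotProduct, jacobi, Matrix.of_apply, gram_apply, Pi.zero_apply,
      Finset.mul_sum]
    rw [← this, Finset.sum_comm]
    refine Finset.sum_congr rfl fun a _ => ?_
    rw [Finset.mul_sum]
    exact Finset.sum_congr rfl fun b _ => by ring
  have h5 : c = 0 := by
    refine Matrix.eq_zero_of_mulVec_eq_zero ?_ h4
    rw [Matrix.det_mul]
    exact (hJ.mul hdet).ne_zero
  have := congrFun h5 a
  simp only [hc, Pi.zero_apply] at this
  linarith

theorem vecLaplacian_comp (H : IsHypersurface k Y ν U)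
    (H' : IsHypersurface k' (fun y => Y (T y)) ν' U') (hx : x ∈ U') (hTx : T x ∈ U)
    (hT : ContDiffAt ℝ ∞ T x) {u : 𝔼 d → V} (hu : ContDiffAt ℝ ∞ u (T x)) :
    vecLaplacian (fun y => Y (T y)) (fun y => u (T y)) x = vecLaplacian Y u (T x) := by
  rw [H.vecLaplacian_comp_eq H' hx hTx hT hu, vecLaplacian]
  simp only [H.driftComp_eq H' hx hTx hT]

end IsHypersurface

end LaplacianInvariance

/-! ### Equidistant hypersurfaces in coordinates -/

section Equidistant

variable {n : ℕ} {k : ℝ}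

/-- The velocity `∂X/∂ρ`, explicitly. -/
def equidistantNormal {S : Type*} (k : ℝ) (F N : S → Minkowski n) (p : S) (s : ℝ) : Minkowski n :=
  (k * Real.sinh (k * s)) • F p + Real.cosh (k * s) • N p

theorem hasDerivAt_cosh_mul (k s : ℝ) :
    HasDerivAt (fun t => Real.cosh (k * t)) (k * Real.sinh (k * s)) s := by
  have := (Real.hasDerivAt_cosh (k * s)).comp s ((hasDerivAt_id s).const_mul k)
  refine this.congr_deriv ?_
  simp [mul_comm]

theorem hasDerivAt_sinh_mul (k s : ℝ) :
    HasDerivAt (fun t => Real.sinh (k * t)) (k * Real.cosh (k * s)) s := by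
  have := (Real.hasDerivAt_sinh (k * s)).comp s ((hasDerivAt_id s).const_mul k)
  refine this.congr_deriv ?_
  simp [mul_comm]

theorem hasDerivAt_equidistant {S : Type*} (hk : k ≠ 0) (F N : S → Minkowski n) (p : S) (s : ℝ) :
    HasDerivAt (fun t => equidistant k F N p t) (equidistantNormal k F N p s) s := by
  refine (((hasDerivAt_cosh_mul k s).smul_const (F p)).add
    (((hasDerivAt_sinh_mul k s).const_mul (1 / k)).smul_const (N p))).congr_deriv ?_
  rw [equidistantNormal]
  congr 2
  field_simp

theorem hasDerivAt_equidistantNormal {S : Type*} (hk : k ≠ 0) (F N : S → Minkowski n) (p : S)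
    (s : ℝ) :
    HasDerivAt (fun t => equidistantNormal k F N p t) (k ^ 2 • equidistant k F N p s) s := by
  refine ((((hasDerivAt_sinh_mul k s).const_mul k).smul_const (F p)).add
    ((hasDerivAt_cosh_mul k s).smul_const (N p))).congr_deriv ?_
  rw [equidistant, smul_add, smul_smul, smul_smul]
  congr 2
  · ring
  · field_simp

theorem velocity_eq {S : Type*} (hk : k ≠ 0) (F N : S → Minkowski n) (p : S) (s : ℝ) :
    velocity k F N p s = equidistantNormal k F N p s :=
  (hasDerivAt_equidistant hk F N p s).deriv

variable {d : ℕ}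

local notation "𝔼" d:max => EuclideanSpace ℝ (Fin d)

variable {f ν : 𝔼 d → Minkowski n} {U : Set (𝔼 d)} {x : 𝔼 d}

/-- The derivative ∂_i X is the same hyperbolic combination of ∂_i f and ∂_i ν, so it is again an
`equidistant` family, now over the index set `Fin d`; its ρ-derivatives then need no new
computation. -/
theorem pd_equidistant (hf : DifferentiableAt ℝ f x) (hν : DifferentiableAt ℝ ν x) (s : ℝ)
    (i : Fin d) :
    pd i (fun y => equidistant k f ν y s) x =
      equidistant k (fun j => pd j f x) (fun j => pd j ν x) i s := by
  unfold equidistant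
  rw [pd_add (hf.fun_const_smul _) (hν.fun_const_smul _), pd_const_smul _ hf, pd_const_smul _ hν]

theorem pd_equidistantNormal (hf : DifferentiableAt ℝ f x) (hν : DifferentiableAt ℝ ν x) (s : ℝ)
    (i : Fin d) :
    pd i (fun y => equidistantNormal k f ν y s) x =
      equidistantNormal k (fun j => pd j f x) (fun j => pd j ν x) i s := by
  unfold equidistantNormal
  rw [pd_add (hf.fun_const_smul _) (hν.fun_const_smul _), pd_const_smul _ hf, pd_const_smul _ hν]

/-- The equidistant hypersurfaces on the side of the normal are regular if the second fundamental
form is positive definite. -/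
theorem IsHypersurface.equidistant (H : IsHypersurface k f ν U) (hk : 0 < k)
    (hpos : ∀ x ∈ U, (gram ν f x).PosDef) {s : ℝ} (hs : 0 ≤ s) :
    IsHypersurface k (fun y => equidistant k f ν y s) (fun y => equidistantNormal k f ν y s) U := by
  have hcs := Real.cosh_sq (k * s)
  have hk0 := hk.ne'
  refine ⟨H.isOpen, fun x hx => ?_, fun x hx => ?_, fun x hx => ?_, fun x hx => ?_, fun x hx => ?_,
    fun x hx i => ?_, fun x hx => ?_⟩
  · exact ((H.smooth x hx).const_smul _).add ((H.smooth_normal x hx).const_smul _)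
  · exact ((H.smooth x hx).const_smul _).add ((H.smooth_normal x hx).const_smul _)
  · simp only [QuasiSpherical.equidistant, lorentz_add_left, lorentz_add_right, lorentz_smul_left,
      lorentz_smul_right, H.lorentz_self x hx, H.lorentz_normal x hx, H.lorentz_normal_self x hx,
      lorentz_comm (f x) (ν x)]
    field_simp
    linear_combination (-1 : ℝ) * hcs
  · simp only [equidistantNormal, lorentz_add_left, lorentz_add_right, lorentz_smul_left,
      lorentz_smul_right, H.lorentz_self x hx, H.lorentz_normal x hx, H.lorentz_normal_self x hx,
      lorentz_comm (f x) (ν x)]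
    field_simp
    linear_combination hcs
  · simp only [QuasiSpherical.equidistant, equidistantNormal, lorentz_add_left, lorentz_add_right,
      lorentz_smul_left, lorentz_smul_right, H.lorentz_self x hx, H.lorentz_normal x hx,
      H.lorentz_normal_self x hx, lorentz_comm (f x) (ν x)]
    field_simp
    ring
  · rw [pd_equidistant (H.smooth x hx).diff (H.smooth_normal x hx).diff]
    simp only [QuasiSpherical.equidistant, equidistantNormal, lorentz_add_left, lorentz_add_right,
      lorentz_smul_left, lorentz_smul_right, H.lorentz_normal_pd x hx, lorentz_comm (f x),
      lorentz_comm (ν x) (pd i ν x), H.lorentz_pd_self hx, H.lorentz_pdNormal_normal hx,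
      H.lorentz_pdNormal_self hx]
    ring
  · refine Matrix.PosDef.of_dotProduct_mulVec_pos ?_ fun v hv => ?_
    · ext i j; exact lorentz_comm _ _
    rw [star_trivial, dotProduct_gram_mulVec]
    simp only [pd_equidistant (H.smooth x hx).diff (H.smooth_normal x hx).diff]
    set W := ∑ i, v i • QuasiSpherical.equidistant k (fun j => pd j f x) (fun j => pd j ν x) i s
      with hW
    have hWy : lorentz W (f x) = 0 := by
      simp only [hW, QuasiSpherical.equidistant, lorentz_sum_left, lorentz_smul_left,
        lorentz_add_left, H.lorentz_pd_self hx, H.lorentz_pdNormal_self hx]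
      simp
    have hself : lorentz (f x) (f x) < 0 := by
      rw [H.lorentz_self x hx]
      have : 0 < 1 / k ^ 2 := by positivity
      linarith
    -- `W` is orthogonal to the timelike vector `f x`, so it is enough that W ≠ 0. Its product with
    -- the corresponding tangent vector of `f` is cosh(ks) g(v,v) + sinh(ks) h(v,v)/k, which is
    -- positive since s ≥ 0.
    refine lorentz_self_pos_of_orthogonal hself hWy fun h0 => ?_
    have e1 : lorentz W (∑ i, v i • pd i f x) =
        Real.cosh (k * s) * dotProduct v ((gram f f x).mulVec v) +
        (1 / k * Real.sinh (k * s)) * dotProduct v ((gram ν f x).mulVec v) := by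
      rw [dotProduct_gram_mulVec, dotProduct_gram_mulVec, ← lorentz_smul_left,
        ← lorentz_smul_left, ← lorentz_add_left, Finset.smul_sum, Finset.smul_sum,
        ← Finset.sum_add_distrib, hW]
      congr 1
      refine Finset.sum_congr rfl fun i _ => ?_
      rw [QuasiSpherical.equidistant, smul_add, smul_comm, smul_comm (v i) (1 / k * _)]
    have e2 := (H.posDef x hx).dotProduct_mulVec_pos hv
    have e3 := (hpos x hx).dotProduct_mulVec_pos hv
    rw [star_trivial] at e2 e3
    rw [h0, lorentz_zero_left] at e1
    have e4 := Real.cosh_pos (k * s)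
    have e5 : 0 ≤ Real.sinh (k * s) := Real.sinh_nonneg_iff.2 (by positivity)
    have e6 : 0 < Real.cosh (k * s) * dotProduct v ((gram f f x).mulVec v) := by positivity
    have e7 : 0 ≤ (1 / k * Real.sinh (k * s)) * dotProduct v ((gram ν f x).mulVec v) := by
      positivity
    linarith

end Equidistant

/-! ### Evolution of the geometry along the equidistant foliation -/

section MatrixDeriv

variable {ι : Type*} [Fintype ι] [DecidableEq ι] {A : ℝ → Matrix ι ι ℝ} {A' : Matrix ι ι ℝ} {s : ℝ}

theorem hasDerivAt_det (h : ∀ i j, HasDerivAt (fun t => A t i j) (A' i j) s) :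
    HasDerivAt (fun t => (A t).det) (∑ i, ∑ j, (A s).adjugate j i * A' i j) s := by
  have := (hasFDerivAt_det (A := A) fun i j => (h i j).hasFDerivAt).hasDerivAt
  refine this.congr_deriv ?_
  simp

theorem differentiableAt_inv_apply (h : ∀ i j, DifferentiableAt ℝ (fun t => A t i j) s)
    (hdet : (A s).det ≠ 0) (i j : ι) : DifferentiableAt ℝ (fun t => (A t)⁻¹ i j) s := by
  simp only [Matrix.inv_def, Ring.inverse_eq_inv', Matrix.smul_apply, smul_eq_mul,
    Matrix.adjugate_apply]
  have hd : ∀ B : ℝ → Matrix ι ι ℝ, (∀ i j, DifferentiableAt ℝ (fun t => B t i j) s) →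
      DifferentiableAt ℝ (fun t => (B t).det) s := fun B hB =>
    (hasFDerivAt_det fun i j => (hB i j).hasFDerivAt).differentiableAt
  refine (((hd A h).fun_inv hdet)).fun_mul (hd _ fun a b => ?_)
  by_cases hb : a = j
  · subst hb; simp
  · simpa [Matrix.updateRow_ne hb] using h a b

/-- Cramer's rule gives differentiability, and the value comes from differentiating A A⁻¹ = 1. -/
theorem hasDerivAt_inv_apply (h : ∀ i j, HasDerivAt (fun t => A t i j) (A' i j) s)
    (hdet : (A s).det ≠ 0) (i j : ι) :
    HasDerivAt (fun t => (A t)⁻¹ i j) (-((A s)⁻¹ * A' * (A s)⁻¹) i j) s := by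
  let B' : Matrix ι ι ℝ := Matrix.of fun i j => deriv (fun t => (A t)⁻¹ i j) s
  have hB : ∀ i j, HasDerivAt (fun t => (A t)⁻¹ i j) (B' i j) s := fun i j =>
    (differentiableAt_inv_apply (fun i j => (h i j).differentiableAt) hdet i j).hasDerivAt
  have hev : ∀ᶠ t in 𝓝 s, (A t).det ≠ 0 :=
    (hasDerivAt_det h).continuousAt.eventually_ne hdet
  have key : A s * B' = -(A' * (A s)⁻¹) := by
    ext a b
    have h1 : HasDerivAt (fun t => ∑ m, A t a m * (A t)⁻¹ m b)
        (∑ m, (A' a m * (A s)⁻¹ m b + A s a m * B' m b)) s :=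
      HasDerivAt.fun_sum fun m _ => (h a m).fun_mul (hB m b)
    have h2 : (fun t => ∑ m, A t a m * (A t)⁻¹ m b) =ᶠ[𝓝 s]
        fun _ => (1 : Matrix ι ι ℝ) a b := by
      filter_upwards [hev] with t ht
      rw [← Matrix.mul_apply, Matrix.mul_nonsing_inv _ ht.isUnit]
    have h3 := (h1.congr_of_eventuallyEq h2.symm).unique (hasDerivAt_const s _)
    rw [Finset.sum_add_distrib] at h3
    rw [Matrix.neg_apply, Matrix.mul_apply, Matrix.mul_apply]
    linarith
  have : B' = -((A s)⁻¹ * A' * (A s)⁻¹) := by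
    calc B' = (A s)⁻¹ * (A s * B') := by
          rw [← Matrix.mul_assoc, Matrix.nonsing_inv_mul _ hdet.isUnit, Matrix.one_mul]
      _ = _ := by rw [key, Matrix.mul_neg, Matrix.mul_assoc]
  have h4 := hB i j
  rw [this] at h4
  exact h4

end MatrixDeriv

/-! ### Variation of the metric, area element and mean curvature along the leaves -/

section Riccati

variable {n d : ℕ} {k : ℝ}

local notation "𝔼" d:max => EuclideanSpace ℝ (Fin d)

variable {f ν : 𝔼 d → Minkowski n} {U : Set (𝔼 d)} {x : 𝔼 d}

/-- The Weingarten equation, in the form used for the evolution of the second fundamental form. -/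
theorem IsHypersurface.gram_normal_normal (H : IsHypersurface k f ν U) (hk : k ≠ 0)
    (hd : n = d + 1) (hx : x ∈ U) :
    gram ν ν x = gram ν f x * (gram f f x)⁻¹ * gram ν f x := by
  have h1 : ∀ i, pd i ν x = ∑ l, (gram ν f x * (gram f f x)⁻¹) i l • pd l f x := by
    intro i
    apply H.eq_of_lorentz_eq hk hd hx
    · simp [lorentz_sum_left, lorentz_smul_left, H.lorentz_pd_self hx, H.lorentz_pdNormal_self hx]
    · simp [lorentz_sum_left, lorentz_smul_left, H.lorentz_pd_normal hx,
        H.lorentz_pdNormal_normal hx]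
    · intro m
      simp only [lorentz_sum_left, lorentz_smul_left, ← gram_apply]
      rw [← Matrix.mul_apply, Matrix.mul_assoc, Matrix.nonsing_inv_mul _ (H.isUnit_det hx),
        Matrix.mul_one]
  ext i j
  rw [gram_apply]
  conv_lhs => rw [h1 i]
  simp only [lorentz_sum_left, lorentz_smul_left, lorentz_comm (pd _ f x), ← gram_apply]
  rw [Matrix.mul_apply]
  exact Finset.sum_congr rfl fun l _ => by rw [H.gramNormal_comm hx]

theorem hasDerivAt_gram_equidistant (hf : DifferentiableAt ℝ f x) (hν : DifferentiableAt ℝ ν x)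
    (hk : k ≠ 0) (s : ℝ) (i j : Fin d) :
    HasDerivAt (fun t => gram (fun y => equidistant k f ν y t) (fun y => equidistant k f ν y t) x i j)
      (gram (fun y => equidistantNormal k f ν y s) (fun y => equidistant k f ν y s) x i j +
        gram (fun y => equidistantNormal k f ν y s) (fun y => equidistant k f ν y s) x j i) s := by
  simp only [gram_apply, pd_equidistant hf hν, pd_equidistantNormal hf hν]
  refine ((hasDerivAt_equidistant hk _ _ i s).lorentz
    (hasDerivAt_equidistant hk _ _ j s)).congr_deriv ?_
  rw [lorentz_comm (equidistantNormal _ _ _ j s)]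

/-- Differentiating ν gives k²X, hence k² times the metric; differentiating X gives ν, hence the
third fundamental form. -/
theorem hasDerivAt_gramNormal_equidistant (hf : DifferentiableAt ℝ f x)
    (hν : DifferentiableAt ℝ ν x) (hk : k ≠ 0) (s : ℝ) (i j : Fin d) :
    HasDerivAt
      (fun t => gram (fun y => equidistantNormal k f ν y t) (fun y => equidistant k f ν y t) x i j)
      (k ^ 2 * gram (fun y => equidistant k f ν y s) (fun y => equidistant k f ν y s) x i j +
        gram (fun y => equidistantNormal k f ν y s) (fun y => equidistantNormal k f ν y s) x i j)
      s := by
  simp only [gram_apply, pd_equidistant hf hν, pd_equidistantNormal hf hν]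
  refine ((hasDerivAt_equidistantNormal hk _ _ i s).lorentz
    (hasDerivAt_equidistant hk _ _ j s)).congr_deriv ?_
  rw [lorentz_smul_left]

variable {s : ℝ}

/-- The first variation of the area element. -/
theorem hasDerivAt_sqrt_det_equidistant
    (H : IsHypersurface k (fun y => equidistant k f ν y s) (fun y => equidistantNormal k f ν y s) U)
    (hx : x ∈ U) (hf : DifferentiableAt ℝ f x) (hν : DifferentiableAt ℝ ν x) (hk : k ≠ 0) :
    HasDerivAt
      (fun t => √(gram (fun y => equidistant k f ν y t) (fun y => equidistant k f ν y t) x).det)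
      ((shape (fun y => equidistant k f ν y s) (fun y => equidistantNormal k f ν y s) x).trace *
        √(gram (fun y => equidistant k f ν y s) (fun y => equidistant k f ν y s) x).det) s := by
  have hpos := H.det_pos hx
  set G := gram (fun y => equidistant k f ν y s) (fun y => equidistant k f ν y s) x with hG
  set h := gram (fun y => equidistantNormal k f ν y s) (fun y => equidistant k f ν y s) x with hh
  have h1 : ∀ i j, HasDerivAt (fun t => gram (fun y => equidistant k f ν y t)
      (fun y => equidistant k f ν y t) x i j) ((2 • h) i j) s := by
    intro i j
    refine (hasDerivAt_gram_equidistant hf hν hk s i j).congr_deriv ?_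
    rw [H.gramNormal_comm hx j i, two_smul, Matrix.add_apply]
  refine ((hasDerivAt_det h1).sqrt hpos.ne').congr_deriv ?_
  have hs : √G.det ≠ 0 := (Real.sqrt_pos.2 hpos).ne'
  have hss : √G.det * √G.det = G.det := Real.mul_self_sqrt hpos.le
  have e1 : ∑ i, ∑ j, G.adjugate j i * (2 • h) i j =
      2 * (G.det * (G⁻¹ * h).trace) := by
    have : G.adjugate = G.det • G⁻¹ := by
      rw [Matrix.inv_def, Ring.inverse_eq_inv', smul_smul, mul_inv_cancel₀ hpos.ne', one_smul]
    simp only [this, Matrix.trace, Matrix.diag, Matrix.mul_apply, Finset.mul_sum]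
    rw [Finset.sum_comm]
    refine Finset.sum_congr rfl fun i _ => Finset.sum_congr rfl fun j _ => ?_
    simp only [Matrix.smul_apply, smul_eq_mul, nsmul_eq_mul]
    push_cast
    ring
  rw [← hG, e1, shape, ← hG, ← hh]
  generalize √G.det = q at hs hss
  rw [← hss]
  field_simp

/-- The traced Riccati equation. -/
theorem hasDerivAt_trace_shape_equidistant
    (H : IsHypersurface k (fun y => equidistant k f ν y s) (fun y => equidistantNormal k f ν y s) U)
    (hx : x ∈ U) (hf : DifferentiableAt ℝ f x) (hν : DifferentiableAt ℝ ν x) (hk : k ≠ 0)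
    (hd : n = d + 1) :
    HasDerivAt
      (fun t => (shape (fun y => equidistant k f ν y t)
        (fun y => equidistantNormal k f ν y t) x).trace)
      (d * k ^ 2 - (shape (fun y => equidistant k f ν y s) (fun y => equidistantNormal k f ν y s) x *
        shape (fun y => equidistant k f ν y s) (fun y => equidistantNormal k f ν y s) x).trace) s := by
  have hpos := H.det_pos hx
  have hunit := H.isUnit_det hx
  have hW := H.gram_normal_normal hk hd hx
  have hcomm := H.gramNormal_comm hx
  have hG1 := hasDerivAt_gram_equidistant (k := k) hf hν hk s
  have hH1 := hasDerivAt_gramNormal_equidistant (k := k) hf hν hk s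
  simp only [shape]
  set G := gram (fun y => equidistant k f ν y s) (fun y => equidistant k f ν y s) x with hG
  set h := gram (fun y => equidistantNormal k f ν y s) (fun y => equidistant k f ν y s) x with hh
  have h1 : ∀ i j, HasDerivAt (fun t => gram (fun y => equidistant k f ν y t)
      (fun y => equidistant k f ν y t) x i j) ((h + h) i j) s := by
    intro i j
    refine (hG1 i j).congr_deriv ?_
    rw [hcomm j i, Matrix.add_apply]
  have h2 : ∀ i j, HasDerivAt (fun t => gram (fun y => equidistantNormal k f ν y t)
      (fun y => equidistant k f ν y t) x i j) ((k ^ 2 • G + h * G⁻¹ * h) i j) s := by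
    intro i j
    refine (hH1 i j).congr_deriv ?_
    rw [hW, Matrix.add_apply, Matrix.smul_apply, smul_eq_mul]
  have h3 := hasDerivAt_inv_apply h1 hpos.ne'
  rw [← hG] at h3
  have tr : ∀ P Q : Matrix (Fin d) (Fin d) ℝ, (P * Q).trace = ∑ i, ∑ j, P i j * Q j i :=
    fun P Q => by simp only [Matrix.trace, Matrix.diag, Matrix.mul_apply]
  rw [show (fun t => ((gram (fun y => equidistant k f ν y t) (fun y => equidistant k f ν y t) x)⁻¹ *
    gram (fun y => equidistantNormal k f ν y t) (fun y => equidistant k f ν y t) x).trace) =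
    fun t => ∑ i, ∑ j, (gram (fun y => equidistant k f ν y t)
      (fun y => equidistant k f ν y t) x)⁻¹ i j * gram (fun y => equidistantNormal k f ν y t)
      (fun y => equidistant k f ν y t) x j i from funext fun t => tr _ _]
  refine (HasDerivAt.fun_sum fun i _ => HasDerivAt.fun_sum fun j _ =>
    (h3 i j).fun_mul (h2 j i)).congr_deriv ?_
  rw [← hG, ← hh]
  have e1 : (∑ i, ∑ j, (-(G⁻¹ * (h + h) * G⁻¹) i j * h j i +
      G⁻¹ i j * (k ^ 2 • G + h * G⁻¹ * h) j i)) =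
      (-(G⁻¹ * (h + h) * G⁻¹) * h + G⁻¹ * (k ^ 2 • G + h * G⁻¹ * h)).trace := by
    rw [Matrix.trace_add, tr, tr]
    simp only [Finset.sum_add_distrib, Matrix.neg_apply]
  rw [e1]
  -- With G' = 2h and, by Weingarten, h' = k²G + hG⁻¹h, this is the Riccati equation S' = k² - S²
  -- for the shape operator S = G⁻¹h.
  have e2 : -(G⁻¹ * (h + h) * G⁻¹) * h + G⁻¹ * (k ^ 2 • G + h * G⁻¹ * h) =
      k ^ 2 • (1 : Matrix (Fin d) (Fin d) ℝ) - G⁻¹ * h * (G⁻¹ * h) := by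
    simp only [Matrix.mul_add, Matrix.add_mul, Matrix.neg_mul, Matrix.mul_smul,
      Matrix.nonsing_inv_mul _ hunit, Matrix.mul_assoc]
    abel
  rw [e2, Matrix.trace_sub, Matrix.trace_smul, Matrix.trace_one, Fintype.card_fin, smul_eq_mul,
    mul_comm]

end Riccati

/-! ### Mean curvature of the slices of a warped metric -/

section Slice

variable {ι : Type*} [Fintype ι] [DecidableEq ι]

theorem inv_warpedMetric_inr {E : Type*} (G : ℝ → E → Matrix ι ι ℝ) (w : E → ℝ → ℝ) (z : E × ℝ)
    (hG : (G z.2 z.1).det ≠ 0) (hw : w z.1 z.2 ≠ 0) (m : ι ⊕ Unit) :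
    (warpedMetric G w z)⁻¹ (Sum.inr ()) m = Sum.elim (fun _ => 0) (fun _ => (w z.1 z.2 ^ 2)⁻¹) m := by
  have hD : IsUnit (Matrix.of fun _ _ : Unit => w z.1 z.2 ^ 2) := by
    rw [Matrix.isUnit_iff_isUnit_det, Matrix.det_unique]
    exact (pow_ne_zero 2 hw).isUnit
  have hA : IsUnit (G z.2 z.1) := (Matrix.isUnit_iff_isUnit_det _).2 hG.isUnit
  rw [warpedMetric, Matrix.inv_fromBlocks_zero₂₁_of_isUnit_iff _ _ _ (iff_of_true hA hD)]
  rcases m with a | ⟨⟩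
  · simp
  · simp [Matrix.inv_def, Ring.inverse_eq_inv']

variable {E : Type*} [NormedAddCommGroup E] [NormedSpace ℝ E]

/-- The metric is block diagonal, so Γ^ρ_ab = -∂_ρ G_ab / (2w²). No derivative of `w` enters, which
matters at ρ = 0: there `u` is controlled only from the right, while the Christoffel symbols use
two-sided derivatives. -/
theorem coordSliceMeanCurvature_eq (e : ι → E) (G : ℝ → E → Matrix ι ι ℝ) (w : E → ℝ → ℝ) (x : E)
    (s : ℝ) (G' : Matrix ι ι ℝ)
    (hdiff : ∀ a b, DifferentiableAt ℝ (fun z : E × ℝ => G z.2 z.1 a b) (x, s))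
    (hG' : ∀ a b, HasDerivAt (fun t => G t x a b) (G' a b) s)
    (hG : (G s x).det ≠ 0) (hw : w x s ≠ 0) :
    coordSliceMeanCurvature e G w x s =
      (w x s)⁻¹ * ∑ a, ∑ b, (G s x)⁻¹ a b * (1 / 2 * G' a b) := by
  have h1 : ∀ a b, pderiv (prodFrame e) (Sum.inr ())
      (fun z => warpedMetric G w z (Sum.inl a) (Sum.inl b)) (x, s) = G' a b := by
    intro a b
    have hc : HasDerivAt (fun t : ℝ => ((x, t) : E × ℝ)) ((0 : E), (1 : ℝ)) s :=
      (hasDerivAt_const s x).prodMk (hasDerivAt_id s)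
    have := (hdiff a b).hasFDerivAt.comp_hasDerivAt s hc
    exact this.unique (hG' a b)
  have h2 : ∀ (i : ι ⊕ Unit) (a : ι), pderiv (prodFrame e) i
      (fun z => warpedMetric G w z (Sum.inl a) (Sum.inr ())) (x, s) = 0 := by
    intro i a
    have : (fun z => warpedMetric G w z (Sum.inl a) (Sum.inr ())) = fun _ => 0 := by
      ext z; simp [warpedMetric]
    rw [this, pderiv]; simp
  have h3 : ∀ a b, christoffel (prodFrame e) (warpedMetric G w) (Sum.inr ()) (Sum.inl a)
      (Sum.inl b) (x, s) = -(1 / 2 * ((w x s ^ 2)⁻¹ * G' a b)) := by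
    intro a b
    simp only [christoffel, inv_warpedMetric_inr G w (x, s) hG hw, Fintype.sum_sum_type,
      Sum.elim_inl, Sum.elim_inr, zero_mul, Finset.sum_const_zero, zero_add, h2,
      Finset.univ_unique, Finset.sum_singleton]
    rw [show (default : Unit) = () from rfl, h1]
    ring
  simp only [coordSliceMeanCurvature, h3, Finset.mul_sum]
  refine Finset.sum_congr rfl fun a _ => Finset.sum_congr rfl fun b _ => ?_
  field_simp

end Slice

/-! ### Coordinate quantities depend only on the germ of the metric -/

section Germs

variable {ι : Type*} {E : Type*} [NormedAddCommGroup E] [NormedSpace ℝ E] {x : E} {e : ι → E}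

theorem pderiv_congr {f g : E → ℝ} (h : f =ᶠ[𝓝 x] g) (i : ι) : pderiv e i f x = pderiv e i g x := by
  rw [pderiv, pderiv, h.fderiv_eq]

variable [Fintype ι] [DecidableEq ι] {G G' : E → Matrix ι ι ℝ}

theorem christoffel_congr (h : G =ᶠ[𝓝 x] G') (l i j : ι) :
    christoffel e G l i j =ᶠ[𝓝 x] christoffel e G' l i j := by
  filter_upwards [h.eventuallyEq_nhds] with y hy
  have : ∀ a b, (fun z => G z a b) =ᶠ[𝓝 y] fun z => G' z a b := fun a b => by
    filter_upwards [hy] with z hz using by rw [hz]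
  simp only [christoffel, hy.eq_of_nhds, pderiv_congr (this _ _)]

theorem riemann_congr (h : G =ᶠ[𝓝 x] G') (l r i j : ι) :
    riemann e G l r i j x = riemann e G' l r i j x := by
  simp only [riemann, pderiv_congr (christoffel_congr h _ _ _),
    (christoffel_congr h _ _ _).eq_of_nhds]

theorem coordScalarCurvature_congr (h : G =ᶠ[𝓝 x] G') :
    coordScalarCurvature e G x = coordScalarCurvature e G' x := by
  simp only [coordScalarCurvature, ricci, riemann_congr h, h.eq_of_nhds]

theorem coordSectionalCurvature_congr (h : G =ᶠ[𝓝 x] G') (v w : ι → ℝ) :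
    coordSectionalCurvature e G x v w = coordSectionalCurvature e G' x v w := by
  simp only [coordSectionalCurvature, riemann_congr h, h.eq_of_nhds]

theorem coordLaplacian_congr (h : G =ᶠ[𝓝 x] G') {f g : E → ℝ} (hf : f =ᶠ[𝓝 x] g) :
    coordLaplacian e G f x = coordLaplacian e G' g x := by
  have : ∀ i j, (fun y => √(G y).det * (G y)⁻¹ i j * pderiv e j f y) =ᶠ[𝓝 x]
      fun y => √(G' y).det * (G' y)⁻¹ i j * pderiv e j g y := fun i j => by
    filter_upwards [h, hf.eventuallyEq_nhds] with z hz hz'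
    rw [hz, pderiv_congr hz']
  simp only [coordLaplacian, pderiv_congr (this _ _), h.eq_of_nhds]

end Germs

/-! ### Hypersurfaces parametrized by a manifold -/

section Charts

variable {d n : ℕ} {S : Type*} [TopologicalSpace S] [ChartedSpace (EuclideanSpace ℝ (Fin d)) S]

local notation "𝔼" d:max => EuclideanSpace ℝ (Fin d)

/-- A function read in the chart at `q`. -/
def inChart {V : Type*} (q : S) (f : S → V) (x : 𝔼 d) : V := f ((chartAt (𝔼 d) q).symm x)

theorem inChart_apply {V : Type*} (q : S) (f : S → V) (x : 𝔼 d) :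
    inChart q f x = f ((chartAt (𝔼 d) q).symm x) := rfl

theorem inChart_chart {V : Type*} {q p : S} (f : S → V) (hp : p ∈ (chartAt (𝔼 d) q).source) :
    inChart q f (chartAt (𝔼 d) q p) = f p := by
  rw [inChart, (chartAt (𝔼 d) q).left_inv hp]

theorem coords_mem (p : S) : coords p ∈ (chartAt (𝔼 d) p).target := mem_chart_target _ p

/-- The transition map from the chart at `q` to the chart at `p`. -/
def transition (q p : S) (x : 𝔼 d) : 𝔼 d := chartAt (𝔼 d) p ((chartAt (𝔼 d) q).symm x)

theorem inChart_transition {W : Type*} {q p : S} {x : 𝔼 d} (hx : x ∈ (chartAt (𝔼 d) q).target)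
    (hp : (chartAt (𝔼 d) q).symm x ∈ (chartAt (𝔼 d) p).source) (f : S → W) :
    inChart q f =ᶠ[𝓝 x] fun y => inChart p f (transition q p y) := by
  have h1 : ∀ᶠ y in 𝓝 x, (chartAt (𝔼 d) q).symm y ∈ (chartAt (𝔼 d) p).source :=
    ((chartAt (𝔼 d) q).continuousAt_symm hx).eventually ((chartAt (𝔼 d) p).open_source.mem_nhds hp)
  filter_upwards [h1] with y hy
  rw [inChart, inChart, transition, (chartAt (𝔼 d) p).left_inv hy]

variable [IsManifold (𝓡 d) ∞ S]

variable {V : Type*} [NormedAddCommGroup V] [NormedSpace ℝ V]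

theorem contDiffAt_inChart {f : S → V} (hf : ContMDiff (𝓡 d) 𝓘(ℝ, V) ∞ f) {q : S} {x : 𝔼 d}
    (hx : x ∈ (chartAt (𝔼 d) q).target) : ContDiffAt ℝ ∞ (inChart q f) x := by
  have h1 := (contMDiffOn_chart_symm (I := 𝓡 d) (n := ∞) (x := q)).contMDiffAt
    ((chartAt (𝔼 d) q).open_target.mem_nhds hx)
  exact contMDiffAt_iff_contDiffAt.1 (hf.contMDiffAt.comp x h1)

theorem mfderiv_comp_chart_symm {f : S → V} (hf : ContMDiff (𝓡 d) 𝓘(ℝ, V) ∞ f) {q : S} {x : 𝔼 d}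
    (hx : x ∈ (chartAt (𝔼 d) q).target) (v : 𝔼 d) :
    (mfderiv (𝓡 d) 𝓘(ℝ, V) f ((chartAt (𝔼 d) q).symm x)
      (mfderiv (𝓡 d) (𝓡 d) (chartAt (𝔼 d) q).symm x v) : V) = fderiv ℝ (inChart q f) x v := by
  have h1 := (contMDiffOn_chart_symm (I := 𝓡 d) (n := ∞) (x := q)).contMDiffAt
    ((chartAt (𝔼 d) q).open_target.mem_nhds hx)
  have h2 := mfderiv_comp x (hf.contMDiffAt.mdifferentiableAt (by simp))
    (h1.mdifferentiableAt (by simp))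
  have h3 : mfderiv (𝓡 d) 𝓘(ℝ, V) (f ∘ (chartAt (𝔼 d) q).symm) x = fderiv ℝ (inChart q f) x :=
    mfderiv_eq_fderiv
  rw [← h3, h2]
  rfl

theorem chartMatrix_inducedMetric {f : S → Minkowski n}
    (hf : ContMDiff (𝓡 d) 𝓘(ℝ, Minkowski n) ∞ f) {q : S} {x : 𝔼 d}
    (hx : x ∈ (chartAt (𝔼 d) q).target) :
    chartMatrix (inducedMetric f) q x = gram (inChart q f) (inChart q f) x := by
  ext i j
  simp only [chartMatrix, inducedMetric, Matrix.of_apply, gram_apply, pd]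
  erw [mfderiv_comp_chart_symm hf hx, mfderiv_comp_chart_symm hf hx]

theorem chartMatrix_secondFundamentalForm {f ν : S → Minkowski n}
    (hf : ContMDiff (𝓡 d) 𝓘(ℝ, Minkowski n) ∞ f) (hν : ContMDiff (𝓡 d) 𝓘(ℝ, Minkowski n) ∞ ν)
    {q : S} {x : 𝔼 d} (hx : x ∈ (chartAt (𝔼 d) q).target) :
    chartMatrix (secondFundamentalForm f ν) q x = gram (inChart q ν) (inChart q f) x := by
  ext i j
  simp only [chartMatrix, secondFundamentalForm, Matrix.of_apply, gram_apply, pd]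
  erw [mfderiv_comp_chart_symm hν hx, mfderiv_comp_chart_symm hf hx]

theorem contDiffAt_transition {q p : S} {x : 𝔼 d} (hx : x ∈ (chartAt (𝔼 d) q).target)
    (hp : (chartAt (𝔼 d) q).symm x ∈ (chartAt (𝔼 d) p).source) :
    ContDiffAt ℝ ∞ (transition q p) x := by
  have h1 := (contMDiffOn_chart_symm (I := 𝓡 d) (n := ∞) (x := q)).contMDiffAt
    ((chartAt (𝔼 d) q).open_target.mem_nhds hx)
  have h2 := (contMDiffOn_chart (I := 𝓡 d) (n := ∞) (x := p)).contMDiffAt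
    ((chartAt (𝔼 d) p).open_source.mem_nhds hp)
  exact contMDiffAt_iff_contDiffAt.1 (h2.comp x h1)

end Charts

/-! ### Chart independence and continuity of the geometric quantities -/

section Immersed

variable {d n : ℕ} {S : Type*} [TopologicalSpace S] [ChartedSpace (EuclideanSpace ℝ (Fin d)) S]

local notation "𝔼" d:max => EuclideanSpace ℝ (Fin d)

/-- `f` is a smooth immersion of the manifold `S` as a spacelike hypersurface of `ℍⁿ_{-k²}` with
unit normal `ν`. -/
structure IsImmersed (d : ℕ) {S : Type*} [TopologicalSpace S]
    [ChartedSpace (EuclideanSpace ℝ (Fin d)) S] (k : ℝ) (f ν : S → Minkowski n) : Prop where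
  smooth : ContMDiff (𝓡 d) 𝓘(ℝ, Minkowski n) ∞ f
  smooth_normal : ContMDiff (𝓡 d) 𝓘(ℝ, Minkowski n) ∞ ν
  hypersurface : ∀ q : S, IsHypersurface k (inChart q f) (inChart q ν) (chartAt (𝔼 d) q).target

/-- The squared norm of the second fundamental form. -/
def sqNormSecondFundamentalForm (d : ℕ) {S : Type*} [TopologicalSpace S]
    [ChartedSpace (EuclideanSpace ℝ (Fin d)) S] (f ν : S → Minkowski n) (p : S) : ℝ :=
  (shape (d := d) (inChart p f) (inChart p ν) (coords p) *
    shape (inChart p f) (inChart p ν) (coords p)).trace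

theorem IsHypersurface.congr {k : ℝ} {Y Y' ν ν' : 𝔼 d → Minkowski n} {U : Set (𝔼 d)}
    (H : IsHypersurface k Y ν U) {V : Set (𝔼 d)} (hV : IsOpen V) (hVU : V ⊆ U)
    (hY : ∀ x ∈ V, Y' x = Y x) (hν : ∀ x ∈ V, ν' x = ν x) : IsHypersurface k Y' ν' V := by
  have hY' : ∀ x ∈ V, Y' =ᶠ[𝓝 x] Y := fun x hx => by
    filter_upwards [hV.mem_nhds hx] with y hy using hY y hy
  have hν' : ∀ x ∈ V, ν' =ᶠ[𝓝 x] ν := fun x hx => by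
    filter_upwards [hV.mem_nhds hx] with y hy using hν y hy
  refine ⟨hV, fun x hx => (H.smooth x (hVU hx)).congr_of_eventuallyEq (hY' x hx),
    fun x hx => (H.smooth_normal x (hVU hx)).congr_of_eventuallyEq (hν' x hx),
    fun x hx => ?_, fun x hx => ?_, fun x hx => ?_, fun x hx i => ?_, fun x hx => ?_⟩
  · rw [hY x hx]; exact H.lorentz_self x (hVU hx)
  · rw [hν x hx]; exact H.lorentz_normal x (hVU hx)
  · rw [hν x hx, hY x hx]; exact H.lorentz_normal_self x (hVU hx)
  · rw [hν x hx, pd_congr (hY' x hx)]; exact H.lorentz_normal_pd x (hVU hx) i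
  · have : gram Y' Y' x = gram Y Y x := by
      ext i j; simp only [gram_apply, pd_congr (hY' x hx)]
    rw [this]; exact H.posDef x (hVU hx)

theorem gram_congr {Y Y' Z Z' : 𝔼 d → Minkowski n} {x : 𝔼 d} (hY : Y' =ᶠ[𝓝 x] Y)
    (hZ : Z' =ᶠ[𝓝 x] Z) : gram Y' Z' x = gram Y Z x := by
  ext i j; simp only [gram_apply, pd_congr hY, pd_congr hZ]

theorem gram_congr_eventually {Y Y' Z Z' : 𝔼 d → Minkowski n} {x : 𝔼 d} (hY : Y' =ᶠ[𝓝 x] Y)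
    (hZ : Z' =ᶠ[𝓝 x] Z) : gram Y' Z' =ᶠ[𝓝 x] gram Y Z := by
  filter_upwards [hY.eventuallyEq_nhds, hZ.eventuallyEq_nhds] with y h1 h2 using gram_congr h1 h2

/-- A function on a manifold is continuous if it is continuous in the preferred charts. -/
theorem continuous_of_inChart {X : Type*} [TopologicalSpace X] {f : S → X}
    (h : ∀ q : S, ContinuousOn (inChart (d := d) q f) (chartAt (𝔼 d) q).target) : Continuous f := by
  refine continuous_iff_continuousAt.2 fun p => ?_
  have h1 : ContinuousAt (inChart (d := d) p f) (chartAt (𝔼 d) p p) :=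
    (h p).continuousAt ((chartAt (𝔼 d) p).open_target.mem_nhds (mem_chart_target _ p))
  have h2 : ContinuousAt (inChart (d := d) p f ∘ chartAt (𝔼 d) p) p :=
    ContinuousAt.comp h1 ((chartAt (𝔼 d) p).continuousAt (mem_chart_source _ p))
  refine h2.congr ?_
  filter_upwards [(chartAt (𝔼 d) p).open_source.mem_nhds (mem_chart_source _ p)] with y hy
  exact inChart_chart f hy

theorem continuousOn_inChart {X : Type*} [TopologicalSpace X] {f : S → X} (hf : Continuous f)
    (q : S) : ContinuousOn (inChart (d := d) q f) (chartAt (𝔼 d) q).target :=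
  hf.comp_continuousOn (chartAt (𝔼 d) q).continuousOn_symm

namespace IsImmersed

variable [IsManifold (𝓡 d) ∞ S] {k : ℝ} {f ν : S → Minkowski n}

theorem chartMatrix_eventuallyEq (H : IsImmersed d k f ν) (q : S) {x : 𝔼 d}
    (hx : x ∈ (chartAt (𝔼 d) q).target) :
    chartMatrix (inducedMetric (d := d) f) q =ᶠ[𝓝 x]
      gram (inChart q f) (inChart q f) := by
  filter_upwards [(chartAt (𝔼 d) q).open_target.mem_nhds hx] with y hy
    using chartMatrix_inducedMetric H.smooth hy

theorem gram_transition (H : IsImmersed d k f ν) {q p : S} {x : 𝔼 d}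
    (hx : x ∈ (chartAt (𝔼 d) q).target)
    (hp : (chartAt (𝔼 d) q).symm x ∈ (chartAt (𝔼 d) p).source) :
    gram (inChart q f) (inChart q f) x =
      jacobi (transition q p) x *
        gram (inChart p f) (inChart p f) (transition q p x) *
        (jacobi (transition q p) x).transpose := by
  have hT := contDiffAt_transition hx hp
  have hTx : transition q p x ∈ (chartAt (𝔼 d) p).target := (chartAt (𝔼 d) p).map_source hp
  rw [gram_congr (inChart_transition hx hp f) (inChart_transition hx hp f)]
  exact gram_comp (((H.hypersurface p).smooth _ hTx).diff) (((H.hypersurface p).smooth _ hTx).diff) hT.diff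

theorem gramNormal_transition (H : IsImmersed d k f ν) {q p : S} {x : 𝔼 d}
    (hx : x ∈ (chartAt (𝔼 d) q).target)
    (hp : (chartAt (𝔼 d) q).symm x ∈ (chartAt (𝔼 d) p).source) :
    gram (inChart q ν) (inChart q f) x =
      jacobi (transition q p) x *
        gram (inChart p ν) (inChart p f) (transition q p x) *
        (jacobi (transition q p) x).transpose := by
  have hT := contDiffAt_transition hx hp
  have hTx : transition q p x ∈ (chartAt (𝔼 d) p).target := (chartAt (𝔼 d) p).map_source hp
  rw [gram_congr (inChart_transition hx hp ν) (inChart_transition hx hp f)]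
  exact gram_comp (((H.hypersurface p).smooth_normal _ hTx).diff) (((H.hypersurface p).smooth _ hTx).diff)
    hT.diff

theorem meanCurvature_eq (H : IsImmersed d k f ν) (p : S) :
    meanCurvature (d := d) f ν p =
      (shape (inChart p f) (inChart p ν) (coords (d := d) p)).trace := by
  rw [meanCurvature, traceWith, chartMatrix_inducedMetric H.smooth (coords_mem p),
    chartMatrix_secondFundamentalForm H.smooth H.smooth_normal (coords_mem p), shape]

/-- The definition uses at each point its own preferred chart; invariance under congruence allows a
single chart for all nearby points. Continuity follows only from this form. -/
theorem meanCurvature_inChart (H : IsImmersed d k f ν) (q : S) {x : 𝔼 d}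
    (hx : x ∈ (chartAt (𝔼 d) q).target) :
    inChart q (meanCurvature (d := d) f ν) x =
      (shape (inChart q f) (inChart q ν) x).trace := by
  have hp := mem_chart_source (𝔼 d) ((chartAt (𝔼 d) q).symm x)
  rw [inChart_apply, H.meanCurvature_eq]
  exact trace_of_congruence (H.gram_transition hx hp) (H.gramNormal_transition hx hp)
    ((H.hypersurface q).det_pos hx).ne'

theorem sqNorm_inChart (H : IsImmersed d k f ν) (q : S) {x : 𝔼 d}
    (hx : x ∈ (chartAt (𝔼 d) q).target) :
    inChart q (sqNormSecondFundamentalForm d f ν) x =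
      (shape (inChart q f) (inChart q ν) x *
        shape (inChart q f) (inChart q ν) x).trace := by
  have hp := mem_chart_source (𝔼 d) ((chartAt (𝔼 d) q).symm x)
  rw [inChart_apply, sqNormSecondFundamentalForm]
  exact trace_sq_of_congruence (H.gram_transition hx hp) (H.gramNormal_transition hx hp)
    ((H.hypersurface q).det_pos hx).ne'

/-- The Gauss equation; since the terms on the right are chart independent, it also settles the
regularity of the scalar curvature without transforming the curvature tensor. -/
theorem scalarCurvature_eq (H : IsImmersed d k f ν) (hk : k ≠ 0) (hd : n = d + 1) (p : S) :
    scalarCurvature (inducedMetric (d := d) f) p = -(d * (d - 1) * k ^ 2) +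
      meanCurvature (d := d) f ν p ^ 2 - sqNormSecondFundamentalForm d f ν p := by
  rw [scalarCurvature, coordScalarCurvature_congr (H.chartMatrix_eventuallyEq p (coords_mem p)),
    (H.hypersurface p).coordScalarCurvature_eq hk hd (coords_mem p), H.meanCurvature_eq,
    sqNormSecondFundamentalForm]

/-- Transfers the Laplacian from the preferred chart at the point to an arbitrary chart, as needed
for continuity and for integration by parts in one chart. -/
theorem laplacian_inChart (H : IsImmersed d k f ν) {u : S → ℝ} (hu : ContMDiff (𝓡 d) 𝓘(ℝ, ℝ) ∞ u)
    (q : S) {x : 𝔼 d} (hx : x ∈ (chartAt (𝔼 d) q).target) :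
    inChart q (laplacian (inducedMetric (d := d) f) u) x =
      coordLaplacian (stdFrame d) (gram (inChart q f) (inChart q f))
        (inChart q u) x := by
  set p := (chartAt (𝔼 d) q).symm x with hpdef
  have hp := mem_chart_source (𝔼 d) p
  have hT := contDiffAt_transition (S := S) hx hp
  have hTx : transition q p x ∈ (chartAt (𝔼 d) p).target := (chartAt (𝔼 d) p).map_source hp
  have e1 : laplacian (inducedMetric (d := d) f) u p =
      coordLaplacian (stdFrame d) (gram (inChart p f) (inChart p f))
        (inChart p u) (transition q p x) :=
    coordLaplacian_congr (H.chartMatrix_eventuallyEq p (coords_mem p)) EventuallyEq.rfl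
  rw [inChart_apply, e1, (H.hypersurface p).coordLaplacian_eq hTx (contDiffAt_inChart hu hTx)]
  have hVopen : IsOpen ((chartAt (𝔼 d) q).target ∩
      (chartAt (𝔼 d) q).symm ⁻¹' (chartAt (𝔼 d) p).source) :=
    (chartAt (𝔼 d) q).isOpen_inter_preimage_symm (chartAt (𝔼 d) p).open_source
  have hcongr : ∀ (g : S → Minkowski n), ∀ y ∈ (chartAt (𝔼 d) q).target ∩
      (chartAt (𝔼 d) q).symm ⁻¹' (chartAt (𝔼 d) p).source,
      inChart p g (transition q p y) = inChart q g y := by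
    intro g y hy
    rw [inChart, inChart, transition,
      (chartAt (𝔼 d) p).left_inv hy.2]
  -- On the overlap the parametrization in the chart at `q` is the one in the chart at `p` composed
  -- with the transition map; in this form the change of coordinates lemma applies.
  have H' := (H.hypersurface q).congr hVopen Set.inter_subset_left (hcongr f) (hcongr ν)
  have hxV : x ∈ (chartAt (𝔼 d) q).target ∩
      (chartAt (𝔼 d) q).symm ⁻¹' (chartAt (𝔼 d) p).source := ⟨hx, hp⟩
  have e2 := (H.hypersurface p).vecLaplacian_comp H' hxV hTx hT (contDiffAt_inChart hu hTx)
  rw [← e2, ← H'.coordLaplacian_eq (u := fun y => inChart p u (transition q p y)) hxV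
    ((contDiffAt_inChart hu hTx).comp x hT)]
  refine coordLaplacian_congr (gram_congr_eventually ?_ ?_) ?_
  · exact (inChart_transition hx hp f).symm
  · exact (inChart_transition hx hp f).symm
  · exact (inChart_transition hx hp u).symm

theorem laplacian_clm (H : IsImmersed d k f ν) (hk : k ≠ 0) (hd : n = d + 1)
    (L : Minkowski n →L[ℝ] ℝ) (p : S) :
    laplacian (inducedMetric (d := d) f) (fun q => L (f q)) p =
      L ((d * k ^ 2) • f p - meanCurvature (d := d) f ν p • ν p) := by
  have hp := coords_mem (d := d) p
  have hu : ContMDiff (𝓡 d) 𝓘(ℝ, ℝ) ∞ (fun q => L (f q)) := L.contMDiff.comp H.smooth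
  have hfp : ∀ {W : Type _} (g : S → W), inChart p g (coords (d := d) p) = g p := fun g =>
    inChart_chart g (mem_chart_source _ p)
  have e1 := H.laplacian_inChart hu p hp
  rw [hfp] at e1
  rw [e1, (H.hypersurface p).coordLaplacian_eq hp (contDiffAt_inChart hu hp)]
  have e2 := vecLaplacian_clm (inChart p f) L (contDiffAt_inChart H.smooth hp)
  rw [show inChart p (fun q => L (f q)) =
    fun y => L (inChart p f y) from rfl, e2,
    (H.hypersurface p).vecLaplacian_self hk hd hp, H.meanCurvature_eq]
  erw [hfp, hfp]

theorem continuous_meanCurvature (H : IsImmersed d k f ν) :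
    Continuous (meanCurvature (d := d) f ν) := by
  refine continuous_of_inChart (d := d) fun q => ?_
  refine ContinuousOn.congr (f := fun x => (shape (inChart q f) (inChart q ν) x).trace)
    (fun x hx => ContinuousAt.continuousWithinAt ?_) fun x hx => H.meanCurvature_inChart q hx
  simp only [shape, Matrix.trace, Matrix.diag, Matrix.mul_apply]
  exact (ContDiffAt.sum fun i _ => ContDiffAt.sum fun j _ =>
    ((H.hypersurface q).contDiffAt_inv hx i j).mul
      ((H.hypersurface q).contDiffAt_gramNormal hx j i)).continuousAt

theorem continuous_sqNorm (H : IsImmersed d k f ν) :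
    Continuous (sqNormSecondFundamentalForm d f ν) := by
  refine continuous_of_inChart (d := d) fun q => ?_
  refine ContinuousOn.congr (f := fun x => (shape (inChart q f) (inChart q ν) x *
    shape (inChart q f) (inChart q ν) x).trace)
    (fun x hx => ContinuousAt.continuousWithinAt ?_) fun x hx => H.sqNorm_inChart q hx
  simp only [shape, Matrix.trace, Matrix.diag, Matrix.mul_apply]
  have h : ∀ i j, ContDiffAt ℝ ∞ (fun y => ∑ m, (gram (inChart q f) (inChart q f) y)⁻¹ i m *
      gram (inChart q ν) (inChart q f) y m j) x := fun i j => ContDiffAt.sum fun m _ =>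
    ((H.hypersurface q).contDiffAt_inv hx i m).mul
      ((H.hypersurface q).contDiffAt_gramNormal hx m j)
  exact (ContDiffAt.sum fun i _ => ContDiffAt.sum fun j _ => (h i j).mul (h j i)).continuousAt

theorem continuous_laplacian (H : IsImmersed d k f ν) {u : S → ℝ}
    (hu : ContMDiff (𝓡 d) 𝓘(ℝ, ℝ) ∞ u) :
    Continuous (laplacian (inducedMetric (d := d) f) u) := by
  refine continuous_of_inChart (d := d) fun q => ?_
  refine ContinuousOn.congr (fun x hx => ContinuousAt.continuousWithinAt ?_)
    fun x hx => H.laplacian_inChart hu q hx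
  exact ((H.hypersurface q).contDiffAt_coordLaplacian hx (contDiffAt_inChart hu hx)).continuousAt

/-- Allows a function to be split by the partition of unity in Green's identity. -/
theorem laplacian_sum (H : IsImmersed d k f ν) {ι : Type*} (s : Finset ι) {u : ι → S → ℝ}
    (hu : ∀ i ∈ s, ContMDiff (𝓡 d) 𝓘(ℝ, ℝ) ∞ (u i)) (p : S) :
    laplacian (inducedMetric (d := d) f) (fun q => ∑ i ∈ s, u i q) p =
      ∑ i ∈ s, laplacian (inducedMetric (d := d) f) (u i) p := by
  have hp := coords_mem (d := d) p
  have hfp : ∀ (g : S → ℝ), inChart p g (coords (d := d) p) = g p := fun g =>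
    inChart_chart g (mem_chart_source _ p)
  have e : ∀ v : S → ℝ, ContMDiff (𝓡 d) 𝓘(ℝ, ℝ) ∞ v →
      laplacian (inducedMetric (d := d) f) v p =
        vecLaplacian (inChart p f) (inChart p v) (coords p) := fun v hv => by
    rw [← hfp (laplacian _ v), H.laplacian_inChart hv p hp,
      (H.hypersurface p).coordLaplacian_eq hp (contDiffAt_inChart hv hp)]
  have hs : ContMDiff (𝓡 d) 𝓘(ℝ, ℝ) ∞ (fun q => ∑ i ∈ s, u i q) :=
    contMDiff_finsetSum fun i hi => hu i hi
  have hd : ∀ y ∈ (chartAt (𝔼 d) p).target, ∀ i ∈ s, DifferentiableAt ℝ (inChart p (u i)) y :=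
    fun y hy i hi => (contDiffAt_inChart (hu i hi) hy).diff
  rw [e _ hs, Finset.sum_congr rfl fun i hi => e _ (hu i hi)]
  have h1 : ∀ j, pd j (inChart p (fun q => ∑ i ∈ s, u i q)) =ᶠ[𝓝 (coords (d := d) p)]
      fun y => ∑ i ∈ s, pd j (inChart p (u i)) y := by
    intro j
    filter_upwards [(chartAt (𝔼 d) p).open_target.mem_nhds hp] with y hy
    exact pd_sum (hd y hy) j
  simp only [vecLaplacian, (h1 _).eq_of_nhds, pd_congr (h1 _),
    pd_sum fun i hi => ((contDiffAt_inChart (hu i hi) hp).pd _).diff, Finset.smul_sum,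
    Finset.sum_add_distrib]
  congr 1
  · rw [Finset.sum_congr rfl fun i _ => Finset.sum_comm]
    exact Finset.sum_comm
  · rw [Finset.sum_comm]

end IsImmersed

end Immersed

/-! ### Linear algebra of definite forms -/

section Definite

variable {ι : Type*} [Fintype ι]

theorem dotProduct_mulVec_comm {A : Matrix ι ι ℝ} (hA : A.transpose = A) (v w : ι → ℝ) :
    dotProduct v (A.mulVec w) = dotProduct w (A.mulVec v) := by
  rw [Matrix.dotProduct_mulVec, ← Matrix.mulVec_transpose, hA, dotProduct_comm]

/-- The strict Cauchy-Schwarz inequality. -/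
theorem gramDet_pos_of_posDef {A : Matrix ι ι ℝ} (hA : A.PosDef) {v w : ι → ℝ}
    (h : LinearIndependent ℝ ![v, w]) :
    0 < dotProduct v (A.mulVec v) * dotProduct w (A.mulVec w) - dotProduct v (A.mulVec w) ^ 2 := by
  have hT : A.transpose = A := by
    simpa [Matrix.IsSymm] using hA.isHermitian
  have hv : v ≠ 0 := by simpa using h.ne_zero 0
  have ha := hA.dotProduct_mulVec_pos hv
  rw [star_trivial] at ha
  have hc := dotProduct_mulVec_comm hT v w
  set a := dotProduct v (A.mulVec v) with ha'
  set t := dotProduct v (A.mulVec w) with ht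
  -- This vector is `a` times the component of `w` orthogonal to `v`, and the form takes on it the
  -- value `a` times the Gram determinant.
  have hz : a • w - t • v ≠ 0 := by
    intro hz
    have := (LinearIndependent.pair_iff.1 h) (-t) a (by rw [← hz]; module)
    exact ha.ne' this.2
  have h2 := hA.dotProduct_mulVec_pos hz
  rw [star_trivial] at h2
  have h3 : dotProduct (a • w - t • v) (A.mulVec (a • w - t • v)) =
      a * (a * dotProduct w (A.mulVec w) - t ^ 2) := by
    simp only [Matrix.mulVec_sub, Matrix.mulVec_smul, sub_dotProduct, dotProduct_sub,
      smul_dotProduct, dotProduct_smul, smul_eq_mul, ← hc, ← ha', ← ht]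
    ring
  rw [h3] at h2
  exact pos_of_mul_pos_right h2 ha.le

variable [DecidableEq ι]

open scoped MatrixOrder in
-- With G⁻¹ = B² and B symmetric, the trace is that of BhB, which is positive definite. It makes the
-- mean curvature detect the sign of a definite second fundamental form.
theorem trace_inv_mul_pos [Nonempty ι] {G h : Matrix ι ι ℝ} (hG : G.PosDef) (hh : h.PosDef) :
    0 < (G⁻¹ * h).trace := by
  obtain ⟨B, hBH, hB⟩ : ∃ B : Matrix ι ι ℝ, B.IsHermitian ∧ B * B = G⁻¹ :=
    ⟨CFC.sqrt G⁻¹, (Matrix.nonneg_iff_posSemidef.1 (CFC.sqrt_nonneg G⁻¹)).isHermitian,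
      CFC.sqrt_mul_sqrt_self G⁻¹ hG.inv.posSemidef.nonneg⟩
  have hdet : G⁻¹.det ≠ 0 := hG.inv.det_pos.ne'
  have hBdet : IsUnit B := by
    rw [Matrix.isUnit_iff_isUnit_det]
    rw [← hB, Matrix.det_mul] at hdet
    exact (right_ne_zero_of_mul hdet).isUnit
  rw [← hB, Matrix.mul_assoc, Matrix.trace_mul_comm]
  nth_rw 2 [← hBH.eq]
  exact (hh.mul_mul_conjTranspose_same (Matrix.vecMul_injective_of_isUnit hBdet)).trace_pos

/-- A symmetric form whose restriction to every plane is definite is definite. -/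
theorem posDef_or_neg_posDef {h : Matrix ι ι ℝ} (hcard : 2 ≤ Fintype.card ι)
    (hT : h.transpose = h)
    (hpos : ∀ v w : ι → ℝ, LinearIndependent ℝ ![v, w] →
      0 < dotProduct v (h.mulVec v) * dotProduct w (h.mulVec w) - dotProduct v (h.mulVec w) ^ 2) :
    h.PosDef ∨ (-h).PosDef := by
  have hH : h.IsHermitian := by simpa [Matrix.IsHermitian] using hT
  have hne : Nonempty ι := Fintype.card_pos_iff.1 (by omega)
  obtain ⟨i⟩ := hne
  let v₀ : ι → ℝ := Pi.single i 1
  have hv₀ : v₀ ≠ 0 := by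
    intro h0; have := congrFun h0 i; simp [v₀] at this
  obtain ⟨j, hj⟩ := Fintype.exists_ne_of_one_lt_card (by omega) i
  have hind₀ : LinearIndependent ℝ ![v₀, Pi.single j 1] := by
    rw [LinearIndependent.pair_iff]
    intro s t hst
    have h1 := congrFun hst i
    have h2 := congrFun hst j
    simp [v₀, hj, hj.symm] at h1 h2
    exact ⟨h1, h2⟩
  -- All nonzero vectors give the form the same strict sign as `v₀`: by the hypothesis on the plane
  -- they span with `v₀`, or, for a multiple of `v₀`, because `v₀` is not null. The latter uses a
  -- second direction, hence dimension at least 2.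
  have key : ∀ v : ι → ℝ, v ≠ 0 → 0 < dotProduct v₀ (h.mulVec v₀) * dotProduct v (h.mulVec v) := by
    intro v hv
    by_cases hi : LinearIndependent ℝ ![v₀, v]
    · have := hpos _ _ hi
      nlinarith [sq_nonneg (dotProduct v₀ (h.mulVec v))]
    · rw [LinearIndependent.pair_iff' hv₀] at hi
      push Not at hi
      obtain ⟨a, rfl⟩ := hi
      have h0 : dotProduct v₀ (h.mulVec v₀) ≠ 0 := by
        intro h0
        have := hpos _ _ hind₀
        rw [h0] at this
        nlinarith [sq_nonneg (dotProduct v₀ (h.mulVec (Pi.single j 1)))]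
      have ha : a ≠ 0 := by rintro rfl; simp at hv
      simp only [Matrix.mulVec_smul, smul_dotProduct, dotProduct_smul, smul_eq_mul]
      have : dotProduct v₀ (h.mulVec v₀) * (a * (a * dotProduct v₀ (h.mulVec v₀))) =
        (a * dotProduct v₀ (h.mulVec v₀)) ^ 2 := by ring
      rw [this]
      positivity
  rcases lt_or_ge 0 (dotProduct v₀ (h.mulVec v₀)) with h0 | h0
  · left
    refine Matrix.PosDef.of_dotProduct_mulVec_pos hH fun v hv => ?_
    rw [star_trivial]
    exact pos_of_mul_pos_right (key v hv) h0.le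
  · right
    refine Matrix.PosDef.of_dotProduct_mulVec_pos hH.neg fun v hv => ?_
    rw [star_trivial, Matrix.neg_mulVec, dotProduct_neg]
    have := key v hv
    by_contra hcon
    nlinarith

end Definite

/-! ### The second derivative test -/

section SecondDerivative

variable {d : ℕ}

local notation "𝔼" d:max => EuclideanSpace ℝ (Fin d)

theorem sum_pd_pd_nonpos_of_isLocalMax {τ : 𝔼 d → ℝ} {x : 𝔼 d} (hτ : ContDiffAt ℝ ∞ τ x)
    (hmax : IsLocalMax τ x) (v : 𝔼 d) : ∑ i, ∑ j, v i * v j * pd i (pd j τ) x ≤ 0 := by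
  by_contra hcon
  push Not at hcon
  let c : ℝ → 𝔼 d := fun r => x + r • v
  have hc0 : c 0 = x := by simp [c]
  have hc : ∀ r, HasDerivAt c v r := fun r => by
    refine (((hasDerivAt_id r).smul_const v).const_add x).congr_deriv ?_
    simp
  have hcc : Tendsto c (𝓝 0) (𝓝 x) := by
    have := (hc 0).continuousAt.tendsto
    rwa [hc0] at this
  have hd : ∀ᶠ r in 𝓝 (0 : ℝ), HasDerivAt (fun r => τ (c r)) (∑ j, v j * pd j τ (c r)) r := by
    have h1 : ContDiffAt ℝ 1 τ x := hτ.of_le (by simp)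
    filter_upwards [hcc.eventually (h1.eventually (by simp))] with r hr
    have := (hr.differentiableAt (by simp)).hasFDerivAt.comp_hasDerivAt r (hc r)
    rw [fderiv_eq_sum_pd] at this
    exact this
  have hd1 : deriv (fun r => τ (c r)) =ᶠ[𝓝 0] fun r => ∑ j, v j * pd j τ (c r) := by
    filter_upwards [hd] with r hr using hr.deriv
  have hd2 : HasDerivAt (fun r => ∑ j, v j * pd j τ (c r)) (∑ j, v j * ∑ i, v i * pd i (pd j τ) x)
      0 := by
    refine HasDerivAt.fun_sum fun j _ => HasDerivAt.const_mul _ ?_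
    have h2 : DifferentiableAt ℝ (pd j τ) (c 0) := by rw [hc0]; exact (hτ.pd j).diff
    have := h2.hasFDerivAt.comp_hasDerivAt 0 (hc 0)
    rw [fderiv_eq_sum_pd, hc0] at this
    exact this
  have hdd : deriv (deriv fun r => τ (c r)) 0 = ∑ i, ∑ j, v i * v j * pd i (pd j τ) x := by
    rw [hd1.deriv_eq, hd2.deriv]
    simp only [Finset.mul_sum]
    rw [Finset.sum_comm]
    exact Finset.sum_congr rfl fun i _ => Finset.sum_congr rfl fun j _ => by ring
  have hlm : IsLocalMax (fun r => τ (c r)) 0 := by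
    have : ∀ᶠ r in 𝓝 (0 : ℝ), τ (c r) ≤ τ x := hcc.eventually hmax
    filter_upwards [this] with r hr
    rwa [hc0]
  -- A positive second derivative would make the point a local minimum along the line as well, so
  -- the function would be locally constant there and the second derivative zero.
  have hlmin : IsLocalMin (fun r => τ (c r)) 0 :=
    isLocalMin_of_deriv_deriv_pos (by rw [hdd]; exact hcon) hlm.deriv_eq_zero
      hd.self_of_nhds.continuousAt
  have hconst : (fun r => τ (c r)) =ᶠ[𝓝 0] fun _ => τ (c 0) := by
    filter_upwards [hlm, hlmin] with r h1 h2 using le_antisymm h1 h2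
  have : deriv (deriv fun r => τ (c r)) 0 = 0 := by
    rw [hconst.deriv.deriv_eq]; simp
  linarith

end SecondDerivative

/-! ### Convexity of the boundary of the region -/

section Convexity

variable {n : ℕ} {S : Type*} [TopologicalSpace S] [ChartedSpace (EuclideanSpace ℝ (Fin (n - 1))) S]

local notation "𝔼" d:max => EuclideanSpace ℝ (Fin d)

variable {k : ℝ} {F N : S → Minkowski n} {Ω₀ : Set (Minkowski n)}

/-- A region has a boundary point at which the time coordinate is largest. -/
theorem IsOutwardEmbedding.exists_max [Nonempty S] (hF : IsOutwardEmbedding k F N Ω₀) (hk : 0 < k)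
    (hn : 3 ≤ n) : ∃ p : S, ∀ y ∈ closure Ω₀, y.2 ≤ (F p).2 := by
  obtain ⟨p₁⟩ := ‹Nonempty S›
  have hne : (closure Ω₀).Nonempty := by
    have h1 := (hF.region_boundary.symm ▸ Set.mem_range_self p₁ : F p₁ ∈ closure Ω₀ \ Ω₀)
    exact ⟨_, h1.1⟩
  obtain ⟨m, hm, hmax⟩ := hF.region_bounded.isCompact_closure.exists_isMaxOn hne
    (continuous_snd (X := 𝔼 n) (Y := ℝ)).continuousOn
  by_cases hmΩ : m ∈ Ω₀
  · exfalso
    obtain ⟨U, hU, hΩ⟩ := hF.region_open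
    have hmH := hF.region_subset hmΩ
    have hmU : m ∈ U := by rw [hΩ] at hmΩ; exact hmΩ.1
    -- On the hyperboloid t = √(|x|² + 1/k²), so moving an interior point in a horizontal direction
    -- `w` with ⟨m.1, w⟩ ≥ 0 strictly increases t. For any nonzero vector, it or its negative
    -- qualifies.
    obtain ⟨w, hw0, hw⟩ : ∃ w : 𝔼 n, w ≠ 0 ∧ 0 ≤ (inner ℝ m.1 w : ℝ) := by
      let w : 𝔼 n := EuclideanSpace.single ⟨0, by omega⟩ 1
      have hw : w ≠ 0 := by simp [w]
      rcases le_total 0 (inner ℝ m.1 w : ℝ) with h | h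
      · exact ⟨w, hw, h⟩
      · exact ⟨-w, neg_ne_zero.2 hw, by rw [inner_neg_right]; linarith⟩
    have hk2 : 0 < 1 / k ^ 2 := by positivity
    have hm2 : √(‖m.1‖ ^ 2 + 1 / k ^ 2) = m.2 := by
      have := hmH.1
      simp only [lorentz, real_inner_self_eq_norm_sq] at this
      rw [show ‖m.1‖ ^ 2 + 1 / k ^ 2 = m.2 ^ 2 by linarith, Real.sqrt_sq hmH.2.le]
    let c : ℝ → Minkowski n := fun r => (m.1 + r • w, √(‖m.1 + r • w‖ ^ 2 + 1 / k ^ 2))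
    have hc : Continuous c := by fun_prop
    have hc0 : c 0 = m := by
      simp only [c, zero_smul, add_zero]
      exact Prod.ext rfl hm2
    have hev : ∀ᶠ r in 𝓝[>] (0 : ℝ), c r ∈ U := by
      refine nhdsWithin_le_nhds (hc.continuousAt.eventually ?_)
      rw [hc0]; exact hU.mem_nhds hmU
    obtain ⟨r, hrU, hr⟩ := (hev.and self_mem_nhdsWithin).exists
    have hr' : 0 < r := hr
    have hnorm : ‖m.1‖ ^ 2 < ‖m.1 + r • w‖ ^ 2 := by
      rw [norm_add_sq_real, inner_smul_right, norm_smul]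
      have : 0 < (‖r‖ * ‖w‖) ^ 2 := by
        have := norm_pos_iff.2 hw0
        have := norm_pos_iff.2 hr'.ne'
        positivity
      have : 0 ≤ r * (inner ℝ m.1 w : ℝ) := mul_nonneg hr'.le hw
      linarith
    have hcH : c r ∈ hyperbolicSpace n k := by
      refine ⟨?_, Real.sqrt_pos.2 (by positivity)⟩
      simp only [c, lorentz, real_inner_self_eq_norm_sq]
      rw [Real.mul_self_sqrt (by positivity)]
      ring
    have hcΩ : c r ∈ Ω₀ := by rw [hΩ]; exact ⟨hrU, hcH⟩
    have h1 : (c r).2 ≤ m.2 := hmax (subset_closure hcΩ)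
    rw [← hm2] at h1
    have h2 : √(‖m.1‖ ^ 2 + 1 / k ^ 2) < √(‖m.1 + r • w‖ ^ 2 + 1 / k ^ 2) :=
      Real.sqrt_lt_sqrt (by positivity) (by linarith)
    exact absurd h1 (not_le.2 h2)
  · have : m ∈ Set.range F := by rw [← hF.region_boundary]; exact ⟨hm, hmΩ⟩
    obtain ⟨p, rfl⟩ := this
    exact ⟨p, fun y hy => hmax hy⟩

/-- A nearby point on the inward geodesic lies in the region, so cosh(ks) t(F) - sinh(ks) t(N)/k ≤
t(F). As cosh(ks) > 1 and t(F) > 0, this forces t(N) > 0. -/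
theorem IsOutwardEmbedding.normal_time_pos (hF : IsOutwardEmbedding k F N Ω₀) (hk : 0 < k) {p : S}
    (hp : ∀ y ∈ closure Ω₀, y.2 ≤ (F p).2) : 0 < (N p).2 := by
  obtain ⟨s, hs, hs0⟩ := ((hF.outward p).and self_mem_nhdsWithin).exists
  have hs0' : 0 < s := hs0
  have h1 := hp _ (subset_closure hs.2)
  have ht := (hF.mem p).2
  simp only [equidistant, mul_neg, Real.cosh_neg, Real.sinh_neg, Prod.snd_add, Prod.smul_snd,
    smul_eq_mul] at h1
  have hks : 0 < k * s := by positivity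
  have hc : 1 < Real.cosh (k * s) := Real.one_lt_cosh.2 hks.ne'
  have hsh : 0 < Real.sinh (k * s) := Real.sinh_pos_iff.2 hks
  have h2 : 0 < 1 / k * Real.sinh (k * s) * (N p).2 := by nlinarith
  exact pos_of_mul_pos_right h2 (by positivity)

/-- At the maximum the Christoffel terms of the Gauss formula drop out, and the Hessian of the time
coordinate is k² t(F) g - t(N) h. It is nonpositive, so h dominates a positive multiple of g. -/
theorem IsImmersed.posDef_of_max (H : IsImmersed (n - 1) k F N) (hk : 0 < k) (hn : 3 ≤ n) {p : S}
    (hFp : 0 < (F p).2) (hNp : 0 < (N p).2) (hmax : ∀ q, (F q).2 ≤ (F p).2) :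
    (gram (inChart p N) (inChart p F) (coords (d := n - 1) p)).PosDef := by
  have hp := coords_mem (d := n - 1) p
  have Hp := H.hypersurface p
  have hFx : inChart p F (coords (d := n - 1) p) = F p := inChart_chart F (mem_chart_source _ p)
  have hNx : inChart p N (coords (d := n - 1) p) = N p := inChart_chart N (mem_chart_source _ p)
  let L : Minkowski n →L[ℝ] ℝ := ContinuousLinearMap.snd ℝ _ _
  let τ : 𝔼 (n - 1) → ℝ := fun y => L (inChart p F y)
  have hτ : ContDiffAt ℝ ∞ τ (coords p) := L.contDiff.contDiffAt.comp _ (Hp.smooth _ hp)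
  have hlm : IsLocalMax τ (coords p) := by
    refine Eventually.of_forall fun y => ?_
    simp only [τ, hFx]
    exact hmax _
  have hpd : ∀ y ∈ (chartAt (𝔼 (n - 1)) p).target, ∀ i, pd i τ y = L (pd i (inChart p F) y) :=
    fun y hy i => pd_clm L (Hp.smooth y hy).diff i
  have hcrit : ∀ i, L (pd i (inChart p F) (coords p)) = 0 := fun i => by
    rw [← hpd _ hp, pd, hlm.fderiv_eq_zero]; simp
  have hpp : ∀ i j, pd i (pd j τ) (coords p) =
      k ^ 2 * gram (inChart p F) (inChart p F) (coords p) i j * (F p).2 -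
        gram (inChart p N) (inChart p F) (coords p) i j * (N p).2 := by
    intro i j
    have h1 : pd j τ =ᶠ[𝓝 (coords p)] fun y => L (pd j (inChart p F) y) := by
      filter_upwards [Hp.isOpen.mem_nhds hp] with y hy using hpd y hy j
    rw [pd_congr h1, pd_clm L ((Hp.smooth _ hp).pd j).diff, Hp.pd_pd_eq hk.ne' (by omega) hp,
      map_sub, map_add, map_sum]
    simp only [map_smul, hcrit, mul_zero, Finset.sum_const_zero, zero_add, hFx, hNx, smul_eq_mul]
    rfl
  refine Matrix.PosDef.of_dotProduct_mulVec_pos (by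
    simpa [Matrix.IsHermitian] using Hp.gramNormal_transpose hp) fun v hv => ?_
  have h1 := sum_pd_pd_nonpos_of_isLocalMax hτ hlm (WithLp.toLp 2 v)
  have h2 := (Hp.posDef _ hp).dotProduct_mulVec_pos hv
  rw [star_trivial] at h2 ⊢
  have bil : ∀ (A : Matrix (Fin (n - 1)) (Fin (n - 1)) ℝ),
      ∑ i, ∑ j, v i * v j * A i j = dotProduct v (A.mulVec v) := by
    intro A
    simp only [dotProduct, Matrix.mulVec, Finset.mul_sum]
    exact Finset.sum_congr rfl fun i _ => Finset.sum_congr rfl fun j _ => by ring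
  have h3 : ∑ i, ∑ j, v i * v j * pd i (pd j τ) (coords p) =
      k ^ 2 * (F p).2 * dotProduct v ((gram (inChart p F) (inChart p F) (coords p)).mulVec v) -
      (N p).2 * dotProduct v ((gram (inChart p N) (inChart p F) (coords p)).mulVec v) := by
    rw [← bil, ← bil, Finset.mul_sum, Finset.mul_sum, ← Finset.sum_sub_distrib]
    refine Finset.sum_congr rfl fun i _ => ?_
    rw [Finset.mul_sum, Finset.mul_sum, ← Finset.sum_sub_distrib]
    refine Finset.sum_congr rfl fun j _ => ?_
    rw [hpp]; ring
  have h4 : 0 < k ^ 2 * (F p).2 *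
    dotProduct v ((gram (inChart p F) (inChart p F) (coords p)).mulVec v) := by positivity
  have h5 : ∑ i, ∑ j, v i * v j * pd i (pd j τ) (coords p) ≤ 0 := h1
  rw [h3] at h5
  exact pos_of_mul_pos_right (lt_of_lt_of_le h4 (by linarith)) hNp.le

variable [IsManifold (𝓡 (n - 1)) ∞ S]

/-- Tangent vectors are orthogonal to the timelike position vector, so an immersion into hyperbolic
space automatically has positive definite induced metric. -/
theorem IsOutwardEmbedding.isImmersed (hF : IsOutwardEmbedding k F N Ω₀) (hk : 0 < k) :
    IsImmersed (n - 1) k F N := by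
  refine ⟨hF.smooth, hF.normal_smooth, fun q => ?_⟩
  have hpd : ∀ x ∈ (chartAt (𝔼 (n - 1)) q).target, ∀ v : 𝔼 (n - 1),
      fderiv ℝ (inChart q F) x v = (mfderiv (𝓡 (n - 1)) 𝓘(ℝ, Minkowski n) F
        ((chartAt (𝔼 (n - 1)) q).symm x) (mfderiv (𝓡 (n - 1)) (𝓡 (n - 1))
          (chartAt (𝔼 (n - 1)) q).symm x v) : Minkowski n) := fun x hx v =>
    (mfderiv_comp_chart_symm hF.smooth hx v).symm
  have hself : ∀ x, lorentz (inChart (d := n - 1) q F x) (inChart q F x) = -(1 / k ^ 2) :=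
    fun x => (hF.mem _).1
  have hpdself : ∀ x ∈ (chartAt (𝔼 (n - 1)) q).target, ∀ i,
      lorentz (pd i (inChart q F) x) (inChart q F x) = 0 := by
    intro x hx i
    have h1 := IsHypersurface.pd_eq_zero_of_const (chartAt (𝔼 (n - 1)) q).open_target
      (fun y _ => hself y) hx i
    have hd := (contDiffAt_inChart hF.smooth hx).diff
    rw [pd_lorentz hd hd, lorentz_comm (inChart q F x)] at h1
    linarith
  refine ⟨(chartAt (𝔼 (n - 1)) q).open_target, fun x hx => contDiffAt_inChart hF.smooth hx,
    fun x hx => contDiffAt_inChart hF.normal_smooth hx, fun x _ => hself x,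
    fun x _ => hF.normal_unit _, fun x _ => hF.normal_tangent _, fun x hx i => ?_, fun x hx => ?_⟩
  · rw [pd, hpd x hx]
    exact hF.normal_orthogonal _ _
  · refine Matrix.PosDef.of_dotProduct_mulVec_pos ?_ fun v hv => ?_
    · ext i j; exact lorentz_comm _ _
    rw [star_trivial, dotProduct_gram_mulVec]
    refine lorentz_self_pos_of_orthogonal (y := inChart q F x) ?_ ?_ fun h0 => hv ?_
    · rw [hself]
      have : 0 < 1 / k ^ 2 := by positivity
      linarith
    · simp [lorentz_sum_left, lorentz_smul_left, hpdself x hx]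
    · have h1 : fderiv ℝ (inChart q F) x (WithLp.toLp 2 v) = 0 := by
        rw [fderiv_eq_sum_pd]; exact h0
      rw [hpd x hx] at h1
      have h2 := hF.immersion _ (h1.trans (map_zero _).symm)
      -- The derivative of the chart is a left inverse of that of its inverse, so injectivity on
      -- tangent spaces passes to coordinates.
      have h3 := (mdifferentiable_chart (I := 𝓡 (n - 1)) q).comp_symm_deriv hx
      have h4 := congrArg (fun L => L (WithLp.toLp 2 v : 𝔼 (n - 1))) h3
      have h5 : (0 : 𝔼 (n - 1)) = WithLp.toLp 2 v :=
        ((congrArg (mfderiv (𝓡 (n - 1)) (𝓡 (n - 1)) (chartAt (𝔼 (n - 1)) q)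
          ((chartAt (𝔼 (n - 1)) q).symm x)) h2).trans (map_zero _)).symm.trans h4
      ext i
      have := congrArg (fun w : 𝔼 (n - 1) => w i) h5
      simpa using this.symm

/-- The Gauss equation turns the curvature bound into definiteness of the second fundamental form. -/
theorem IsImmersed.definite_of_sectionalCurvatureGT (H : IsImmersed (n - 1) k F N) (hk : 0 < k)
    (hn : 3 ≤ n)
    (hK : SectionalCurvatureGT (inducedMetric F : Tensor2 (n - 1) S) (-k ^ 2)) (p : S) :
    (gram (inChart p N) (inChart p F) (coords (d := n - 1) p)).PosDef ∨
      (-gram (inChart p N) (inChart p F) (coords (d := n - 1) p)).PosDef := by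
  have hp := coords_mem (d := n - 1) p
  have Hp := H.hypersurface p
  have bil : ∀ (A : Matrix (Fin (n - 1)) (Fin (n - 1)) ℝ) (v w : Fin (n - 1) → ℝ),
      ∑ i, ∑ j, A i j * v i * w j = dotProduct v (A.mulVec w) := by
    intro A v w
    simp only [dotProduct, Matrix.mulVec, Finset.mul_sum]
    exact Finset.sum_congr rfl fun i _ => Finset.sum_congr rfl fun j _ => by ring
  refine posDef_or_neg_posDef (by simp; omega) (Hp.gramNormal_transpose hp) fun v w hvw => ?_
  have h1 := hK p v w hvw
  rw [coordSectionalCurvature_congr (H.chartMatrix_eventuallyEq p hp), coordSectionalCurvature,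
    Hp.sum_riemann_eq hk.ne' (by omega) hp] at h1
  simp only [bil] at h1
  have h2 := gramDet_pos_of_posDef (Hp.posDef _ hp) hvw
  rw [lt_div_iff₀ h2] at h1
  linarith

/-- The second fundamental form of the boundary is positive definite in every chart. -/
theorem IsOutwardEmbedding.posDef [ConnectedSpace S] (hF : IsOutwardEmbedding k F N Ω₀)
    (hk : 0 < k) (hn : 3 ≤ n)
    (hK : SectionalCurvatureGT (inducedMetric F : Tensor2 (n - 1) S) (-k ^ 2)) (q : S)
    {x : 𝔼 (n - 1)} (hx : x ∈ (chartAt (𝔼 (n - 1)) q).target) :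
    (gram (inChart q N) (inChart q F) x).PosDef := by
  have H := hF.isImmersed hk
  have : Nonempty (Fin (n - 1)) := ⟨⟨0, by omega⟩⟩
  have hdef := H.definite_of_sectionalCurvatureGT hk hn hK
  have hposH : ∀ p, (gram (inChart p N) (inChart p F) (coords (d := n - 1) p)).PosDef →
      0 < meanCurvature (d := n - 1) F N p := fun p hp => by
    rw [H.meanCurvature_eq]
    exact trace_inv_mul_pos ((H.hypersurface p).posDef _ (coords_mem p)) hp
  have hnegH : ∀ p, (-gram (inChart p N) (inChart p F) (coords (d := n - 1) p)).PosDef →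
      meanCurvature (d := n - 1) F N p < 0 := fun p hp => by
    rw [H.meanCurvature_eq]
    have := trace_inv_mul_pos ((H.hypersurface p).posDef _ (coords_mem p)) hp
    rw [Matrix.mul_neg, Matrix.trace_neg] at this
    exact neg_pos.1 this
  obtain ⟨p₀, hp₀⟩ := hF.exists_max hk hn
  have hrange : ∀ q, F q ∈ closure Ω₀ := fun q => by
    have h1 : F q ∈ closure Ω₀ \ Ω₀ := by rw [hF.region_boundary]; exact Set.mem_range_self q
    exact h1.1
  have h0 : 0 < meanCurvature (d := n - 1) F N p₀ :=
    hposH p₀ (H.posDef_of_max hk hn (hF.mem p₀).2 (hF.normal_time_pos hk hp₀)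
      fun q => hp₀ _ (hrange q))
  -- The mean curvature is continuous on a connected space and positive at `p₀`; a nonpositive value
  -- would produce a zero, impossible where the second fundamental form is definite.
  have hall : ∀ p, 0 < meanCurvature (d := n - 1) F N p := by
    intro p
    by_contra hcon
    push Not at hcon
    obtain ⟨r, hr⟩ := mem_range_of_exists_le_of_exists_ge H.continuous_meanCurvature
      ⟨p, hcon⟩ ⟨p₀, h0.le⟩
    rcases hdef r with h | h
    · exact (hposH r h).ne' hr
    · exact (hnegH r h).ne hr
  set p := (chartAt (𝔼 (n - 1)) q).symm x with hpdef
  have hps := mem_chart_source (𝔼 (n - 1)) p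
  have hpp : (gram (inChart p N) (inChart p F) (coords (d := n - 1) p)).PosDef := by
    rcases hdef p with h | h
    · exact h
    · exact absurd (hnegH p h) (not_lt.2 (hall p).le)
  rw [H.gramNormal_transition hx hps]
  have hJ := (isUnit_det_of_congruence (H.gram_transition hx hps)
    ((H.hypersurface q).det_pos hx).ne').1
  have := hpp.mul_mul_conjTranspose_same (B := jacobi (transition q p) x)
    (Matrix.vecMul_injective_of_isUnit ((Matrix.isUnit_iff_isUnit_det _).2 hJ))
  rw [Matrix.conjTranspose_eq_transpose_of_trivial] at this
  exact this

/-- The leaves of the equidistant foliation are immersed. -/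
theorem IsOutwardEmbedding.isImmersed_leaf [ConnectedSpace S] (hF : IsOutwardEmbedding k F N Ω₀)
    (hk : 0 < k) (hn : 3 ≤ n)
    (hK : SectionalCurvatureGT (inducedMetric F : Tensor2 (n - 1) S) (-k ^ 2)) {s : ℝ}
    (hs : 0 ≤ s) :
    IsImmersed (n - 1) k (fun p => equidistant k F N p s)
      (fun p => equidistantNormal k F N p s) := by
  have h : ∀ a b : ℝ, ContMDiff (𝓡 (n - 1)) 𝓘(ℝ, Minkowski n) ∞ (fun p => a • F p + b • N p) :=
    fun a b => ((a • ContinuousLinearMap.id ℝ (Minkowski n)).contMDiff.comp hF.smooth).add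
      ((b • ContinuousLinearMap.id ℝ (Minkowski n)).contMDiff.comp hF.normal_smooth)
  refine ⟨h _ _, h _ _, fun q => ?_⟩
  exact ((hF.isImmersed hk).hypersurface q).equidistant hk
    (fun x hx => hF.posDef hk hn hK q hx) hs

end Convexity

/-! ### Joint regularity of the equidistant family -/

section Joint

variable {n d : ℕ} {k : ℝ}

local notation "𝔼" d:max => EuclideanSpace ℝ (Fin d)

variable {f ν : 𝔼 d → Minkowski n} {U : Set (𝔼 d)} {x : 𝔼 d}

/-- The index type serves two uses: `Fin d` for the family of partial derivatives, and `Unit` for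
the position vector itself. -/
theorem contDiffAt_equidistant_uncurry {V : Type*} [NormedAddCommGroup V] [NormedSpace ℝ V]
    {ι : Type*} {F N : V → ι → Minkowski n} {y : V} {i : ι}
    (hF : ContDiffAt ℝ ∞ (fun v => F v i) y) (hN : ContDiffAt ℝ ∞ (fun v => N v i) y) (s : ℝ) :
    ContDiffAt ℝ ∞ (fun z : V × ℝ => equidistant k (F z.1) (N z.1) i z.2) (y, s) := by
  have h1 : ContDiffAt ℝ ∞ (fun z : V × ℝ => F z.1 i) (y, s) := hF.comp (y, s) contDiffAt_fst
  have h2 : ContDiffAt ℝ ∞ (fun z : V × ℝ => N z.1 i) (y, s) := hN.comp (y, s) contDiffAt_fst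
  unfold equidistant
  fun_prop

theorem contDiffAt_equidistantNormal_uncurry {V : Type*} [NormedAddCommGroup V] [NormedSpace ℝ V]
    {ι : Type*} {F N : V → ι → Minkowski n} {y : V} {i : ι}
    (hF : ContDiffAt ℝ ∞ (fun v => F v i) y) (hN : ContDiffAt ℝ ∞ (fun v => N v i) y) (s : ℝ) :
    ContDiffAt ℝ ∞ (fun z : V × ℝ => equidistantNormal k (F z.1) (N z.1) i z.2) (y, s) := by
  have h1 : ContDiffAt ℝ ∞ (fun z : V × ℝ => F z.1 i) (y, s) := hF.comp (y, s) contDiffAt_fst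
  have h2 : ContDiffAt ℝ ∞ (fun z : V × ℝ => N z.1 i) (y, s) := hN.comp (y, s) contDiffAt_fst
  unfold equidistantNormal
  fun_prop

theorem contDiffAt_gram_equidistant (hU : IsOpen U) (hf : ∀ y ∈ U, ContDiffAt ℝ ∞ f y)
    (hν : ∀ y ∈ U, ContDiffAt ℝ ∞ ν y)
    (hx : x ∈ U) (s : ℝ) (a b : Fin d) :
    ContDiffAt ℝ ∞ (fun z : 𝔼 d × ℝ => gram (fun y => equidistant k f ν y z.2)
      (fun y => equidistant k f ν y z.2) z.1 a b) (x, s) := by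
  have h := fun i => contDiffAt_equidistant_uncurry (k := k) (F := fun y j => pd j f y)
    (N := fun y j => pd j ν y) ((hf x hx).pd i) ((hν x hx).pd i) s
  refine ((h a).lorentz (h b)).congr_of_eventuallyEq ?_
  filter_upwards [(hU.prod isOpen_univ).mem_nhds ⟨hx, Set.mem_univ s⟩] with z hz
  rw [gram_apply, pd_equidistant (hf _ hz.1).diff (hν _ hz.1).diff,
    pd_equidistant (hf _ hz.1).diff (hν _ hz.1).diff]

theorem contDiffAt_gramNormal_equidistant (hU : IsOpen U) (hf : ∀ y ∈ U, ContDiffAt ℝ ∞ f y)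
    (hν : ∀ y ∈ U, ContDiffAt ℝ ∞ ν y)
    (hx : x ∈ U) (s : ℝ) (a b : Fin d) :
    ContDiffAt ℝ ∞ (fun z : 𝔼 d × ℝ => gram (fun y => equidistantNormal k f ν y z.2)
      (fun y => equidistant k f ν y z.2) z.1 a b) (x, s) := by
  have h := fun i => contDiffAt_equidistant_uncurry (k := k) (F := fun y j => pd j f y)
    (N := fun y j => pd j ν y) ((hf x hx).pd i) ((hν x hx).pd i) s
  have h' := fun i => contDiffAt_equidistantNormal_uncurry (k := k) (F := fun y j => pd j f y)
    (N := fun y j => pd j ν y) ((hf x hx).pd i) ((hν x hx).pd i) s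
  refine ((h' a).lorentz (h b)).congr_of_eventuallyEq ?_
  filter_upwards [(hU.prod isOpen_univ).mem_nhds ⟨hx, Set.mem_univ s⟩] with z hz
  rw [gram_apply, pd_equidistant (hf _ hz.1).diff (hν _ hz.1).diff,
    pd_equidistantNormal (hf _ hz.1).diff (hν _ hz.1).diff]

theorem contDiffAt_sqrt_det_equidistant (hU : IsOpen U) (hf : ∀ y ∈ U, ContDiffAt ℝ ∞ f y)
    (hν : ∀ y ∈ U, ContDiffAt ℝ ∞ ν y)
    {s : ℝ} (hdet : (gram (fun y => equidistant k f ν y s) (fun y => equidistant k f ν y s) x).det ≠ 0)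
    (hx : x ∈ U) :
    ContDiffAt ℝ ∞ (fun z : 𝔼 d × ℝ => √(gram (fun y => equidistant k f ν y z.2)
      (fun y => equidistant k f ν y z.2) z.1).det) (x, s) :=
  contDiffAt_sqrt_det (contDiffAt_gram_equidistant hU hf hν hx s) hdet

theorem contDiffAt_shape_equidistant (hU : IsOpen U) (hf : ∀ y ∈ U, ContDiffAt ℝ ∞ f y)
    (hν : ∀ y ∈ U, ContDiffAt ℝ ∞ ν y)
    {s : ℝ} (hdet : (gram (fun y => equidistant k f ν y s) (fun y => equidistant k f ν y s) x).det ≠ 0)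
    (hx : x ∈ U) (a b : Fin d) :
    ContDiffAt ℝ ∞ (fun z : 𝔼 d × ℝ => shape (fun y => equidistant k f ν y z.2)
      (fun y => equidistantNormal k f ν y z.2) z.1 a b) (x, s) := by
  simp only [shape, Matrix.mul_apply]
  exact ContDiffAt.sum fun m _ =>
    (contDiffAt_inv_apply (contDiffAt_gram_equidistant hU hf hν hx s) hdet a m).mul
      (contDiffAt_gramNormal_equidistant hU hf hν hx s m b)

theorem contDiffAt_trace_shape_equidistant (hU : IsOpen U) (hf : ∀ y ∈ U, ContDiffAt ℝ ∞ f y)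
    (hν : ∀ y ∈ U, ContDiffAt ℝ ∞ ν y)
    {s : ℝ} (hdet : (gram (fun y => equidistant k f ν y s) (fun y => equidistant k f ν y s) x).det ≠ 0)
    (hx : x ∈ U) :
    ContDiffAt ℝ ∞ (fun z : 𝔼 d × ℝ => (shape (fun y => equidistant k f ν y z.2)
      (fun y => equidistantNormal k f ν y z.2) z.1).trace) (x, s) := by
  simp only [Matrix.trace, Matrix.diag]
  exact ContDiffAt.sum fun i _ => contDiffAt_shape_equidistant hU hf hν hdet hx i i

theorem contDiffAt_trace_shape_sq_equidistant (hU : IsOpen U) (hf : ∀ y ∈ U, ContDiffAt ℝ ∞ f y)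
    (hν : ∀ y ∈ U, ContDiffAt ℝ ∞ ν y)
    {s : ℝ} (hdet : (gram (fun y => equidistant k f ν y s) (fun y => equidistant k f ν y s) x).det ≠ 0)
    (hx : x ∈ U) :
    ContDiffAt ℝ ∞ (fun z : 𝔼 d × ℝ => (shape (fun y => equidistant k f ν y z.2)
      (fun y => equidistantNormal k f ν y z.2) z.1 * shape (fun y => equidistant k f ν y z.2)
      (fun y => equidistantNormal k f ν y z.2) z.1).trace) (x, s) := by
  simp only [Matrix.trace, Matrix.diag, Matrix.mul_apply]
  exact ContDiffAt.sum fun i _ => ContDiffAt.sum fun j _ =>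
    (contDiffAt_shape_equidistant hU hf hν hdet hx i j).mul
      (contDiffAt_shape_equidistant hU hf hν hdet hx j i)

end Joint

/-! ### The geometry of the leaves -/

section Leaves

variable {n : ℕ} {S : Type*} [TopologicalSpace S] [ChartedSpace (EuclideanSpace ℝ (Fin (n - 1))) S]

local notation "𝔼" d:max => EuclideanSpace ℝ (Fin d)

variable {k : ℝ} {F N : S → Minkowski n}

theorem leafH₀_eq (hk : k ≠ 0) (p : S) (s : ℝ) :
    leafH₀ k F N p s = meanCurvature (d := n - 1) (fun q => equidistant k F N q s)
      (fun q => equidistantNormal k F N q s) p := by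
  simp only [leafH₀, velocity_eq hk]

variable [IsManifold (𝓡 (n - 1)) ∞ S]

theorem leafScalar_eq (hn : 1 ≤ n) (hk : k ≠ 0) {s : ℝ}
    (H : IsImmersed (n - 1) k (fun p => equidistant k F N p s)
      (fun p => equidistantNormal k F N p s)) (p : S) :
    leafScalar k F N p s = -((n - 1) * (n - 2) * k ^ 2) + leafH₀ k F N p s ^ 2 -
      sqNormSecondFundamentalForm (n - 1) (fun p => equidistant k F N p s)
        (fun p => equidistantNormal k F N p s) p := by
  rw [leafScalar, leafMetric, H.scalarCurvature_eq hk (by omega), leafH₀_eq hk]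
  push_cast [hn]
  ring

/-- The mean curvature of the leaves in the metric `u² dρ² + g_ρ`. -/
theorem leafH_eq (hk : k ≠ 0) (hF : ContMDiff (𝓡 (n - 1)) 𝓘(ℝ, Minkowski n) ∞ F)
    (hN : ContMDiff (𝓡 (n - 1)) 𝓘(ℝ, Minkowski n) ∞ N) {s : ℝ}
    (H : IsImmersed (n - 1) k (fun p => equidistant k F N p s)
      (fun p => equidistantNormal k F N p s)) {u : S → ℝ → ℝ} {p : S} (hu : u p s ≠ 0) :
    leafH k F N u p s = (u p s)⁻¹ * leafH₀ k F N p s := by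
  have hp := coords_mem (d := n - 1) p
  have Hp := H.hypersurface p
  have hopen := (chartAt (𝔼 (n - 1)) p).open_target
  -- All real `t` are needed, not only t ≥ 0: the metric is differentiated on both sides of `s`,
  -- also when s = 0. Smoothness of the map suffices; leaves with negative parameter need not be
  -- immersed.
  have hX : ∀ t, ContMDiff (𝓡 (n - 1)) 𝓘(ℝ, Minkowski n) ∞ (fun p => equidistant k F N p t) :=
    fun t => ((Real.cosh (k * t) • ContinuousLinearMap.id ℝ (Minkowski n)).contMDiff.comp hF).add
      (((1 / k * Real.sinh (k * t)) • ContinuousLinearMap.id ℝ (Minkowski n)).contMDiff.comp hN)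
  have hG : ∀ t, ∀ x ∈ (chartAt (𝔼 (n - 1)) p).target, chartMatrix (leafMetric k F N t) p x =
      gram (fun y => equidistant k (inChart p F) (inChart p N) y t)
        (fun y => equidistant k (inChart p F) (inChart p N) y t) x :=
    fun t x hx => chartMatrix_inducedMetric (hX t) hx
  have hup : u ((chartAt (𝔼 (n - 1)) p).symm (coords p)) s = u p s := by
    rw [coords, (chartAt (𝔼 (n - 1)) p).left_inv (mem_chart_source _ p)]
  have hf : ∀ y ∈ (chartAt (𝔼 (n - 1)) p).target, ContDiffAt ℝ ∞ (inChart p F) y :=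
    fun y hy => contDiffAt_inChart hF hy
  have hν : ∀ y ∈ (chartAt (𝔼 (n - 1)) p).target, ContDiffAt ℝ ∞ (inChart p N) y :=
    fun y hy => contDiffAt_inChart hN hy
  rw [leafH, sliceMeanCurvature, coordSliceMeanCurvature_eq (stdFrame (n - 1))
    (fun s => chartMatrix (leafMetric k F N s) p) _ (coords p) s
    (2 • gram (fun y => equidistantNormal k (inChart p F) (inChart p N) y s)
        (fun y => equidistant k (inChart p F) (inChart p N) y s) (coords p)) ?_ ?_ ?_ ?_]
  · rw [hup, hG s _ hp, leafH₀_eq hk, H.meanCurvature_eq]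
    congr 1
    simp only [shape, Matrix.trace, Matrix.diag, Matrix.mul_apply]
    refine Finset.sum_congr rfl fun a _ => Finset.sum_congr rfl fun b _ => ?_
    rw [two_smul, Matrix.add_apply]
    have := Hp.gramNormal_comm hp a b
    rw [show gram (fun y => equidistantNormal k (inChart p F) (inChart p N) y s)
      (fun y => equidistant k (inChart p F) (inChart p N) y s) (coords p) a b = _ from this]
    congr 1
    rw [← two_mul, ← mul_assoc]
    norm_num
  · intro a b
    refine ((contDiffAt_gram_equidistant (k := k) hopen hf hν hp s a b).differentiableAt
      (by simp)).congr_of_eventuallyEq ?_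
    filter_upwards [(hopen.prod isOpen_univ).mem_nhds ⟨hp, Set.mem_univ s⟩] with z hz
    rw [hG _ _ hz.1]
  · intro a b
    simp only [hG _ _ hp]
    refine (hasDerivAt_gram_equidistant (hf _ hp).diff (hν _ hp).diff hk s a b).congr_deriv ?_
    rw [two_smul, Matrix.add_apply]
    congr 1
    exact Hp.gramNormal_comm hp b a
  · rw [hG _ _ hp]
    exact (Hp.det_pos hp).ne'
  · rw [hup]; exact hu

end Leaves

/-! ### Integration with respect to the Riemannian volume -/

section Volume

variable {d : ℕ} {S : Type*} [TopologicalSpace S] [ChartedSpace (EuclideanSpace ℝ (Fin d)) S]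

local notation "𝔼" d:max => EuclideanSpace ℝ (Fin d)

/-- The overlap of the charts at `q` and `r`, in the chart at `q`. -/
def overlap (q r : S) : Set (𝔼 d) :=
  (chartAt (𝔼 d) q).target ∩ (chartAt (𝔼 d) q).symm ⁻¹' (chartAt (𝔼 d) r).source

theorem image_transition (q r : S) :
    transition q r '' overlap (d := d) q r = overlap (d := d) r q := by
  ext y
  constructor
  · rintro ⟨x, hx, rfl⟩
    refine ⟨(chartAt (𝔼 d) r).map_source hx.2, ?_⟩
    rw [Set.mem_preimage, transition, (chartAt (𝔼 d) r).left_inv hx.2]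
    exact (chartAt (𝔼 d) q).map_target hx.1
  · intro hy
    refine ⟨transition r q y, ⟨(chartAt (𝔼 d) q).map_source hy.2, ?_⟩, ?_⟩
    · rw [Set.mem_preimage, transition, (chartAt (𝔼 d) q).left_inv hy.2]
      exact (chartAt (𝔼 d) r).map_target hy.1
    · rw [transition, transition, (chartAt (𝔼 d) q).left_inv hy.2,
        (chartAt (𝔼 d) r).right_inv hy.1]

theorem injOn_transition (q r : S) : Set.InjOn (transition q r) (overlap (d := d) q r) := by
  intro x hx y hy hxy
  have h := (chartAt (𝔼 d) r).injOn hx.2 hy.2 hxy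
  exact (chartAt (𝔼 d) q).symm.injOn hx.1 hy.1 h

theorem isOpen_overlap (q r : S) : IsOpen (overlap (d := d) q r) :=
  (chartAt (𝔼 d) q).isOpen_inter_preimage_symm (chartAt (𝔼 d) r).open_source

variable [T2Space S] [CompactSpace S] [IsManifold (𝓡 d) ∞ S]

theorem tsupport_chartPartition_subset (q : S) :
    tsupport (chartPartition d S q) ⊆ (chartAt (𝔼 d) q).source :=
  Classical.choose_spec (SmoothPartitionOfUnity.exists_isSubordinate_chartAt_source (𝓡 d) S) q

theorem finite_support_chartPartition :
    {q : S | (Function.support (chartPartition d S q)).Nonempty}.Finite :=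
  (chartPartition d S).locallyFinite.finite_nonempty_of_compact

variable (d S) in
/-- The indices of the functions of `chartPartition` that are not identically zero. -/
def partitionIndices : Finset S := (finite_support_chartPartition (d := d) (S := S)).toFinset

theorem chartPartition_eq_zero {q : S} (hq : q ∉ partitionIndices d S) (p : S) :
    chartPartition d S q p = 0 := by
  by_contra h
  exact hq ((finite_support_chartPartition (d := d) (S := S)).mem_toFinset.2 ⟨p, h⟩)

theorem sum_chartPartition (p : S) : ∑ q ∈ partitionIndices d S, chartPartition d S q p = 1 := by
  rw [← (chartPartition d S).sum_eq_one (Set.mem_univ p), finsum_eq_sum_of_support_subset]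
  intro q hq
  by_contra h
  exact hq (chartPartition_eq_zero h p)

/-- The support of the `q`-th function of `chartPartition`, in the chart at `q`. -/
def partitionSupport (q : S) : Set (𝔼 d) := chartAt (𝔼 d) q '' tsupport (chartPartition d S q)

theorem isCompact_partitionSupport (q : S) : IsCompact (partitionSupport (d := d) q) :=
  (isClosed_tsupport _).isCompact.image_of_continuousOn
    ((chartAt (𝔼 d) q).continuousOn.mono (tsupport_chartPartition_subset q))

theorem partitionSupport_subset (q : S) :
    partitionSupport (d := d) q ⊆ (chartAt (𝔼 d) q).target := by
  rintro _ ⟨p, hp, rfl⟩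
  exact (chartAt (𝔼 d) q).map_source (tsupport_chartPartition_subset q hp)

theorem inChart_chartPartition_eq_zero {q : S} {x : 𝔼 d} (hx : x ∈ (chartAt (𝔼 d) q).target)
    (hx' : x ∉ partitionSupport (d := d) q) : inChart q (chartPartition d S q) x = 0 := by
  by_contra h
  exact hx' ⟨_, subset_tsupport _ h, (chartAt (𝔼 d) q).right_inv hx⟩

theorem continuousOn_inChart_chartPartition (q r : S) :
    ContinuousOn (inChart (d := d) r (chartPartition d S q)) (chartAt (𝔼 d) r).target :=
  continuousOn_inChart (chartPartition d S q).contMDiff.continuous r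

variable {V : Type*} [NormedAddCommGroup V] [NormedSpace ℝ V]
variable {g : Tensor2 d S}

theorem integrable_partition
    (hg : ∀ q, ContinuousOn (fun x => √(chartMatrix g q x).det) (chartAt (𝔼 d) q).target) {f : S → V}
    (hf : Continuous f) (q : S) :
    IntegrableOn (fun x => (inChart q (chartPartition d S q) x * √(chartMatrix g q x).det) •
      inChart q f x) (chartAt (𝔼 d) q).target := by
  refine IntegrableOn.of_forall_sdiff_eq_zero (s := partitionSupport (d := d) q) ?_
    (chartAt (𝔼 d) q).open_target.measurableSet fun x hx => by
      rw [inChart_chartPartition_eq_zero hx.1 hx.2, zero_mul, zero_smul]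
  refine ContinuousOn.integrableOn_compact (isCompact_partitionSupport q) ?_
  exact (((continuousOn_inChart_chartPartition q q).mul (hg q)).smul
    (continuousOn_inChart hf q)).mono (partitionSupport_subset q)

variable [MeasurableSpace S]

/-- By compactness only finitely many functions of the partition are nonzero, so the sum over all
points of `S` is finite. -/
theorem riemannianVolume_eq (g : Tensor2 d S) :
    riemannianVolume g = ∑ q ∈ partitionIndices d S, Measure.map (chartAt (𝔼 d) q).symm
      ((volume.restrict (chartAt (𝔼 d) q).target).withDensity fun x =>
        ((inChart q (chartPartition d S q) x * √(chartMatrix g q x).det).toNNReal : ENNReal)) := by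
  ext A hA
  rw [riemannianVolume, Measure.sum_apply _ hA, tsum_eq_sum (s := partitionIndices d S),
    Measure.finsetSum_apply]
  · rfl
  · intro q hq
    simp only [chartPartition_eq_zero hq, zero_mul, ENNReal.ofReal_zero]
    have : (volume.restrict (chartAt (𝔼 d) q).target).withDensity (fun _ => (0 : ENNReal)) = 0 :=
      withDensity_zero
    rw [this]
    simp

variable [BorelSpace S] [SecondCountableTopology V]

theorem integrable_map_partition
    (hg : ∀ q, ContinuousOn (fun x => √(chartMatrix g q x).det) (chartAt (𝔼 d) q).target)
    {f : S → V} (hf : Continuous f) (q : S) :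
    Integrable f (Measure.map (chartAt (𝔼 d) q).symm
      ((volume.restrict (chartAt (𝔼 d) q).target).withDensity fun x =>
        ((inChart q (chartPartition d S q) x * √(chartMatrix g q x).det).toNNReal : ENNReal))) ∧
    ∫ p, f p ∂(Measure.map (chartAt (𝔼 d) q).symm
      ((volume.restrict (chartAt (𝔼 d) q).target).withDensity fun x =>
        ((inChart q (chartPartition d S q) x * √(chartMatrix g q x).det).toNNReal : ENNReal))) =
      ∫ x in (chartAt (𝔼 d) q).target,
        (inChart q (chartPartition d S q) x * √(chartMatrix g q x).det) • inChart q f x := by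
  have hm : MeasurableSet (chartAt (𝔼 d) q).target := (chartAt (𝔼 d) q).open_target.measurableSet
  have hψ : AEMeasurable (chartAt (𝔼 d) q).symm
      ((volume.restrict (chartAt (𝔼 d) q).target).withDensity fun x =>
        ((inChart q (chartPartition d S q) x * √(chartMatrix g q x).det).toNNReal : ENNReal)) :=
    ((chartAt (𝔼 d) q).continuousOn_symm.aemeasurable hm).mono_ac
      (withDensity_absolutelyContinuous _ _)
  have hρ : AEMeasurable (fun x => (inChart q (chartPartition d S q) x *
      √(chartMatrix g q x).det).toNNReal) (volume.restrict (chartAt (𝔼 d) q).target) :=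
    (((continuousOn_inChart_chartPartition q q).mul (hg q)).aemeasurable hm).real_toNNReal
  have hsmul : ∀ x, (inChart q (chartPartition d S q) x * √(chartMatrix g q x).det).toNNReal •
      f ((chartAt (𝔼 d) q).symm x) = (inChart q (chartPartition d S q) x *
        √(chartMatrix g q x).det) • inChart q f x := fun x => by
    have h0 : 0 ≤ inChart q (chartPartition d S q) x * √(chartMatrix g q x).det :=
      mul_nonneg ((chartPartition d S).nonneg q _) (Real.sqrt_nonneg _)
    rw [NNReal.smul_def, Real.coe_toNNReal _ h0, inChart_apply q f]
  constructor
  · rw [integrable_map_measure hf.aestronglyMeasurable hψ,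
      integrable_withDensity_iff_integrable_smul₀ hρ]
    simp only [Function.comp_apply, hsmul]
    exact integrable_partition hg hf q
  · rw [integral_map hψ hf.aestronglyMeasurable, integral_withDensity_eq_integral_smul₀ hρ]
    simp only [hsmul]

theorem integrable_riemannianVolume
    (hg : ∀ q, ContinuousOn (fun x => √(chartMatrix g q x).det) (chartAt (𝔼 d) q).target)
    {f : S → V} (hf : Continuous f) : Integrable f (riemannianVolume g) := by
  rw [riemannianVolume_eq, integrable_finsetSum_measure]
  exact fun q _ => (integrable_map_partition hg hf q).1

theorem integral_riemannianVolume
    (hg : ∀ q, ContinuousOn (fun x => √(chartMatrix g q x).det) (chartAt (𝔼 d) q).target)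
    {f : S → V} (hf : Continuous f) :
    ∫ p, f p ∂riemannianVolume g = ∑ q ∈ partitionIndices d S,
      ∫ x in (chartAt (𝔼 d) q).target,
        (inChart q (chartPartition d S q) x * √(chartMatrix g q x).det) • inChart q f x := by
  rw [riemannianVolume_eq, integral_finsetSum_measure
    fun q _ => (integrable_map_partition hg hf q).1]
  exact Finset.sum_congr rfl fun q _ => (integrable_map_partition hg hf q).2

/-- The domains become compact sets that do not depend on the metric, as differentiation in ρ under
the integral requires. -/
theorem integral_riemannianVolume_partitionSupport
    (hg : ∀ q, ContinuousOn (fun x => √(chartMatrix g q x).det) (chartAt (𝔼 d) q).target)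
    {f : S → V} (hf : Continuous f) :
    ∫ p, f p ∂riemannianVolume g = ∑ q ∈ partitionIndices d S,
      ∫ x in partitionSupport (d := d) q,
        (inChart q (chartPartition d S q) x * √(chartMatrix g q x).det) • inChart q f x := by
  rw [integral_riemannianVolume hg hf]
  refine Finset.sum_congr rfl fun q _ => ?_
  refine setIntegral_eq_of_subset_of_forall_sdiff_eq_zero
    (chartAt (𝔼 d) q).open_target.measurableSet (partitionSupport_subset q) fun x hx => ?_
  rw [inChart_chartPartition_eq_zero hx.1 hx.2, zero_mul, zero_smul]

/-- A function supported in one chart is integrated in that chart. -/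
theorem integral_riemannianVolume_of_support
    (hg : ∀ q, ContinuousOn (fun x => √(chartMatrix g q x).det) (chartAt (𝔼 d) q).target)
    (hT : ∀ q r, ∀ x ∈ overlap (d := d) q r, √(chartMatrix g q x).det =
      |(fderiv ℝ (transition q r) x).det| * √(chartMatrix g r (transition q r x)).det)
    {f : S → ℝ} (hf : Continuous f) {r : S} {C : Set S} (hC : IsClosed C)
    (hCr : C ⊆ (chartAt (𝔼 d) r).source) (hfC : ∀ p, p ∉ C → f p = 0) :
    ∫ p, f p ∂riemannianVolume g =
      ∫ x in (chartAt (𝔼 d) r).target, √(chartMatrix g r x).det * inChart r f x := by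
  have hmr : MeasurableSet (chartAt (𝔼 d) r).target := (chartAt (𝔼 d) r).open_target.measurableSet
  -- Both integrands vanish off the overlap, one because of the support of `f`, the other because of
  -- that of the partition function; on the overlap the transition map changes variables. Summing
  -- over `q` then uses that the partition sums to 1.
  have key : ∀ q, ∫ x in (chartAt (𝔼 d) q).target,
      (inChart q (chartPartition d S q) x * √(chartMatrix g q x).det) • inChart q f x =
      ∫ x in (chartAt (𝔼 d) r).target,
        inChart r (chartPartition d S q) x * (√(chartMatrix g r x).det * inChart r f x) := by
    intro q
    have h1 := integral_image_eq_integral_abs_det_fderiv_smul (μ := volume)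
      (isOpen_overlap (d := d) q r).measurableSet
      (f := transition q r) (f' := fderiv ℝ (transition q r)) (fun x hx =>
        (contDiffAt_transition hx.1 hx.2).diff.hasFDerivAt.hasFDerivWithinAt)
      (injOn_transition q r)
      (fun x => inChart r (chartPartition d S q) x * (√(chartMatrix g r x).det * inChart r f x))
    rw [image_transition] at h1
    have h2 : ∫ x in (chartAt (𝔼 d) r).target,
        inChart r (chartPartition d S q) x * (√(chartMatrix g r x).det * inChart r f x) =
        ∫ x in overlap (d := d) r q,
          inChart r (chartPartition d S q) x * (√(chartMatrix g r x).det * inChart r f x) := by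
      refine setIntegral_eq_of_subset_of_forall_sdiff_eq_zero hmr Set.inter_subset_left
        fun x hx => ?_
      have : inChart r (chartPartition d S q) x = 0 := by
        by_contra h
        exact hx.2 ⟨hx.1, tsupport_chartPartition_subset q (subset_tsupport _ h)⟩
      rw [this, zero_mul]
    have h3 : ∫ x in (chartAt (𝔼 d) q).target,
        (inChart q (chartPartition d S q) x * √(chartMatrix g q x).det) • inChart q f x =
        ∫ x in overlap (d := d) q r,
          (inChart q (chartPartition d S q) x * √(chartMatrix g q x).det) • inChart q f x := by
      refine setIntegral_eq_of_subset_of_forall_sdiff_eq_zero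
        (chartAt (𝔼 d) q).open_target.measurableSet Set.inter_subset_left fun x hx => ?_
      have : inChart q f x = 0 := hfC _ fun h => hx.2 ⟨hx.1, hCr h⟩
      rw [this, smul_zero]
    rw [h2, h3, h1]
    refine setIntegral_congr_fun (isOpen_overlap q r).measurableSet fun x hx => ?_
    have e1 : ∀ h : S → ℝ, inChart r h (transition q r x) = inChart q h x := fun h =>
      (inChart_transition hx.1 hx.2 h).eq_of_nhds.symm
    simp only [e1, smul_eq_mul, hT q r x hx]
    ring
  have hcont : ContinuousOn (fun x => √(chartMatrix g r x).det * inChart r f x)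
      (chartAt (𝔼 d) r).target := (hg r).mul (continuousOn_inChart hf r)
  rw [integral_riemannianVolume hg hf, Finset.sum_congr rfl fun q _ => key q,
    ← integral_finsetSum]
  · refine setIntegral_congr_fun hmr fun x _ => ?_
    simp only [← Finset.sum_mul]
    have := sum_chartPartition (d := d) ((chartAt (𝔼 d) r).symm x)
    simp only [inChart_apply] at this ⊢
    rw [this, one_mul]
  · intro q _
    have hCc : IsCompact (chartAt (𝔼 d) r '' C) :=
      hC.isCompact.image_of_continuousOn ((chartAt (𝔼 d) r).continuousOn.mono hCr)
    have hsub : chartAt (𝔼 d) r '' C ⊆ (chartAt (𝔼 d) r).target := by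
      rintro _ ⟨p, hp, rfl⟩
      exact (chartAt (𝔼 d) r).map_source (hCr hp)
    refine IntegrableOn.of_forall_sdiff_eq_zero (s := chartAt (𝔼 d) r '' C)
      (ContinuousOn.integrableOn_compact hCc
        (((continuousOn_inChart_chartPartition q r).mul hcont).mono hsub)) hmr fun x hx => ?_
    have : inChart r f x = 0 := hfC _ fun h => hx.2 ⟨_, h, (chartAt (𝔼 d) r).right_inv hx.1⟩
    rw [this, mul_zero, mul_zero]

end Volume

/-! ### Green's identity -/

section Divergence

variable {d : ℕ}

local notation "𝔼" d:max => EuclideanSpace ℝ (Fin d)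

theorem integral_pd_eq_zero_of_contDiff {W : 𝔼 d → ℝ} (hW : ContDiff ℝ ∞ W)
    (hs : HasCompactSupport W) (i : Fin d) :
    Integrable (pd i W) ∧ ∫ x, pd i W x = 0 := by
  have hc : Continuous (pd i W) :=
    (hW.continuous_fderiv (by simp)).clm_apply continuous_const
  have hcs : HasCompactSupport (pd i W) := hs.fderiv_apply ℝ (stdFrame d i)
  have hint : Integrable (pd i W) := hc.integrable_of_hasCompactSupport hcs
  refine ⟨hint, ?_⟩
  -- Integration by parts against the constant function 1.
  have := integral_mul_fderiv_eq_neg_fderiv_mul_of_integrable (μ := volume) (f := fun _ => (1 : ℝ))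
    (g := W) (v := stdFrame d i) (by simp) (by simp only [one_mul]; exact hint)
    (by simpa using hW.continuous.integrable_of_hasCompactSupport hs) (by fun_prop)
    (fun x _ => (hW.differentiable (by simp)) x)
  simpa [pd] using this

/-- The divergence of a compactly supported field has integral zero. -/
theorem integral_pd_eq_zero {U K : Set (𝔼 d)} (hU : IsOpen U) (hK : IsCompact K) (hKU : K ⊆ U)
    {W : 𝔼 d → ℝ} (hW : ∀ x ∈ U, ContDiffAt ℝ ∞ W x) (h0 : ∀ x ∈ U, x ∉ K → W x = 0) (i : Fin d) :
    IntegrableOn (pd i W) U ∧ ∫ x in U, pd i W x = 0 := by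
  classical
  have hin : ∀ x ∈ U, U.indicator W =ᶠ[𝓝 x] W := fun x hx => by
    filter_upwards [hU.mem_nhds hx] with y hy using Set.indicator_of_mem hy W
  have hzero : ∀ x, x ∉ K → U.indicator W x = 0 := fun x hx => by
    by_cases hxU : x ∈ U
    · rw [Set.indicator_of_mem hxU, h0 x hxU hx]
    · exact Set.indicator_of_notMem hxU W
  have hout : ∀ x, x ∉ K → U.indicator W =ᶠ[𝓝 x] fun _ => 0 := fun x hx => by
    filter_upwards [hK.isClosed.isOpen_compl.mem_nhds hx] with y hy using hzero y hy
  -- The extension by zero is smooth: near a point of `K` it equals `W`, and near a point off the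
  -- closed set `K` it vanishes.
  have hsm : ContDiff ℝ ∞ (U.indicator W) := contDiff_iff_contDiffAt.2 fun x => by
    by_cases hx : x ∈ K
    · exact (hW x (hKU hx)).congr_of_eventuallyEq (hin x (hKU hx))
    · exact contDiffAt_const.congr_of_eventuallyEq (hout x hx)
  obtain ⟨h1, h2⟩ := integral_pd_eq_zero_of_contDiff hsm (HasCompactSupport.intro hK hzero) i
  have heq : Set.EqOn (pd i (U.indicator W)) (pd i W) U := fun x hx => pd_congr (hin x hx) i
  refine ⟨h1.integrableOn.congr_fun heq hU.measurableSet, ?_⟩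
  rw [← setIntegral_congr_fun hU.measurableSet heq, setIntegral_eq_integral_of_forall_compl_eq_zero,
    h2]
  intro x hx
  rw [pd_congr (hout x fun h => hx (hKU h)), pd_const]

end Divergence

/-! ### Green's identity, first for functions supported in one chart -/

section Green

variable {d n : ℕ} {S : Type*} [TopologicalSpace S] [ChartedSpace (EuclideanSpace ℝ (Fin d)) S]

local notation "𝔼" d:max => EuclideanSpace ℝ (Fin d)

theorem laplacian_eq_zero (g : Tensor2 d S) {a : S → ℝ} {p : S} (ha : a =ᶠ[𝓝 p] fun _ => 0) :
    laplacian g a p = 0 := by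
  have h1 : (fun x => a ((chartAt (𝔼 d) p).symm x)) =ᶠ[𝓝 (coords p)] fun _ => 0 := by
    have h2 : Tendsto (chartAt (𝔼 d) p).symm (𝓝 (coords p)) (𝓝 p) := by
      have := (chartAt (𝔼 d) p).continuousAt_symm (coords_mem p)
      rwa [ContinuousAt, coords, (chartAt (𝔼 d) p).left_inv (mem_chart_source _ p)] at this
    exact h2.eventually ha
  rw [laplacian, coordLaplacian_congr EventuallyEq.rfl h1]
  simp [coordLaplacian, pderiv]

namespace IsImmersed

variable [IsManifold (𝓡 d) ∞ S] {k : ℝ} {f ν : S → Minkowski n}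

theorem continuousOn_sqrt_det (H : IsImmersed d k f ν) (q : S) :
    ContinuousOn (fun x => √(chartMatrix (inducedMetric (d := d) f) q x).det)
      (chartAt (𝔼 d) q).target := by
  refine ContinuousOn.congr (f := fun x => √(gram (inChart q f) (inChart q f) x).det)
    (fun x hx => ((H.hypersurface q).contDiffAt_sqrt hx).continuousAt.continuousWithinAt)
    fun x hx => ?_
  simp only [chartMatrix_inducedMetric H.smooth hx]

theorem sqrt_det_transition (H : IsImmersed d k f ν) (q r : S) {x : 𝔼 d}
    (hx : x ∈ overlap (d := d) q r) :
    √(chartMatrix (inducedMetric (d := d) f) q x).det = |(fderiv ℝ (transition q r) x).det| *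
      √(chartMatrix (inducedMetric (d := d) f) r (transition q r x)).det := by
  have hTx : transition q r x ∈ (chartAt (𝔼 d) r).target := (chartAt (𝔼 d) r).map_source hx.2
  rw [chartMatrix_inducedMetric H.smooth hx.1, chartMatrix_inducedMetric H.smooth hTx,
    sqrt_det_of_congruence (H.gram_transition hx.1 hx.2), det_jacobi]

variable [T2Space S] [CompactSpace S] [MeasurableSpace S] [BorelSpace S]

/-- In the chart the integrand times the area density is a coordinate divergence (`green_eq`) of a
field vanishing off a compact set. Only `a` has to be localized, since the field is bilinear in the
1-jets of `a` and `φ`. -/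
theorem green_of_support (H : IsImmersed d k f ν) {a φ : S → ℝ}
    (ha : ContMDiff (𝓡 d) 𝓘(ℝ, ℝ) ∞ a) (hφ : ContMDiff (𝓡 d) 𝓘(ℝ, ℝ) ∞ φ) {r : S} {C : Set S}
    (hC : IsClosed C) (hCr : C ⊆ (chartAt (𝔼 d) r).source) (haC : ∀ p, p ∉ C → a p = 0) :
    ∫ p, (laplacian (inducedMetric (d := d) f) a p * φ p -
      a p * laplacian (inducedMetric (d := d) f) φ p)
      ∂riemannianVolume (inducedMetric (d := d) f) = 0 := by
  have hcont : Continuous fun p => laplacian (inducedMetric (d := d) f) a p * φ p -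
      a p * laplacian (inducedMetric (d := d) f) φ p :=
    ((H.continuous_laplacian ha).mul hφ.continuous).sub
      (ha.continuous.mul (H.continuous_laplacian hφ))
  have hCc : IsCompact (chartAt (𝔼 d) r '' C) :=
    hC.isCompact.image_of_continuousOn ((chartAt (𝔼 d) r).continuousOn.mono hCr)
  have hsub : chartAt (𝔼 d) r '' C ⊆ (chartAt (𝔼 d) r).target := by
    rintro _ ⟨p, hp, rfl⟩
    exact (chartAt (𝔼 d) r).map_source (hCr hp)
  have hopen := (chartAt (𝔼 d) r).open_target
  have hR := H.hypersurface r
  rw [integral_riemannianVolume_of_support H.continuousOn_sqrt_det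
    (fun q r x hx => H.sqrt_det_transition q r hx) hcont hC hCr fun p hp => ?_]
  · have ha' : ∀ x ∈ (chartAt (𝔼 d) r).target, ContDiffAt ℝ ∞ (inChart r a) x :=
      fun x hx => contDiffAt_inChart ha hx
    have hφ' : ∀ x ∈ (chartAt (𝔼 d) r).target, ContDiffAt ℝ ∞ (inChart r φ) x :=
      fun x hx => contDiffAt_inChart hφ hx
    have hdiv := fun i => integral_pd_eq_zero hopen hCc hsub
      (W := fun y => ∑ j, √(gram (inChart r f) (inChart r f) y).det *
        (gram (inChart r f) (inChart r f) y)⁻¹ i j *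
          (inChart r φ y * pd j (inChart r a) y - inChart r a y * pd j (inChart r φ) y))
      (fun x hx => ContDiffAt.sum fun j _ => ((hR.contDiffAt_sqrt hx).mul
        (hR.contDiffAt_inv hx i j)).mul (((hφ' x hx).mul ((ha' x hx).pd j)).sub
          ((ha' x hx).mul ((hφ' x hx).pd j))))
      (fun x hx hxC => by
        have h0 : inChart r a =ᶠ[𝓝 x] fun _ => 0 := by
          filter_upwards [(hopen.inter hCc.isClosed.isOpen_compl).mem_nhds ⟨hx, hxC⟩] with y hy
          exact haC _ fun h => hy.2 ⟨_, h, (chartAt (𝔼 d) r).right_inv hy.1⟩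
        simp only [pd_congr h0, pd_const, h0.eq_of_nhds, mul_zero, zero_mul, sub_zero,
          Finset.sum_const_zero]) i
    rw [setIntegral_congr_fun hopen.measurableSet (g := fun x => ∑ i, pd i (fun y => ∑ j,
        √(gram (inChart r f) (inChart r f) y).det * (gram (inChart r f) (inChart r f) y)⁻¹ i j *
          (inChart r φ y * pd j (inChart r a) y - inChart r a y * pd j (inChart r φ) y)) x)
      fun x hx => ?_, integral_finsetSum _ fun i _ => (hdiv i).1]
    · exact Finset.sum_eq_zero fun i _ => (hdiv i).2
    · have e1 := H.laplacian_inChart ha r hx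
      have e2 := H.laplacian_inChart hφ r hx
      have e3 := hR.green_eq hx (ha' x hx) (hφ' x hx)
      rw [← e1, ← e2] at e3
      simp only [chartMatrix_inducedMetric H.smooth hx]
      exact e3
  · have h0 : a =ᶠ[𝓝 p] fun _ => 0 := by
      filter_upwards [hC.isOpen_compl.mem_nhds hp] with y hy using haC y hy
    rw [laplacian_eq_zero _ h0, haC p hp, zero_mul, zero_mul, sub_zero]

/-- **Green's identity** on a compact manifold. -/
theorem green (H : IsImmersed d k f ν) {a φ : S → ℝ}
    (ha : ContMDiff (𝓡 d) 𝓘(ℝ, ℝ) ∞ a) (hφ : ContMDiff (𝓡 d) 𝓘(ℝ, ℝ) ∞ φ) :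
    ∫ p, (laplacian (inducedMetric (d := d) f) a p * φ p -
      a p * laplacian (inducedMetric (d := d) f) φ p)
      ∂riemannianVolume (inducedMetric (d := d) f) = 0 := by
  have hb : ∀ q : S, ContMDiff (𝓡 d) 𝓘(ℝ, ℝ) ∞ (fun p => chartPartition d S q p * a p) :=
    fun q => (chartPartition d S q).contMDiff.mul ha
  -- Both sides are linear in `a`, so the partition of unity reduces the identity to the case of a
  -- function supported in one chart.
  have hsum : a = fun p => ∑ q ∈ partitionIndices d S, chartPartition d S q p * a p := by
    ext p
    rw [← Finset.sum_mul, sum_chartPartition, one_mul]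
  have e : ∀ p, laplacian (inducedMetric (d := d) f) a p * φ p -
      a p * laplacian (inducedMetric (d := d) f) φ p = ∑ q ∈ partitionIndices d S,
      (laplacian (inducedMetric (d := d) f) (fun p => chartPartition d S q p * a p) p * φ p -
        chartPartition d S q p * a p * laplacian (inducedMetric (d := d) f) φ p) := fun p => by
    conv_lhs => rw [hsum]
    rw [H.laplacian_sum _ fun q _ => hb q, Finset.sum_sub_distrib, Finset.sum_mul, Finset.sum_mul]
  simp only [e]
  rw [integral_finsetSum]
  · refine Finset.sum_eq_zero fun q _ => ?_
    refine H.green_of_support (hb q) hφ (isClosed_tsupport _) (tsupport_chartPartition_subset q)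
      fun p hp => ?_
    rw [image_eq_zero_of_notMem_tsupport hp, zero_mul]
  · intro q _
    exact integrable_riemannianVolume H.continuousOn_sqrt_det
      (((H.continuous_laplacian (hb q)).mul hφ.continuous).sub
        ((hb q).continuous.mul (H.continuous_laplacian hφ)))

end IsImmersed

end Green

/-! ### Differentiation under the integral sign -/

section Parametric

variable {E V : Type*} [NormedAddCommGroup E] [MeasurableSpace E] [OpensMeasurableSpace E]
  {μ : Measure E} [IsFiniteMeasureOnCompacts μ]
  [NormedAddCommGroup V] [NormedSpace ℝ V]

/-- One-sided differentiation under an integral over a compact set. -/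
theorem hasDerivWithinAt_setIntegral {K : Set E} (hK : IsCompact K) {f f' : ℝ → E → V}
    (hf : ∀ t, 0 ≤ t → ContinuousOn (f t) K)
    (hf' : ContinuousOn (fun z : E × ℝ => f' z.2 z.1) (K ×ˢ Set.Ici 0))
    (hd : ∀ x ∈ K, ∀ t, 0 ≤ t → HasDerivWithinAt (fun r => f r x) (f' t x) (Set.Ici 0) t)
    {s : ℝ} (hs : 0 ≤ s) :
    HasDerivWithinAt (fun t => ∫ x in K, f t x ∂μ) (∫ x in K, f' s x ∂μ) (Set.Ici 0) s := by
  have hfin : Fact (μ K < ⊤) := ⟨hK.measure_lt_top⟩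
  have hint : ∀ t, 0 ≤ t → IntegrableOn (f t) K μ := fun t ht =>
    (hf t ht).integrableOn_compact hK
  -- The bound on K × [0, s + 1] dominates the difference quotients: by the mean value inequality,
  -- each quotient between `s` and a point of [0, s + 1] is at most `M`.
  obtain ⟨M, hM⟩ := (hK.prod (isCompact_Icc (a := (0 : ℝ)) (b := s + 1))).exists_bound_of_continuousOn
    (hf'.mono (Set.prod_mono le_rfl Set.Icc_subset_Ici_self))
  rw [hasDerivWithinAt_iff_tendsto_slope]
  have hev : ∀ᶠ t in 𝓝[Set.Ici 0 \ {s}] s, t ∈ Set.Icc 0 (s + 1) ∧ t ≠ s := by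
    have h1 : ∀ᶠ t in 𝓝[Set.Ici 0 \ {s}] s, t < s + 1 :=
      nhdsWithin_le_nhds (Iio_mem_nhds (by linarith))
    filter_upwards [h1, self_mem_nhdsWithin] with t ht1 ht2
    exact ⟨⟨ht2.1, ht1.le⟩, ht2.2⟩
  have hslope : (fun t => ∫ x in K, slope (fun r => f r x) s t ∂μ) =ᶠ[𝓝[Set.Ici 0 \ {s}] s]
      slope (fun t => ∫ x in K, f t x ∂μ) s := by
    filter_upwards [hev] with t ht
    simp only [slope, vsub_eq_sub]
    rw [integral_smul, integral_sub (hint t ht.1.1) (hint s hs)]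
  refine Tendsto.congr' hslope (tendsto_integral_filter_of_dominated_convergence (fun _ => M)
    ?_ ?_ ?_ ?_)
  · filter_upwards [hev] with t ht
    simp only [slope, vsub_eq_sub]
    exact ((hint t ht.1.1).aestronglyMeasurable.sub
      (hint s hs).aestronglyMeasurable).const_smul _
  · filter_upwards [hev] with t ht
    refine (ae_restrict_iff' hK.measurableSet).2 (Eventually.of_forall fun x hx => ?_)
    have h1 := (convex_Icc (0 : ℝ) (s + 1)).norm_image_sub_le_of_norm_hasDerivWithin_le
      (f := fun r => f r x) (f' := fun r => f' r x) (C := M)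
      (fun r hr => (hd x hx r hr.1).mono Set.Icc_subset_Ici_self)
      (fun r hr => hM (x, r) ⟨hx, hr⟩) (x := s) (y := t) ⟨hs, by linarith⟩ ht.1
    have h2 : 0 < ‖t - s‖ := norm_pos_iff.2 (sub_ne_zero.2 ht.2)
    rw [slope, vsub_eq_sub, norm_smul, norm_inv, inv_mul_le_iff₀ h2, mul_comm]
    exact h1
  · exact integrable_const _
  · refine (ae_restrict_iff' hK.measurableSet).2 (Eventually.of_forall fun x hx => ?_)
    exact hasDerivWithinAt_iff_tendsto_slope.1 (hd x hx s hs)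

end Parametric

/-! ### Regularity of functions on `S × [0, ∞)` -/

section HalfSpace

variable {d : ℕ} {S : Type*} [TopologicalSpace S] [ChartedSpace (EuclideanSpace ℝ (Fin d)) S]

local notation "𝔼" d:max => EuclideanSpace ℝ (Fin d)

variable {u : S → ℝ → ℝ}

theorem contMDiff_slice (hu : ContMDiffOn ((𝓡 d).prod 𝓘(ℝ, ℝ)) 𝓘(ℝ, ℝ) ∞
      (fun z : S × ℝ => u z.1 z.2) (Set.univ ×ˢ Set.Ici 0)) {s : ℝ} (hs : 0 ≤ s) :
    ContMDiff (𝓡 d) 𝓘(ℝ, ℝ) ∞ (fun p => u p s) := by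
  have h1 : ContMDiff (𝓡 d) ((𝓡 d).prod 𝓘(ℝ, ℝ)) ∞ (fun p : S => (p, s)) :=
    contMDiff_id.prodMk contMDiff_const
  exact hu.comp_contMDiff h1 fun p => ⟨Set.mem_univ p, hs⟩

theorem uniqueDiffOn_target_prod (q : S) :
    UniqueDiffOn ℝ ((chartAt (𝔼 d) q).target ×ˢ Set.Ici (0 : ℝ)) :=
  (chartAt (𝔼 d) q).open_target.uniqueDiffOn.prod (uniqueDiffOn_Ici 0)

variable [IsManifold (𝓡 d) ∞ S]

theorem contDiffOn_inChart (hu : ContMDiffOn ((𝓡 d).prod 𝓘(ℝ, ℝ)) 𝓘(ℝ, ℝ) ∞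
      (fun z : S × ℝ => u z.1 z.2) (Set.univ ×ˢ Set.Ici 0)) (q : S) :
    ContDiffOn ℝ ∞ (fun z : 𝔼 d × ℝ => inChart q u z.1 z.2)
      ((chartAt (𝔼 d) q).target ×ˢ Set.Ici 0) := by
  have h1 := (contMDiffOn_chart_symm (I := 𝓡 d) (n := ∞) (x := q)).prodMap
    (contMDiffOn_id (I := 𝓘(ℝ, ℝ)) (n := ∞) (s := Set.Ici (0 : ℝ)))
  have h2 := hu.comp h1 fun z hz => ⟨Set.mem_univ _, hz.2⟩
  -- The statement on the vector space E × ℝ has to be read with the product model and the product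
  -- charts.
  rw [← contMDiffOn_iff_contDiffOn, modelWithCornersSelf_prod, ← chartedSpaceSelf_prod]
  exact h2

/-- Expressing the one-sided ρ-derivative through the full derivative on the half space yields its
joint continuity up to ρ = 0. -/
theorem hasDerivWithinAt_inChart_fderivWithin (hu : ContMDiffOn ((𝓡 d).prod 𝓘(ℝ, ℝ)) 𝓘(ℝ, ℝ) ∞
      (fun z : S × ℝ => u z.1 z.2) (Set.univ ×ˢ Set.Ici 0)) (q : S) {x : 𝔼 d}
    (hx : x ∈ (chartAt (𝔼 d) q).target) {s : ℝ} (hs : 0 ≤ s) :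
    HasDerivWithinAt (inChart q u x)
      (fderivWithin ℝ (fun z : 𝔼 d × ℝ => inChart q u z.1 z.2)
        ((chartAt (𝔼 d) q).target ×ˢ Set.Ici 0) (x, s) (0, 1)) (Set.Ici 0) s := by
  have h1 := ((contDiffOn_inChart hu q).differentiableOn (by simp) (x, s)
    ⟨hx, hs⟩).hasFDerivWithinAt
  have h2 : HasDerivWithinAt (fun t : ℝ => ((x, t) : 𝔼 d × ℝ)) ((0 : 𝔼 d), (1 : ℝ)) (Set.Ici 0) s :=
    (hasDerivWithinAt_const s _ x).prodMk (hasDerivWithinAt_id s _)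
  exact h1.comp_hasDerivWithinAt s h2 fun t ht => ⟨hx, ht⟩

theorem hasDerivWithinAt_inChart (hu : ContMDiffOn ((𝓡 d).prod 𝓘(ℝ, ℝ)) 𝓘(ℝ, ℝ) ∞
      (fun z : S × ℝ => u z.1 z.2) (Set.univ ×ˢ Set.Ici 0)) (q : S) {x : 𝔼 d}
    (hx : x ∈ (chartAt (𝔼 d) q).target) {s : ℝ} (hs : 0 ≤ s) :
    HasDerivWithinAt (inChart q u x) (derivWithin (inChart q u x) (Set.Ici 0) s) (Set.Ici 0) s :=
  (hasDerivWithinAt_inChart_fderivWithin hu q hx hs).differentiableWithinAt.hasDerivWithinAt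

theorem continuousOn_derivWithin_inChart (hu : ContMDiffOn ((𝓡 d).prod 𝓘(ℝ, ℝ)) 𝓘(ℝ, ℝ) ∞
      (fun z : S × ℝ => u z.1 z.2) (Set.univ ×ˢ Set.Ici 0)) (q : S) :
    ContinuousOn (fun z : 𝔼 d × ℝ => derivWithin (inChart q u z.1) (Set.Ici 0) z.2)
      ((chartAt (𝔼 d) q).target ×ˢ Set.Ici 0) := by
  have h1 := (contDiffOn_inChart hu q).continuousOn_fderivWithin (uniqueDiffOn_target_prod q)
    (by simp)
  refine (h1.clm_apply (continuousOn_const (c := ((0 : 𝔼 d), (1 : ℝ))))).congr fun z hz => ?_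
  exact (hasDerivWithinAt_inChart_fderivWithin hu q hz.1 hz.2).derivWithin (uniqueDiffOn_Ici 0 _ hz.2)

theorem continuous_derivWithin_slice (hu : ContMDiffOn ((𝓡 d).prod 𝓘(ℝ, ℝ)) 𝓘(ℝ, ℝ) ∞
      (fun z : S × ℝ => u z.1 z.2) (Set.univ ×ˢ Set.Ici 0)) {s : ℝ} (hs : 0 ≤ s) :
    Continuous fun p => derivWithin (u p) (Set.Ici 0) s := by
  refine continuous_of_inChart (d := d) fun q => ?_
  exact (continuousOn_derivWithin_inChart hu q).comp (f := fun x => (x, s))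
    (by fun_prop) fun x hx => ⟨hx, hs⟩

end HalfSpace

/-! ### The derivative of the integral -/

section Monotonicity

variable {n : ℕ} {S : Type*} [TopologicalSpace S] [ChartedSpace (EuclideanSpace ℝ (Fin (n - 1))) S]

local notation "𝔼" d:max => EuclideanSpace ℝ (Fin d)

/-- Green's identity is used for u - 1, while the evolution equation contains Δu. -/
theorem laplacian_sub_const {d : ℕ} {S : Type*} [TopologicalSpace S]
    [ChartedSpace (EuclideanSpace ℝ (Fin d)) S] (g : Tensor2 d S) (a : S → ℝ) (c : ℝ) (p : S) :
    laplacian g (fun q => a q - c) p = laplacian g a p := by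
  simp only [laplacian, coordLaplacian, pderiv, fderiv_sub_const]

/-- The derivative in `s` of `(H₀ - H) X` times the area element, divided by the area element. -/
def variationField (k : ℝ) (F N : S → Minkowski n) (u : S → ℝ → ℝ) (s : ℝ) (p : S) : Minkowski n :=
  (leafH₀ k F N p s * (leafH₀ k F N p s - (u p s)⁻¹ * leafH₀ k F N p s) +
    (((n - 1 : ℕ) * k ^ 2 - sqNormSecondFundamentalForm (n - 1) (fun p => equidistant k F N p s)
      (fun p => equidistantNormal k F N p s) p) * (1 - (u p s)⁻¹) +
    leafH₀ k F N p s * (derivWithin (u p) (Set.Ici 0) s / u p s ^ 2))) • equidistant k F N p s +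
  (leafH₀ k F N p s - (u p s)⁻¹ * leafH₀ k F N p s) • equidistantNormal k F N p s

/-- The integrand on the right-hand side of the monotonicity formula. -/
def dissipationField (k : ℝ) (F N : S → Minkowski n) (u : S → ℝ → ℝ) (s : ℝ) (p : S) :
    Minkowski n :=
  ((u p s)⁻¹ * (u p s - 1) ^ 2) •
    ((leafScalar k F N p s + (n - 1) * (n - 2) * k ^ 2) • ((1 / 2 : ℝ) • equidistant k F N p s) +
      leafH₀ k F N p s • velocity k F N p s)

variable [IsManifold (𝓡 (n - 1)) ∞ S]
variable {k : ℝ} {F N : S → Minkowski n} {u : S → ℝ → ℝ}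

/-- The evolution equation turns the variation of the integrand into the dissipation term and a
term that Green's identity integrates to zero. -/
theorem variationField_eq (hn : 1 ≤ n) (hk : k ≠ 0) {s : ℝ} (hs : 0 ≤ s)
    (H : IsImmersed (n - 1) k (fun p => equidistant k F N p s)
      (fun p => equidistantNormal k F N p s)) (hu : IsQuasiSphericalSolution k F N u) (p : S) :
    variationField k F N u s p = -dissipationField k F N u s p +
      (laplacian (leafMetric k F N s) (fun q => u q s - 1) p • equidistant k F N p s -
        (u p s - 1) • (((n - 1 : ℕ) * k ^ 2) • equidistant k F N p s -
          leafH₀ k F N p s • equidistantNormal k F N p s)) := by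
  have hpos := hu.pos p s hs
  have hpde := hu.pde p s hs
  have hR := leafScalar_eq hn hk H p
  rw [variationField, dissipationField, laplacian_sub_const, velocity_eq hk]
  -- The Gauss equation removes |A|²; after that the identity is algebra in the values at one point.
  have hA : sqNormSecondFundamentalForm (n - 1) (fun p => equidistant k F N p s)
      (fun p => equidistantNormal k F N p s) p =
      -((n - 1) * (n - 2) * k ^ 2) + leafH₀ k F N p s ^ 2 - leafScalar k F N p s := by linarith
  rw [hA]
  have hcast : ((n - 1 : ℕ) : ℝ) = n - 1 := by push_cast [hn]; ring
  rw [hcast]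
  generalize laplacian (leafMetric k F N s) (fun q => u q s) p = Λ at *
  generalize leafScalar k F N p s = R at *
  generalize leafH₀ k F N p s = h at *
  generalize derivWithin (u p) (Set.Ici 0) s = w' at *
  generalize u p s = w at *
  generalize equidistant k F N p s = X
  generalize equidistantNormal k F N p s = Y
  have hw : w ≠ 0 := hpos.ne'
  -- The evolution equation divided by 2u².
  have h1 : h * (w' / w ^ 2) = Λ + (w⁻¹ - w) / 2 * (R + n * (n - 1) * k ^ 2) := by
    field_simp
    linarith
  rw [h1]
  -- Comparison of the coefficients of X here, and of ν in `h3`, where 1 - 1/u = (u-1) - (u-1)²/u.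
  have h2 : h * (h - w⁻¹ * h) + (((n - 1) * k ^ 2 -
      (-((n - 1) * (n - 2) * k ^ 2) + h ^ 2 - R)) * (1 - w⁻¹) +
      (Λ + (w⁻¹ - w) / 2 * (R + n * (n - 1) * k ^ 2))) =
      -(w⁻¹ * (w - 1) ^ 2 * ((R + (n - 1) * (n - 2) * k ^ 2) * (1 / 2))) + Λ -
        (w - 1) * ((n - 1) * k ^ 2) := by
    field_simp
    ring
  have h3 : h - w⁻¹ * h = -(w⁻¹ * (w - 1) ^ 2 * h) + (w - 1) * h := by
    field_simp
    ring
  rw [h2, h3]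
  module

theorem continuous_dissipationField (hn : 1 ≤ n) (hk : k ≠ 0) {s : ℝ} (hs : 0 ≤ s)
    (H : IsImmersed (n - 1) k (fun p => equidistant k F N p s)
      (fun p => equidistantNormal k F N p s)) (hu : IsQuasiSphericalSolution k F N u) :
    Continuous (dissipationField k F N u s) := by
  have h1 : Continuous fun p => u p s := (contMDiff_slice hu.smooth hs).continuous
  have h2 : Continuous fun p => leafH₀ k F N p s := by
    simp only [leafH₀_eq hk]; exact H.continuous_meanCurvature
  have h3 : Continuous fun p => leafScalar k F N p s := by
    simp only [leafScalar_eq hn hk H]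
    exact (continuous_const.add (h2.pow 2)).sub H.continuous_sqNorm
  have h4 : Continuous fun p => velocity k F N p s := by
    simp only [velocity_eq hk]; exact H.smooth_normal.continuous
  have h5 := H.smooth.continuous
  have h6 : Continuous fun p => (u p s)⁻¹ := h1.inv₀ fun p => (hu.pos p s hs).ne'
  unfold dissipationField
  fun_prop

theorem continuous_variationField (hk : k ≠ 0) {s : ℝ} (hs : 0 ≤ s)
    (H : IsImmersed (n - 1) k (fun p => equidistant k F N p s)
      (fun p => equidistantNormal k F N p s)) (hu : IsQuasiSphericalSolution k F N u) :
    Continuous (variationField k F N u s) := by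
  have h1 : Continuous fun p => u p s := (contMDiff_slice hu.smooth hs).continuous
  have h2 : Continuous fun p => leafH₀ k F N p s := by
    simp only [leafH₀_eq hk]; exact H.continuous_meanCurvature
  have h3 := H.continuous_sqNorm
  have h4 := H.smooth_normal.continuous
  have h5 := H.smooth.continuous
  have h6 : Continuous fun p => (u p s)⁻¹ := h1.inv₀ fun p => (hu.pos p s hs).ne'
  have h7 := continuous_derivWithin_slice hu.smooth hs
  have h8 : Continuous fun p => derivWithin (u p) (Set.Ici 0) s / u p s ^ 2 :=
    h7.div (h1.pow 2) fun p => pow_ne_zero _ (hu.pos p s hs).ne'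
  unfold variationField
  fun_prop

theorem continuous_integrand (hk : k ≠ 0) (hF : ContMDiff (𝓡 (n - 1)) 𝓘(ℝ, Minkowski n) ∞ F)
    (hN : ContMDiff (𝓡 (n - 1)) 𝓘(ℝ, Minkowski n) ∞ N) {s : ℝ} (hs : 0 ≤ s)
    (H : IsImmersed (n - 1) k (fun p => equidistant k F N p s)
      (fun p => equidistantNormal k F N p s)) (hu : IsQuasiSphericalSolution k F N u) :
    Continuous fun p => (leafH₀ k F N p s - leafH k F N u p s) • equidistant k F N p s := by
  have h1 : Continuous fun p => u p s := (contMDiff_slice hu.smooth hs).continuous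
  have h2 : Continuous fun p => leafH₀ k F N p s := by
    simp only [leafH₀_eq hk]; exact H.continuous_meanCurvature
  have h5 := H.smooth.continuous
  have h6 : Continuous fun p => (u p s)⁻¹ := h1.inv₀ fun p => (hu.pos p s hs).ne'
  have h7 : (fun p => leafH k F N u p s) = fun p => (u p s)⁻¹ * leafH₀ k F N p s :=
    funext fun p => leafH_eq hk hF hN H (hu.pos p s hs).ne'
  have h8 : Continuous fun p => leafH k F N u p s := by rw [h7]; exact h6.mul h2
  fun_prop

variable [T2Space S] [CompactSpace S]

/-- In the chart at `q`, the integrand is differentiable under the integral sign. -/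
theorem hasDerivWithinAt_chart_integral (hn : 1 ≤ n) (hk : k ≠ 0)
    (hF : ContMDiff (𝓡 (n - 1)) 𝓘(ℝ, Minkowski n) ∞ F)
    (hN : ContMDiff (𝓡 (n - 1)) 𝓘(ℝ, Minkowski n) ∞ N)
    (H : ∀ s, 0 ≤ s → IsImmersed (n - 1) k (fun p => equidistant k F N p s)
      (fun p => equidistantNormal k F N p s)) (hu : IsQuasiSphericalSolution k F N u) {s : ℝ}
    (hs : 0 ≤ s) (q : S) :
    HasDerivWithinAt
      (fun t => ∫ x in partitionSupport (d := n - 1) q, (inChart q (chartPartition (n - 1) S q) x *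
        √(chartMatrix (leafMetric k F N t) q x).det) •
          inChart q (fun p => (leafH₀ k F N p t - leafH k F N u p t) • equidistant k F N p t) x)
      (∫ x in partitionSupport (d := n - 1) q, (inChart q (chartPartition (n - 1) S q) x *
        √(chartMatrix (leafMetric k F N s) q x).det) • inChart q (variationField k F N u s) x)
      (Set.Ici 0) s := by
  have hopen := (chartAt (𝔼 (n - 1)) q).open_target
  have hsub := partitionSupport_subset (d := n - 1) q
  have hf : ∀ y ∈ (chartAt (𝔼 (n - 1)) q).target, ContDiffAt ℝ ∞ (inChart q F) y :=
    fun y hy => contDiffAt_inChart hF hy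
  have hν : ∀ y ∈ (chartAt (𝔼 (n - 1)) q).target, ContDiffAt ℝ ∞ (inChart q N) y :=
    fun y hy => contDiffAt_inChart hN hy
  let X : ℝ → 𝔼 (n - 1) → Minkowski n := fun t y => equidistant k (inChart q F) (inChart q N) y t
  let Y : ℝ → 𝔼 (n - 1) → Minkowski n :=
    fun t y => equidistantNormal k (inChart q F) (inChart q N) y t
  have hdet : ∀ t, 0 ≤ t → ∀ x ∈ (chartAt (𝔼 (n - 1)) q).target, (gram (X t) (X t) x).det ≠ 0 :=
    fun t ht x hx => (((H t ht).hypersurface q).det_pos hx).ne'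
  have hG : ∀ t, 0 ≤ t → ∀ x ∈ (chartAt (𝔼 (n - 1)) q).target,
      chartMatrix (leafMetric k F N t) q x = gram (X t) (X t) x :=
    fun t ht x hx => chartMatrix_inducedMetric (H t ht).smooth hx
  have hh : ∀ t, 0 ≤ t → ∀ x ∈ (chartAt (𝔼 (n - 1)) q).target,
      leafH₀ k F N ((chartAt (𝔼 (n - 1)) q).symm x) t = (shape (X t) (Y t) x).trace :=
    fun t ht x hx => (leafH₀_eq hk _ _).trans ((H t ht).meanCurvature_inChart q hx)
  have hb : ∀ t, 0 ≤ t → ∀ x ∈ (chartAt (𝔼 (n - 1)) q).target,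
      sqNormSecondFundamentalForm (n - 1) (fun p => equidistant k F N p t)
        (fun p => equidistantNormal k F N p t) ((chartAt (𝔼 (n - 1)) q).symm x) =
        (shape (X t) (Y t) x * shape (X t) (Y t) x).trace :=
    fun t ht x hx => (H t ht).sqNorm_inChart q hx
  have hpos : ∀ t, 0 ≤ t → ∀ x, 0 < inChart (d := n - 1) q u x t := fun t ht x => hu.pos _ t ht
  have hleaf : ∀ t, 0 ≤ t → ∀ x ∈ (chartAt (𝔼 (n - 1)) q).target,
      leafH k F N u ((chartAt (𝔼 (n - 1)) q).symm x) t =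
        (inChart q u x t)⁻¹ * (shape (X t) (Y t) x).trace := fun t ht x hx => by
    rw [leafH_eq hk hF hN (H t ht) (hu.pos _ t ht).ne', hh t ht x hx]
    rfl
  have hI : ∀ t, 0 ≤ t → ∀ x ∈ (chartAt (𝔼 (n - 1)) q).target,
      (inChart q (chartPartition (n - 1) S q) x * √(chartMatrix (leafMetric k F N t) q x).det) •
        inChart q (fun p => (leafH₀ k F N p t - leafH k F N u p t) • equidistant k F N p t) x =
      (inChart q (chartPartition (n - 1) S q) x * √(gram (X t) (X t) x).det) •
        (((shape (X t) (Y t) x).trace - (inChart q u x t)⁻¹ * (shape (X t) (Y t) x).trace) •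
          X t x) := fun t ht x hx => by
    rw [hG t ht x hx, inChart_apply q (fun p => _ • _), hh t ht x hx, hleaf t ht x hx]
    rfl
  have hV : ∀ t, 0 ≤ t → ∀ x ∈ (chartAt (𝔼 (n - 1)) q).target,
      inChart q (variationField k F N u t) x =
      ((shape (X t) (Y t) x).trace * ((shape (X t) (Y t) x).trace -
          (inChart q u x t)⁻¹ * (shape (X t) (Y t) x).trace) +
        (((n - 1 : ℕ) * k ^ 2 - (shape (X t) (Y t) x * shape (X t) (Y t) x).trace) *
          (1 - (inChart q u x t)⁻¹) + (shape (X t) (Y t) x).trace *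
            (derivWithin (inChart q u x) (Set.Ici 0) t / inChart q u x t ^ 2))) • X t x +
      ((shape (X t) (Y t) x).trace - (inChart q u x t)⁻¹ * (shape (X t) (Y t) x).trace) • Y t x :=
    fun t ht x hx => by
      rw [inChart_apply, variationField, hh t ht x hx, hb t ht x hx]
      rfl
  refine hasDerivWithinAt_setIntegral (isCompact_partitionSupport q) (f := fun t x =>
    (inChart q (chartPartition (n - 1) S q) x * √(chartMatrix (leafMetric k F N t) q x).det) •
      inChart q (fun p => (leafH₀ k F N p t - leafH k F N u p t) • equidistant k F N p t) x)
    (f' := fun t x => (inChart q (chartPartition (n - 1) S q) x *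
        √(chartMatrix (leafMetric k F N t) q x).det) • inChart q (variationField k F N u t) x)
    (fun t ht => ?_) ?_ (fun x hx t ht => ?_) hs
  · exact (((continuousOn_inChart_chartPartition q q).mul ((H t ht).continuousOn_sqrt_det q)).smul
      (continuousOn_inChart (continuous_integrand hk hF hN ht (H t ht) hu) q)).mono hsub
  -- Joint continuity of each factor of the derivative on target × [0, ∞); the determinant of the
  -- metric is nonzero there, which makes the inverse metric regular.
  · have c1 : ContinuousOn (fun z : 𝔼 (n - 1) × ℝ => inChart q (chartPartition (n - 1) S q) z.1)
        ((chartAt (𝔼 (n - 1)) q).target ×ˢ Set.Ici 0) :=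
      (continuousOn_inChart_chartPartition q q).comp continuousOn_fst fun z hz => hz.1
    have c2 : ContinuousOn (fun z : 𝔼 (n - 1) × ℝ => √(gram (X z.2) (X z.2) z.1).det)
        ((chartAt (𝔼 (n - 1)) q).target ×ˢ Set.Ici 0) := fun z hz =>
      (contDiffAt_sqrt_det_equidistant hopen hf hν (hdet z.2 hz.2 z.1 hz.1)
        hz.1).continuousAt.continuousWithinAt
    have c3 : ContinuousOn (fun z : 𝔼 (n - 1) × ℝ => (shape (X z.2) (Y z.2) z.1).trace)
        ((chartAt (𝔼 (n - 1)) q).target ×ˢ Set.Ici 0) := fun z hz =>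
      (contDiffAt_trace_shape_equidistant hopen hf hν (hdet z.2 hz.2 z.1 hz.1)
        hz.1).continuousAt.continuousWithinAt
    have c4 : ContinuousOn (fun z : 𝔼 (n - 1) × ℝ =>
        (shape (X z.2) (Y z.2) z.1 * shape (X z.2) (Y z.2) z.1).trace)
        ((chartAt (𝔼 (n - 1)) q).target ×ˢ Set.Ici 0) := fun z hz =>
      (contDiffAt_trace_shape_sq_equidistant hopen hf hν (hdet z.2 hz.2 z.1 hz.1)
        hz.1).continuousAt.continuousWithinAt
    have c5 : ContinuousOn (fun z : 𝔼 (n - 1) × ℝ => X z.2 z.1)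
        ((chartAt (𝔼 (n - 1)) q).target ×ˢ Set.Ici 0) := fun z hz =>
      (contDiffAt_equidistant_uncurry (F := fun y (_ : Unit) => inChart q F y)
        (N := fun y (_ : Unit) => inChart q N y) (i := ()) (hf z.1 hz.1) (hν z.1 hz.1)
        z.2).continuousAt.continuousWithinAt
    have c6 : ContinuousOn (fun z : 𝔼 (n - 1) × ℝ => Y z.2 z.1)
        ((chartAt (𝔼 (n - 1)) q).target ×ˢ Set.Ici 0) := fun z hz =>
      (contDiffAt_equidistantNormal_uncurry (F := fun y (_ : Unit) => inChart q F y)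
        (N := fun y (_ : Unit) => inChart q N y) (i := ()) (hf z.1 hz.1) (hν z.1 hz.1)
        z.2).continuousAt.continuousWithinAt
    have c7 := (contDiffOn_inChart hu.smooth q).continuousOn
    have c8 : ContinuousOn (fun z : 𝔼 (n - 1) × ℝ => (inChart q u z.1 z.2)⁻¹)
        ((chartAt (𝔼 (n - 1)) q).target ×ˢ Set.Ici 0) :=
      c7.inv₀ fun z hz => (hpos z.2 hz.2 z.1).ne'
    have c9 : ContinuousOn (fun z : 𝔼 (n - 1) × ℝ =>
        derivWithin (inChart q u z.1) (Set.Ici 0) z.2 / inChart q u z.1 z.2 ^ 2)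
        ((chartAt (𝔼 (n - 1)) q).target ×ˢ Set.Ici 0) :=
      (continuousOn_derivWithin_inChart hu.smooth q).div (c7.pow 2)
        fun z hz => pow_ne_zero _ (hpos z.2 hz.2 z.1).ne'
    refine ContinuousOn.mono ?_ (Set.prod_mono hsub le_rfl)
    refine ((c1.mul c2).smul ((((c3.mul (c3.sub (c8.mul c3))).add
      ((((continuousOn_const (c := ((n - 1 : ℕ) : ℝ) * k ^ 2)).sub c4).mul
        ((continuousOn_const (c := (1 : ℝ))).sub c8)).add (c3.mul c9))).smul c5).add ((c3.sub (c8.mul c3)).smul c6))).congr fun z hz => ?_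
    simp only [hG z.2 hz.2 z.1 hz.1, hV z.2 hz.2 z.1 hz.1]
    rfl
  · have hxt := hsub hx
    have hH := (H t ht).hypersurface q
    have d1 : HasDerivWithinAt (fun r => √(gram (X r) (X r) x).det)
        ((shape (X t) (Y t) x).trace * √(gram (X t) (X t) x).det) (Set.Ici 0) t :=
      (hasDerivAt_sqrt_det_equidistant hH hxt (hf x hxt).diff (hν x hxt).diff hk).hasDerivWithinAt
    have d2 : HasDerivWithinAt (fun r => (shape (X r) (Y r) x).trace)
        ((n - 1 : ℕ) * k ^ 2 - (shape (X t) (Y t) x * shape (X t) (Y t) x).trace) (Set.Ici 0) t :=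
      (hasDerivAt_trace_shape_equidistant hH hxt (hf x hxt).diff (hν x hxt).diff hk
        (by omega)).hasDerivWithinAt
    have d3 : HasDerivWithinAt (fun r => X r x) (Y t x) (Set.Ici 0) t :=
      (hasDerivAt_equidistant hk _ _ x t).hasDerivWithinAt
    have d4 := (hasDerivWithinAt_inChart hu.smooth q hxt ht).inv (hpos t ht x).ne'
    -- Product rule for χ √det g · (H₀ - H₀/u) X; factoring out the density χ √det g leaves
    -- `variationField`.
    have d5 := ((d1.const_mul (inChart q (chartPartition (n - 1) S q) x)).smul
      ((d2.sub (d4.mul d2)).smul d3))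
    refine (d5.congr_deriv ?_).congr (fun r hr => hI r hr x hxt) (hI t ht x hxt)
    rw [hG t ht x hxt, hV t ht x hxt]
    simp only [Pi.sub_apply, Pi.mul_apply, Pi.smul_apply', Pi.inv_apply]
    module

variable [MeasurableSpace S] [BorelSpace S]

theorem hasDerivWithinAt_integral_leaf (hn : 1 ≤ n) (hk : k ≠ 0)
    (hF : ContMDiff (𝓡 (n - 1)) 𝓘(ℝ, Minkowski n) ∞ F)
    (hN : ContMDiff (𝓡 (n - 1)) 𝓘(ℝ, Minkowski n) ∞ N)
    (H : ∀ s, 0 ≤ s → IsImmersed (n - 1) k (fun p => equidistant k F N p s)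
      (fun p => equidistantNormal k F N p s)) (hu : IsQuasiSphericalSolution k F N u) {s : ℝ}
    (hs : 0 ≤ s) :
    HasDerivWithinAt
      (fun t => ∫ p, (leafH₀ k F N p t - leafH k F N u p t) • equidistant k F N p t
        ∂riemannianVolume (leafMetric k F N t))
      (∫ p, variationField k F N u s p ∂riemannianVolume (leafMetric k F N s)) (Set.Ici 0) s := by
  have e : ∀ t, 0 ≤ t → ∀ {f : S → Minkowski n}, Continuous f →
      ∫ p, f p ∂riemannianVolume (leafMetric k F N t) = ∑ q ∈ partitionIndices (n - 1) S,
        ∫ x in partitionSupport (d := n - 1) q, (inChart q (chartPartition (n - 1) S q) x *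
          √(chartMatrix (leafMetric k F N t) q x).det) • inChart q f x := fun t ht f hf =>
    integral_riemannianVolume_partitionSupport (H t ht).continuousOn_sqrt_det hf
  rw [e s hs (continuous_variationField hk hs (H s hs) hu)]
  exact (HasDerivWithinAt.fun_sum fun q _ =>
    hasDerivWithinAt_chart_integral hn hk hF hN H hu hs q).congr
    (fun t ht => e t ht (continuous_integrand hk hF hN ht (H t ht) hu))
    (e s hs (continuous_integrand hk hF hN hs (H s hs) hu))

theorem integral_variationField (hn : 1 ≤ n) (hk : k ≠ 0) {s : ℝ} (hs : 0 ≤ s)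
    (H : IsImmersed (n - 1) k (fun p => equidistant k F N p s)
      (fun p => equidistantNormal k F N p s)) (hu : IsQuasiSphericalSolution k F N u) :
    ∫ p, variationField k F N u s p ∂riemannianVolume (leafMetric k F N s) =
      -∫ p, dissipationField k F N u s p ∂riemannianVolume (leafMetric k F N s) := by
  have hint : ∀ {f : S → Minkowski n}, Continuous f →
      Integrable f (riemannianVolume (leafMetric k F N s)) := fun hf =>
    integrable_riemannianVolume H.continuousOn_sqrt_det hf
  have hv := contMDiff_slice hu.smooth hs
  have ha : ContMDiff (𝓡 (n - 1)) 𝓘(ℝ, ℝ) ∞ (fun p => u p s - 1) := hv.sub contMDiff_const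
  have h0 : Continuous fun p => leafH₀ k F N p s := by
    simp only [leafH₀_eq hk]; exact H.continuous_meanCurvature
  have hlap : Continuous (laplacian (leafMetric k F N s) fun q => u q s - 1) :=
    H.continuous_laplacian ha
  have hX := H.smooth.continuous
  have hY := H.smooth_normal.continuous
  have hcG : Continuous fun p =>
      laplacian (leafMetric k F N s) (fun q => u q s - 1) p • equidistant k F N p s -
        (u p s - 1) • (((n - 1 : ℕ) * k ^ 2) • equidistant k F N p s -
          leafH₀ k F N p s • equidistantNormal k F N p s) :=
    (hlap.smul hX).sub (ha.continuous.smul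
      ((hX.const_smul (((n - 1 : ℕ) : ℝ) * k ^ 2)).sub (h0.smul hY)))
  have hD : Integrable (fun p => -dissipationField k F N u s p)
      (riemannianVolume (leafMetric k F N s)) :=
    (hint (continuous_dissipationField hn hk hs H hu)).neg
  simp only [variationField_eq hn hk hs H hu]
  rw [integral_add hD (hint hcG), integral_neg, add_eq_left]
  -- A vector integral vanishes if all its linear functionals do; for each `L`, Green's identity is
  -- applied to u - 1 and L ∘ X.
  refine (SeparatingDual.eq_zero_iff_forall_dual_eq_zero (R := ℝ) _).2 fun L => ?_
  rw [← L.integral_comp_comm (hint hcG)]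
  have hφ : ContMDiff (𝓡 (n - 1)) 𝓘(ℝ, ℝ) ∞ (fun p => L (equidistant k F N p s)) :=
    L.contMDiff.comp H.smooth
  rw [← H.green ha hφ]
  refine integral_congr_ae (Eventually.of_forall fun p => ?_)
  simp only [map_sub, map_smul, smul_eq_mul, H.laplacian_clm hk (by omega) L p, leafH₀_eq hk]
  rfl

end Monotonicity

end QuasiSpherical

end

theorem lemma2p5 (n : ℕ) (hn : 3 ≤ n) (k : ℝ) (hk : 0 < k)
    (S : Type*) [TopologicalSpace S] [T2Space S] [CompactSpace S] [ConnectedSpace S]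
    [ChartedSpace (EuclideanSpace ℝ (Fin (n - 1))) S] [IsManifold (𝓡 (n - 1)) ∞ S]
    [MeasurableSpace S] [BorelSpace S]
    (F N : S → QuasiSpherical.Minkowski n) (Ω₀ : Set (QuasiSpherical.Minkowski n))
    (hF : QuasiSpherical.IsOutwardEmbedding k F N Ω₀)
    (hK : QuasiSpherical.SectionalCurvatureGT
      (QuasiSpherical.inducedMetric F : QuasiSpherical.Tensor2 (n - 1) S) (-k ^ 2))
    (u : S → ℝ → ℝ) (hu : QuasiSpherical.IsQuasiSphericalSolution k F N u)
    (ρ : ℝ) (hρ : 0 ≤ ρ) :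
    (∀ s : ℝ, 0 ≤ s → Integrable
      (fun p => (QuasiSpherical.leafH₀ k F N p s - QuasiSpherical.leafH k F N u p s) •
        QuasiSpherical.equidistant k F N p s)
      (QuasiSpherical.riemannianVolume (QuasiSpherical.leafMetric k F N s))) ∧
    Integrable
      (fun p => ((u p ρ)⁻¹ * (u p ρ - 1) ^ 2) •
        ((QuasiSpherical.leafScalar k F N p ρ + (n - 1) * (n - 2) * k ^ 2) •
            ((1 / 2 : ℝ) • QuasiSpherical.equidistant k F N p ρ)
          + QuasiSpherical.leafH₀ k F N p ρ • QuasiSpherical.velocity k F N p ρ))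
      (QuasiSpherical.riemannianVolume (QuasiSpherical.leafMetric k F N ρ)) ∧
    HasDerivWithinAt
      (fun s => ∫ p, (QuasiSpherical.leafH₀ k F N p s - QuasiSpherical.leafH k F N u p s) •
          QuasiSpherical.equidistant k F N p s
        ∂QuasiSpherical.riemannianVolume (QuasiSpherical.leafMetric k F N s))
      (-∫ p, ((u p ρ)⁻¹ * (u p ρ - 1) ^ 2) •
          ((QuasiSpherical.leafScalar k F N p ρ + (n - 1) * (n - 2) * k ^ 2) •
              ((1 / 2 : ℝ) • QuasiSpherical.equidistant k F N p ρ)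
            + QuasiSpherical.leafH₀ k F N p ρ • QuasiSpherical.velocity k F N p ρ)
        ∂QuasiSpherical.riemannianVolume (QuasiSpherical.leafMetric k F N ρ))
      (Set.Ici 0) ρ := by
  have hn1 : 1 ≤ n := by omega
  -- The only use of the curvature bound, of connectedness and of the region: regularity of all
  -- leaves with s ≥ 0.
  have H := fun s hs => hF.isImmersed_leaf hk hn hK (s := s) hs
  refine ⟨fun s hs => QuasiSpherical.integrable_riemannianVolume (H s hs).continuousOn_sqrt_det
    (QuasiSpherical.continuous_integrand hk.ne' hF.smooth hF.normal_smooth hs (H s hs) hu),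
    QuasiSpherical.integrable_riemannianVolume (H ρ hρ).continuousOn_sqrt_det
      (QuasiSpherical.continuous_dissipationField hn1 hk.ne' hρ (H ρ hρ) hu), ?_⟩
  have h := QuasiSpherical.hasDerivWithinAt_integral_leaf hn1 hk.ne' hF.smooth hF.normal_smooth H
    hu hρ
  rw [QuasiSpherical.integral_variationField hn1 hk.ne' hρ (H ρ hρ) hu] at h
  exact h
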